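/- All Lie algebras are over $\mathbb C$; fix $t\in\mathbb C$, $t\neq 0$. "Elements $x,y,z$ present the Lie algebra $L$ with relations $R$" means: $x,y,z$ generate $L$, and the kernel of the map from the free Lie algebra on $x,y,z$ to $L$ is the ideal generated by $R$ (all relations between $x,y,z$ follow from $R$). Write $z_i=(\operatorname{ad}x)^i z$. **Algebras.** For $\lambda\in\mathbb C$ let $U_\lambda=U(\mathfrak{sl}(2))/(\Delta-\lambda^2+1)$, where $\Delta=2(X^+X^-+X^-X^+)+H^2$ and $[X^+,X^-]=H$, $[H,X^\pm]=\pm2X^\pm$, viewed as a Lie algebra with respect to the commutator. The homomorphism $$X^-\mapsto-\tfrac{d}{du},\quad H\mapsto 2u\tfrac{d}{du}-(\lambda-1),\quad X^+\mapsto u^2\tfrac{d}{du}-(\lambda-1)u$$ from $U_\lambda$ to the algebra of differential operators on $\mathbb C[u]$ is injective, and elements of $U_\lambda$ are written as differential operators through it. Let $\mathfrak{sl}(\lambda)=U_\lambda/\mathbb C$ for $\lambda\notin\mathbb Z\setminus\{0\}$, and $\mathfrak{sl}(\lambda)=U_\lambda/(J_n+\mathbb C)$ for $\lambda=\pm n$,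 $n\ge1$ an integer, where $J_n$ is the kernel of the representation of $U_\lambda$ by $n\times n$ matrices $X^+\mapsto\sum_i i(n-i)E_{i,i+1}$, $X^-\mapsto\sum_i E_{i+1,i}$. Let $\mathfrak{o/sp}(\lambda)\subset U_\lambda$ be the Lie subalgebra $\{a:\tau(a)=-a\}$, where $\tau$ is the antiautomorphism of $U_\lambda$ with $\tau(g)=-g$ for $g\in\mathfrak{sl}(2)$. Let $\mathfrak{sl}(*)$ be the Lie algebra, with respect to the Poisson bracket $\{x,y\}=h$, $\{h,x\}=2x$, $\{h,y\}=-2y$, of polynomial functions on the hyperboloid $4xy+h^2=1$, modulo constants, and let $\mathfrak{o/sp}(*)$ be the Lie algebra of odd polynomial functions on this hyperboloid. **Relations.** Type 0: $[[x,y],x]=2x$, $[[x,y],y]=-2y$. Type 1, with $2k_2=4$ for $\mathfrak{sl}$ and $2k_2=6$ for $\mathfrak{o/sp}$: $[y,z]=0$, $[[x,y],z]=-2k_2z$, $z_{2k_2+1}=0$. Types 2 and 3 for $\mathfrak{sl}$, with parameters $a,b$: $$3[z_1,z_2]-2[z,z_3]=24a\,y,\quad [z,[z,z_1]]=0,\quad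 4[z_3,[z,z_1]]-3[z_2,[z,z_2]]=576b\,z.$$ Types 2 and 3 for $\mathfrak{o/sp}$, with parameters $a,b,c$: $$2[z_1,z_2]-[z,z_3]=72a\,z,\quad 9[z_2,z_3]-5[z_1,z_4]=216a\,z_2+432b\,y,$$ $$[z,[z,z_1]]=0,\quad 7[z_3,[z,z_1]]-6[z_2,[z,z_2]]=720c\,[z,z_1].$$ **Theorem 2.6.** 1. For every $\lambda\in\mathbb C$, the elements $x=u^2\frac d{du}-(\lambda-1)u$, $y=-\frac d{du}$, $z=t\frac{d^2}{du^2}$ present $U_\lambda/\mathbb C$ (which is $\mathfrak{sl}(\lambda)$ if $\lambda\notin\mathbb Z\setminus\{0\}$) with the relations of types 0, 1 and 2, 3 for $\mathfrak{sl}$, where $a=t^2(\lambda^2-4)$, $b=t^2(\lambda^2-9)$. For $\lambda=\pm n$ with an integer $n\ge2$, the same elements present $\mathfrak{sl}(\lambda)$ with these relations and the dimension-shearing relation $(\operatorname{ad}z_1)^{n-2}z=0$. 2. For every $\lambda\in\mathbb C$, the elements $x,y$ as above and $z=-t\frac{d^3}{du^3}$ present $\mathfrak{o/sp}(\lambda)$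 with the relations of types 0, 1 and 2, 3 for $\mathfrak{o/sp}$, where $a=t(\lambda^2-19)$, $b=t^2(\lambda^2-4)(\lambda^2-9)$, $c=t(\lambda^2-49)$. For $\lambda=\pm N$ with $N\in\{2n,2n+1\}$ and an integer $n\ge1$, the same elements present the quotient $\mathfrak{o/sp}(\lambda)/(\mathfrak{o/sp}(\lambda)\cap J_N)$ (that is, $\mathfrak{sp}(2n)$ or $\mathfrak o(2n+1)$) with these relations and the dimension-shearing relation $(\operatorname{ad}z_1)^{n-1}z=0$. 3. The elements $x$, $y$, $z=ty^2$ present $\mathfrak{sl}(*)$ with the relations of types 0, 1 and 2, 3 for $\mathfrak{sl}$, where $a=b=t^2$. The elements $x$, $y$, $z=ty^3$ present $\mathfrak{o/sp}(*)$ with the relations of types 0, 1 and 2, 3 for $\mathfrak{o/sp}$, where $a=c=t$, $b=t^2$. Moreover $\mathfrak{sl}(*)$ and $\mathfrak{o/sp}(*)$ are the limits as $\lambda\to\infty$: an element $r$ of the free Lie algebra on $x,y,z$ vanishes in $\mathfrak{sl}(*)$ (in $\mathfrak{o/sp}(*)$) if and only if there is a polynomial $r(s)$ in $s$ with coefficients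 in the free Lie algebra such that $r(0)=r$ and $r(1/\lambda)$ vanishes in $U_\lambda/\mathbb C$ (in $\mathfrak{o/sp}(\lambda)$) for all $\lambda\in\mathbb C\setminus\{0\}$, with $t$ replaced by $t/\lambda$ (by $t/\lambda^2$) in the generator $z$. -/

import Mathlib

open Polynomial

-- An associative algebra is regarded as a Lie algebra through the commutator.
attribute [local instance 100] LieRing.ofAssociativeRing

namespace ComplexSize

noncomputable section

/-! ### Presentations of Lie algebras -/

/-- Labels of the three Jacobson generators. -/
inductive Gen where
  | x : Gen
  | y : Gen
  | z : Gen

/-- The free Lie algebra over `ℂ` on `x`, `y`, `z`. -/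
abbrev Free : Type := FreeLieAlgebra ℂ Gen

/-- The assignment `x ↦ a`, `y ↦ b`, `z ↦ c`. -/
def triple {L : Type} (a b c : L) : Gen → L
  | .x => a
  | .y => b
  | .z => c

/-- The homomorphism from the free Lie algebra given by the assignment `x ↦ a`, `y ↦ b`,
`z ↦ c`. -/
def evalHom {L : Type} [LieRing L] [LieAlgebra ℂ L] (a b c : L) : Free →ₗ⁅ℂ⁆ L :=
  FreeLieAlgebra.lift ℂ (triple a b c)

/-- The elements `a`, `b`, `c` generate the Lie algebra `L`, and all relations between them (that
is, the kernel of the map from the free Lie algebra) follow from the relations `r = 0`, `r ∈ R`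
(that is, this kernel is the ideal generated by `R`). -/
def IsPresentedBy {L : Type} [LieRing L] [LieAlgebra ℂ L] (a b c : L) (R : Set Free) : Prop :=
  Function.Surjective (evalHom a b c) ∧ (evalHom a b c).ker = LieSubmodule.lieSpan ℂ Free R

/-- The free generator `x`. -/
def fX : Free := FreeLieAlgebra.of ℂ Gen.x

/-- The free generator `y`. -/
def fY : Free := FreeLieAlgebra.of ℂ Gen.y

/-- `fZ i` is `z_i = (ad x)^i z`; in particular `fZ 0 = z`. -/
def fZ (i : ℕ) : Free := ((LieAlgebra.ad ℂ Free fX) ^ i) (FreeLieAlgebra.of ℂ Gen.z)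

/-- The relations of type 0. -/
def rel0 : Set Free :=
  {⁅⁅fX, fY⁆, fX⁆ - (2 : ℂ) • fX, ⁅⁅fX, fY⁆, fY⁆ + (2 : ℂ) • fY}

/-- The relations of type 1, for the lowest weight vector `z` of the module `L^m`, `m = 2 k₂`. -/
def rel1 (m : ℕ) : Set Free :=
  {⁅fY, fZ 0⁆, ⁅⁅fX, fY⁆, fZ 0⁆ + (m : ℂ) • fZ 0, fZ (m + 1)}

/-- The relations of types 2 and 3 of the series `sl`, with structure parameters `a`, `b`. -/
def relSl23 (a b : ℂ) : Set Free :=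
  {(3 : ℂ) • ⁅fZ 1, fZ 2⁆ - (2 : ℂ) • ⁅fZ 0, fZ 3⁆ - (24 * a) • fY,
   ⁅fZ 0, ⁅fZ 0, fZ 1⁆⁆,
   (4 : ℂ) • ⁅fZ 3, ⁅fZ 0, fZ 1⁆⁆ - (3 : ℂ) • ⁅fZ 2, ⁅fZ 0, fZ 2⁆⁆ - (576 * b) • fZ 0}

/-- The relations of types 2 and 3 of the series `o/sp`, with structure parameters
`a`, `b`, `c`. -/
def relOsp23 (a b c : ℂ) : Set Free :=
  {(2 : ℂ) • ⁅fZ 1, fZ 2⁆ - ⁅fZ 0, fZ 3⁆ - (72 * a) • fZ 0,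
   (9 : ℂ) • ⁅fZ 2, fZ 3⁆ - (5 : ℂ) • ⁅fZ 1, fZ 4⁆ - (216 * a) • fZ 2 - (432 * b) • fY,
   ⁅fZ 0, ⁅fZ 0, fZ 1⁆⁆,
   (7 : ℂ) • ⁅fZ 3, ⁅fZ 0, fZ 1⁆⁆ - (6 : ℂ) • ⁅fZ 2, ⁅fZ 0, fZ 2⁆⁆
     - (720 * c) • ⁅fZ 0, fZ 1⁆}

/-- All relations (of types 0, 1, 2, 3) for `sl(lam)`. -/
def relSl (lam t : ℂ) : Set Free :=
  rel0 ∪ rel1 4 ∪ relSl23 (t ^ 2 * (lam ^ 2 - 4)) (t ^ 2 * (lam ^ 2 - 9))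

/-- All relations (of types 0, 1, 2, 3) for `o/sp(lam)`. -/
def relOsp (lam t : ℂ) : Set Free :=
  rel0 ∪ rel1 6 ∪
    relOsp23 (t * (lam ^ 2 - 19)) (t ^ 2 * ((lam ^ 2 - 4) * (lam ^ 2 - 9))) (t * (lam ^ 2 - 49))

/-- The dequantized relations for `sl(*)`: the limits of those for `sl(lam)` under
`t ↦ t / lam`, `lam → ∞`. -/
def relSlStar (t : ℂ) : Set Free :=
  rel0 ∪ rel1 4 ∪ relSl23 (t ^ 2) (t ^ 2)

/-- The dequantized relations for `o/sp(*)`: the limits of those for `o/sp(lam)` under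
`t ↦ t / lam ^ 2`, `lam → ∞`. -/
def relOspStar (t : ℂ) : Set Free :=
  rel0 ∪ rel1 6 ∪ relOsp23 t (t ^ 2) t

/-- The left-hand side `(ad z₁)^k z` of the dimension-shearing relation. -/
def shear (k : ℕ) : Free := ((LieAlgebra.ad ℂ Free (fZ 1)) ^ k) (fZ 0)

/-! ### The associative algebra `U(sl(2)) / (Δ - lam² + 1)` -/

/-- The Lie algebra `sl(2)` of traceless matrices. -/
abbrev Sl2 : Type := LieAlgebra.SpecialLinear.sl (Fin 2) ℂ

/-- `X⁺ = E₁₂`. -/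
def sl2X : Sl2 := LieAlgebra.SpecialLinear.single 0 1 (by decide) 1

/-- `X⁻ = E₂₁`. -/
def sl2Y : Sl2 := LieAlgebra.SpecialLinear.single 1 0 (by decide) 1

/-- `H = E₁₁ - E₂₂`. -/
def sl2H : Sl2 := LieAlgebra.SpecialLinear.singleSubSingle 0 1 1

/-- The universal enveloping algebra of `sl(2)`. -/
abbrev USl2 : Type := UniversalEnvelopingAlgebra ℂ Sl2

/-- The canonical map `sl(2) → U(sl(2))`. -/
abbrev iotaU : Sl2 →ₗ⁅ℂ⁆ USl2 := UniversalEnvelopingAlgebra.ι ℂ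

/-- The Casimir element `Δ = 2 (X⁺ X⁻ + X⁻ X⁺) + H²` of `U(sl(2))`. -/
def casimir : USl2 :=
  (2 : ℂ) • (iotaU sl2X * iotaU sl2Y + iotaU sl2Y * iotaU sl2X) + iotaU sl2H ^ 2

/-- The relation `Δ = lam² - 1`. -/
def CasimirRel (lam : ℂ) (a b : USl2) : Prop :=
  a = casimir ∧ b = algebraMap ℂ USl2 (lam ^ 2 - 1)

/-- The quotient of `U(sl(2))` by the two-sided ideal generated by `Δ - lam² + 1`. -/
abbrev U (lam : ℂ) : Type := RingQuot (CasimirRel lam)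

/-- The image of an element of `sl(2)` in `U lam`. -/
def toU (lam : ℂ) (g : Sl2) : U lam := RingQuot.mkAlgHom ℂ (CasimirRel lam) (iotaU g)

/-- `X⁺` in `U lam`. -/
def uX (lam : ℂ) : U lam := toU lam sl2X

/-- `X⁻` in `U lam`. -/
def uY (lam : ℂ) : U lam := toU lam sl2Y

/-- `H` in `U lam`. -/
def uH (lam : ℂ) : U lam := toU lam sl2H

/-- A triple `x, y, h` of elements of an associative algebra that satisfy the commutation relations
of `sl(2)` gives a homomorphism of Lie algebras from `sl(2)`. -/
def sl2Hom {A : Type} [Ring A] [Algebra ℂ A] (x y h : A) (hxy : x * y - y * x = h)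
    (hhx : h * x - x * h = (2 : ℂ) • x) (hhy : h * y - y * h = -((2 : ℂ) • y)) :
    Sl2 →ₗ⁅ℂ⁆ A where
  toFun g := g.val 0 1 • x + g.val 1 0 • y + g.val 0 0 • h
  map_add' g g' := by
    have h1 (i j : Fin 2) : (g + g').val i j = g.val i j + g'.val i j := rfl
    rw [h1, h1, h1]
    module
  map_smul' c g := by
    have h1 (i j : Fin 2) : (c • g).val i j = c * g.val i j := rfl
    rw [h1, h1, h1, RingHom.id_apply]
    module
  map_lie' := by
    intro g g'
    have h1 (i j : Fin 2) : (⁅g, g'⁆ : Sl2).val i j =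
        (g.val i 0 * g'.val 0 j + g.val i 1 * g'.val 1 j) -
          (g'.val i 0 * g.val 0 j + g'.val i 1 * g.val 1 j) := by
      rw [LieAlgebra.SpecialLinear.sl_bracket]
      simp [Matrix.mul_apply, Fin.sum_univ_two]
    have h2 (k : Sl2) : k.val 1 1 = -k.val 0 0 := by
      have h3 : Matrix.trace k.val = 0 := LinearMap.mem_ker.1 k.property
      rw [Matrix.trace_fin_two] at h3
      linear_combination h3
    have e1 : x * y = y * x + h := by rw [← hxy]; abel
    have e2 : h * x = x * h + (2 : ℂ) • x := by rw [← hhx]; abel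
    have e3 : h * y = y * h - (2 : ℂ) • y := by rw [sub_eq_add_neg, ← hhy]; abel
    rw [h1, h1, h1, h2, h2, Ring.lie_def]
    simp only [add_mul, mul_add, smul_mul_smul_comm, e1, e2, e3]
    module

/-- Lifting such a triple to `U lam`, if the Casimir element acts as `lam² - 1`. -/
def U.lift (lam : ℂ) {A : Type} [Ring A] [Algebra ℂ A] (x y h : A) (hxy : x * y - y * x = h)
    (hhx : h * x - x * h = (2 : ℂ) • x) (hhy : h * y - y * h = -((2 : ℂ) • y))
    (hc : (2 : ℂ) • (x * y + y * x) + h ^ 2 = algebraMap ℂ A (lam ^ 2 - 1)) : U lam →ₐ[ℂ] A :=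
  RingQuot.liftAlgHom ℂ
    ⟨UniversalEnvelopingAlgebra.lift ℂ (sl2Hom x y h hxy hhx hhy), by
      rintro a b ⟨rfl, rfl⟩
      rw [AlgHom.commutes, ← hc]
      simp [casimir, iotaU, sl2Hom, sl2X, sl2Y, sl2H]⟩

section lift

variable (lam : ℂ) {A : Type} [Ring A] [Algebra ℂ A] (x y h : A) (hxy : x * y - y * x = h)
    (hhx : h * x - x * h = (2 : ℂ) • x) (hhy : h * y - y * h = -((2 : ℂ) • y))
    (hc : (2 : ℂ) • (x * y + y * x) + h ^ 2 = algebraMap ℂ A (lam ^ 2 - 1))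

theorem U.lift_uX : U.lift lam x y h hxy hhx hhy hc (uX lam) = x := by
  simp [U.lift, uX, toU, sl2Hom, sl2X]

theorem U.lift_uY : U.lift lam x y h hxy hhx hhy hc (uY lam) = y := by
  simp [U.lift, uY, toU, sl2Hom, sl2Y]

theorem U.lift_uH : U.lift lam x y h hxy hhx hhy hc (uH lam) = h := by
  simp [U.lift, uH, toU, sl2Hom, sl2H]

end lift

theorem U.toU_lie (lam : ℂ) (g g' : Sl2) :
    toU lam g * toU lam g' - toU lam g' * toU lam g = toU lam ⁅g, g'⁆ := by
  simp [toU, iotaU, LieHom.map_lie, Ring.lie_def]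

theorem sl2_lie_XY : ⁅sl2X, sl2Y⁆ = sl2H := by
  apply Subtype.ext
  rw [LieAlgebra.SpecialLinear.sl_bracket]
  ext i j
  fin_cases i <;> fin_cases j <;> simp [sl2X, sl2Y, sl2H]

theorem sl2_lie_HX : ⁅sl2H, sl2X⁆ = (2 : ℂ) • sl2X := by
  apply Subtype.ext
  rw [LieAlgebra.SpecialLinear.sl_bracket]
  ext i j
  fin_cases i <;> fin_cases j <;> simp [sl2X, sl2H, sub_mul, mul_sub]; norm_num

theorem sl2_lie_HY : ⁅sl2H, sl2Y⁆ = (-2 : ℂ) • sl2Y := by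
  apply Subtype.ext
  rw [LieAlgebra.SpecialLinear.sl_bracket]
  ext i j
  fin_cases i <;> fin_cases j <;> simp [sl2Y, sl2H, sub_mul, mul_sub]; norm_num

theorem uX_uY (lam : ℂ) : uX lam * uY lam - uY lam * uX lam = uH lam := by
  rw [uX, uY, uH, U.toU_lie, sl2_lie_XY]

theorem uH_uX (lam : ℂ) : uH lam * uX lam - uX lam * uH lam = (2 : ℂ) • uX lam := by
  rw [uX, uH, U.toU_lie, sl2_lie_HX, toU, toU, map_smul, map_smul]

theorem uH_uY (lam : ℂ) : uH lam * uY lam - uY lam * uH lam = -((2 : ℂ) • uY lam) := by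
  rw [uY, uH, U.toU_lie, sl2_lie_HY, toU, toU, map_smul, map_smul, neg_smul]

theorem u_casimir (lam : ℂ) :
    (2 : ℂ) • (uX lam * uY lam + uY lam * uX lam) + uH lam ^ 2 =
      algebraMap ℂ (U lam) (lam ^ 2 - 1) := by
  have h := RingQuot.mkAlgHom_rel ℂ (s := CasimirRel lam) ⟨rfl, rfl⟩
  rw [AlgHom.commutes] at h
  rw [← h]
  simp [casimir, uX, uY, uH, toU]

/-! ### The realization by differential operators -/

/-- The operator `d/du` on `ℂ[u]`. -/
def opD : Module.End ℂ ℂ[X] := derivative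

/-- The operator of multiplication by `u` on `ℂ[u]`. -/
def opU : Module.End ℂ ℂ[X] := LinearMap.mulLeft ℂ X

theorem C2 : (C (2 : ℂ) : ℂ[X]) = 2 := map_ofNat C 2

/-- The homomorphism from `U lam` to differential operators:
`X⁺ ↦ u² d/du - (lam - 1) u`, `X⁻ ↦ - d/du`, `H ↦ 2 u d/du - (lam - 1)`. -/
def realization (lam : ℂ) : U lam →ₐ[ℂ] Module.End ℂ ℂ[X] :=
  U.lift lam (opU ^ 2 * opD - (lam - 1) • opU) (-opD) ((2 : ℂ) • (opU * opD) - (lam - 1) • 1)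
    (by
      refine LinearMap.ext fun p => ?_
      simp [opD, opU, pow_two, smul_eq_C_mul, C2]
      ring)
    (by
      refine LinearMap.ext fun p => ?_
      simp [opD, opU, pow_two, smul_eq_C_mul, C2]
      ring)
    (by
      refine LinearMap.ext fun p => ?_
      simp [opD, opU, smul_eq_C_mul, C2]
      ring)
    (by
      refine LinearMap.ext fun p => ?_
      simp [opD, opU, pow_two, smul_eq_C_mul, Algebra.algebraMap_eq_smul_one, C2]
      ring)

theorem realization_uX (lam : ℂ) :
    realization lam (uX lam) = opU ^ 2 * opD - (lam - 1) • opU :=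
  U.lift_uX ..

theorem realization_uY (lam : ℂ) : realization lam (uY lam) = -opD :=
  U.lift_uY ..

theorem realization_uY_sq (lam : ℂ) : realization lam (uY lam ^ 2) = opD ^ 2 := by
  rw [map_pow, realization_uY]
  exact neg_sq opD

theorem realization_uY_cube (lam : ℂ) : realization lam (uY lam ^ 3) = -opD ^ 3 := by
  rw [map_pow, realization_uY]
  exact Odd.neg_pow (by decide) opD

/-! ### The Lie algebra `sl(lam)` -/

/-- The ideal of constants in the Lie algebra of an associative algebra. -/
def constants (A : Type) [Ring A] [Algebra ℂ A] : LieIdeal ℂ A where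
  __ := Submodule.span ℂ {(1 : A)}
  lie_mem := by
    intro a m hm
    obtain ⟨c, rfl⟩ := Submodule.mem_span_singleton.1 hm
    have h : ⁅a, c • (1 : A)⁆ = 0 := by simp [Ring.lie_def]
    rw [h]
    exact Submodule.zero_mem _

/-- The Lie algebra `U lam` modulo constants. -/
abbrev Sl (lam : ℂ) : Type := U lam ⧸ constants (U lam)

/-- The class modulo constants. -/
def toSl (lam : ℂ) (a : U lam) : Sl lam := LieSubmodule.Quotient.mk a

/-! ### Integer `lam`: the homomorphism onto matrices of size `n = |lam|` -/

/-- The matrix `∑ i (n - i) E_{i, i+1}` (rows and columns numbered from `1`). -/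
def matX (n : ℕ) : Matrix (Fin n) (Fin n) ℂ :=
  Matrix.of fun i j => if (j : ℕ) = i + 1 then ((i : ℂ) + 1) * (n - (i + 1)) else 0

/-- The matrix `∑ E_{i+1, i}`. -/
def matY (n : ℕ) : Matrix (Fin n) (Fin n) ℂ :=
  Matrix.of fun i j => if (i : ℕ) = j + 1 then 1 else 0

/-- The matrix `diag (n - 1, n - 3, …, 1 - n)`. -/
def matH (n : ℕ) : Matrix (Fin n) (Fin n) ℂ :=
  Matrix.diagonal fun i => (n : ℂ) - 1 - 2 * i

theorem matX_mul_matY (n : ℕ) :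
    matX n * matY n = Matrix.diagonal fun i : Fin n => ((i : ℂ) + 1) * (n - (i + 1)) := by
  ext i j
  rw [Matrix.mul_apply]
  by_cases hi : (i : ℕ) + 1 < n
  · rw [Finset.sum_eq_single (⟨i + 1, hi⟩ : Fin n)]
    · by_cases hij : i = j
      · simp [matX, matY, hij]
      · have : (i : ℕ) ≠ j := fun h => hij (Fin.ext h)
        simp [matX, matY, hij, this]
    · intro k _ hk
      have : (k : ℕ) ≠ i + 1 := fun h => hk (Fin.ext h)
      simp [matX, this]
    · simp
  · have h1 : (i : ℕ) + 1 = n := by omega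
    have h2 : (n : ℂ) - (i + 1) = 0 := by
      have h3 : ((i : ℕ) : ℂ) + 1 = n := by exact_mod_cast h1
      rw [h3, sub_self]
    rw [Finset.sum_eq_zero]
    · by_cases hij : i = j
      · subst hij; simp [h2]
      · simp [hij]
    · intro k _
      simp [matX, h2]

theorem matY_mul_matX (n : ℕ) :
    matY n * matX n = Matrix.diagonal fun i : Fin n => (i : ℂ) * (n - i) := by
  ext i j
  rw [Matrix.mul_apply]
  rcases Nat.eq_zero_or_pos (i : ℕ) with hi | hi
  · rw [Finset.sum_eq_zero]
    · by_cases hij : i = j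
      · subst hij; simp [hi]
      · simp [hij]
    · intro k _
      simp [matY, hi]
  · have h1 : (i : ℕ) - 1 < n := by omega
    have h3 : (i : ℕ) - 1 + 1 = i := by omega
    have h2 : (((i : ℕ) - 1 : ℕ) : ℂ) + 1 = (i : ℂ) := by exact_mod_cast h3
    rw [Finset.sum_eq_single (⟨i - 1, h1⟩ : Fin n)]
    · by_cases hij : i = j
      · subst hij; simp [matX, matY, h2, h3]
      · have : (j : ℕ) ≠ i := fun h => hij (Fin.ext h.symm)
        simp [matX, matY, hij, h3, this]
    · intro k _ hk
      have : (i : ℕ) ≠ k + 1 := fun h => hk (Fin.ext (by simp [h]))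
      simp [matY, this]
    · simp

/-- For `lam = ± n`, the homomorphism from `U lam` to matrices of size `n` (the irreducible
representation of dimension `n`): `X⁺ ↦ ∑ i (n - i) E_{i, i+1}`, `X⁻ ↦ ∑ E_{i+1, i}`. -/
def matRep (lam : ℂ) (n : ℕ) (hn : lam ^ 2 = (n : ℂ) ^ 2) :
    U lam →ₐ[ℂ] Matrix (Fin n) (Fin n) ℂ :=
  U.lift lam (matX n) (matY n) (matH n)
    (by
      rw [matX_mul_matY, matY_mul_matX, matH, Matrix.diagonal_sub]
      congr 1
      ext i
      ring)
    (by
      ext i j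
      simp only [matH, matX, Matrix.sub_apply, Matrix.diagonal_mul, Matrix.mul_diagonal,
        Matrix.of_apply, Matrix.smul_apply, smul_eq_mul]
      split_ifs with h
      · rw [h]; push_cast; ring
      · ring)
    (by
      ext i j
      simp only [matH, matY, Matrix.sub_apply, Matrix.diagonal_mul, Matrix.mul_diagonal,
        Matrix.of_apply, Matrix.smul_apply, Matrix.neg_apply, smul_eq_mul]
      split_ifs with h
      · rw [h]; push_cast; ring
      · ring)
    (by
      rw [matX_mul_matY, matY_mul_matX, matH, Matrix.diagonal_add, pow_two,
        Matrix.diagonal_mul_diagonal, hn, Matrix.algebraMap_eq_diagonal, ← Matrix.diagonal_smul,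
        Matrix.diagonal_add]
      congr 1
      ext i
      simp
      ring)

theorem matRep_uX (lam : ℂ) (n : ℕ) (hn : lam ^ 2 = (n : ℂ) ^ 2) :
    matRep lam n hn (uX lam) = matX n :=
  U.lift_uX ..

theorem matRep_uY (lam : ℂ) (n : ℕ) (hn : lam ^ 2 = (n : ℂ) ^ 2) :
    matRep lam n hn (uY lam) = matY n :=
  U.lift_uY ..

/-- The ideal of the Lie algebra `U lam`, `lam = ± n`, that has the quotient `gl(n)`. -/
def idealJ (lam : ℂ) (n : ℕ) (hn : lam ^ 2 = (n : ℂ) ^ 2) : LieIdeal ℂ (U lam) :=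
  (matRep lam n hn).toLieHom.ker

/-- The Lie algebra `sl(lam)` for `lam = ± n`: the quotient of `U lam` modulo `idealJ` and
constants. -/
abbrev SlInt (lam : ℂ) (n : ℕ) (hn : lam ^ 2 = (n : ℂ) ^ 2) : Type :=
  U lam ⧸ (idealJ lam n hn ⊔ constants (U lam))

/-- The class in `SlInt`. -/
def toSlInt (lam : ℂ) (n : ℕ) (hn : lam ^ 2 = (n : ℂ) ^ 2) (a : U lam) : SlInt lam n hn :=
  LieSubmodule.Quotient.mk a

/-! ### The Lie algebra `o/sp(lam)` -/

/-- The antiautomorphism of `U lam` with `g ↦ -g` on `sl(2)` (as a homomorphism to the opposite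
algebra). -/
def antiHom (lam : ℂ) : U lam →ₐ[ℂ] (U lam)ᵐᵒᵖ :=
  U.lift lam (MulOpposite.op (-uX lam)) (MulOpposite.op (-uY lam)) (MulOpposite.op (-uH lam))
    (by
      rw [← MulOpposite.op_mul, ← MulOpposite.op_mul, ← MulOpposite.op_sub, ← uX_uY lam]
      congr 1
      noncomm_ring)
    (by
      rw [← MulOpposite.op_mul, ← MulOpposite.op_mul, ← MulOpposite.op_sub,
        ← MulOpposite.op_smul, smul_neg, ← uH_uX lam]
      congr 1
      noncomm_ring)
    (by
      rw [← MulOpposite.op_mul, ← MulOpposite.op_mul, ← MulOpposite.op_sub,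
        ← MulOpposite.op_smul, smul_neg, ← MulOpposite.op_neg, ← uH_uY lam]
      congr 1
      noncomm_ring)
    (by
      rw [← MulOpposite.op_mul, ← MulOpposite.op_mul, ← MulOpposite.op_add,
        ← MulOpposite.op_smul, ← MulOpposite.op_pow, ← MulOpposite.op_add,
        MulOpposite.algebraMap_apply, ← u_casimir lam]
      congr 1
      rw [neg_mul_neg, neg_mul_neg, neg_sq, add_comm (uY lam * uX lam)])

/-- The antiautomorphism of `U lam` with `g ↦ -g` on `sl(2)`. -/
def anti (lam : ℂ) (a : U lam) : U lam := (antiHom lam a).unop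

theorem anti_mul (lam : ℂ) (a b : U lam) : anti lam (a * b) = anti lam b * anti lam a := by
  simp [anti]

theorem anti_uX (lam : ℂ) : anti lam (uX lam) = -uX lam := by
  rw [anti, antiHom, U.lift_uX, MulOpposite.unop_op]

theorem anti_uY (lam : ℂ) : anti lam (uY lam) = -uY lam := by
  rw [anti, antiHom, U.lift_uY, MulOpposite.unop_op]

theorem anti_uH (lam : ℂ) : anti lam (uH lam) = -uH lam := by
  rw [anti, antiHom, U.lift_uH, MulOpposite.unop_op]

theorem anti_uY_pow (lam : ℂ) (k : ℕ) : anti lam (uY lam ^ k) = (-1) ^ k * uY lam ^ k := by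
  rw [anti, map_pow, MulOpposite.unop_pow]
  change (anti lam (uY lam)) ^ k = _
  rw [anti_uY, neg_pow]

theorem anti_lie_uX (lam : ℂ) (a : U lam) : anti lam ⁅uX lam, a⁆ = ⁅uX lam, anti lam a⁆ := by
  have h : anti lam (uX lam * a - a * uX lam) =
      anti lam (uX lam * a) - anti lam (a * uX lam) := by simp [anti]
  rw [Ring.lie_def, h, anti_mul, anti_mul, anti_uX, Ring.lie_def]
  noncomm_ring

/-- The Lie algebra `o/sp(lam)`: the fixed points of the involution `a ↦ -anti a` of the Lie algebra
`U lam`. As an `sl(2)`-module, `U lam` is the direct sum of the modules `L^{2k}`, `k ≥ 0`, spanned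
by the elements `(ad X⁺)^i (X⁻)^k`; by `anti_uY_pow` and `anti_lie_uX` this involution multiplies
`L^{2k}` by `(-1)^(k+1)`, so that it is `-1` on `L^{4k}` and `1` on `L^{4k+2}`. -/
def oSp (lam : ℂ) : LieSubalgebra ℂ (U lam) where
  carrier := {a | anti lam a = -a}
  add_mem' := by
    intro a b ha hb
    have h : anti lam (a + b) = anti lam a + anti lam b := by simp [anti]
    rw [Set.mem_ofPred_eq] at ha hb ⊢
    rw [h, ha, hb, neg_add]
  zero_mem' := by simp [anti]
  smul_mem' := by
    intro c a ha
    have h : anti lam (c • a) = c • anti lam a := by simp [anti]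
    rw [Set.mem_ofPred_eq] at ha ⊢
    rw [h, ha, smul_neg]
  lie_mem' := by
    intro a b ha hb
    have h : anti lam (a * b - b * a) = anti lam (a * b) - anti lam (b * a) := by simp [anti]
    change anti lam a = -a at ha
    change anti lam b = -b at hb
    change anti lam ⁅a, b⁆ = -⁅a, b⁆
    rw [Ring.lie_def, h, anti_mul, anti_mul, ha, hb]
    noncomm_ring

/-- The generator `x = X⁺` of `o/sp(lam)`. -/
def ospX (lam : ℂ) : oSp lam := ⟨uX lam, anti_uX lam⟩

/-- The generator `y = X⁻` of `o/sp(lam)`. -/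
def ospY (lam : ℂ) : oSp lam := ⟨uY lam, anti_uY lam⟩

/-- The generator `z = t (X⁻)³ = - t d³/du³` of `o/sp(lam)`. -/
def ospZ (lam t : ℂ) : oSp lam :=
  t • ⟨uY lam ^ 3, by
    change anti lam (uY lam ^ 3) = -uY lam ^ 3
    rw [anti_uY_pow]
    noncomm_ring⟩

/-- The ideal of `o/sp(lam)`, `lam = ± n`, that has the quotient `o(n)` (`n` odd) or `sp(n)`
(`n` even). -/
def idealI (lam : ℂ) (n : ℕ) (hn : lam ^ 2 = (n : ℂ) ^ 2) : LieIdeal ℂ (oSp lam) :=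
  ((matRep lam n hn).toLieHom.comp (oSp lam).incl).ker

/-- The quotient `o(n)` (`n` odd) or `sp(n)` (`n` even) of `o/sp(lam)`, `lam = ± n`. -/
abbrev OspInt (lam : ℂ) (n : ℕ) (hn : lam ^ 2 = (n : ℂ) ^ 2) : Type :=
  oSp lam ⧸ idealI lam n hn

/-- The class in `OspInt`. -/
def toOspInt (lam : ℂ) (n : ℕ) (hn : lam ^ 2 = (n : ℂ) ^ 2) (a : oSp lam) : OspInt lam n hn :=
  LieSubmodule.Quotient.mk a

/-! ### The dequantized algebras `sl(*)` and `o/sp(*)` -/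

/-- The space `ℂ[x, y, h]` of polynomial functions on the dual space of `sl(2)`, to be regarded as a
Lie algebra with respect to the Poisson bracket; the coordinates are numbered
`x = X 0`, `y = X 1`, `h = X 2`. -/
def Pol : Type := MvPolynomial (Fin 3) ℂ

instance : AddCommGroup Pol := inferInstanceAs (AddCommGroup (MvPolynomial (Fin 3) ℂ))

instance : Module ℂ Pol := inferInstanceAs (Module ℂ (MvPolynomial (Fin 3) ℂ))

/-- The Poisson bracket with `{x, y} = h`, `{h, x} = 2 x`, `{h, y} = -2 y`. -/
def poisson (f g : MvPolynomial (Fin 3) ℂ) : MvPolynomial (Fin 3) ℂ :=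
  .X 2 * (.pderiv 0 f * .pderiv 1 g - .pderiv 1 f * .pderiv 0 g) +
    2 * .X 0 * (.pderiv 2 f * .pderiv 0 g - .pderiv 0 f * .pderiv 2 g) -
    2 * .X 1 * (.pderiv 2 f * .pderiv 1 g - .pderiv 1 f * .pderiv 2 g)

theorem pderiv_comm (i j : Fin 3) (f : MvPolynomial (Fin 3) ℂ) :
    MvPolynomial.pderiv i (MvPolynomial.pderiv j f) =
      MvPolynomial.pderiv j (MvPolynomial.pderiv i f) := by
  induction f using MvPolynomial.induction_on with
  | C a => simp
  | add p q hp hq => simp only [map_add, hp, hq]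
  | mul_X p k hp =>
    have h (i : Fin 3) : MvPolynomial.pderiv i (MvPolynomial.X k : MvPolynomial (Fin 3) ℂ) =
        MvPolynomial.C (if k = i then 1 else 0) := by
      rw [MvPolynomial.pderiv_X, Pi.single_apply]
      split_ifs <;> simp
    simp only [MvPolynomial.pderiv_mul, map_add, h, hp, MvPolynomial.pderiv_C]
    ring

theorem poisson_jacobi (f g k : MvPolynomial (Fin 3) ℂ) :
    poisson f (poisson g k) = poisson (poisson f g) k + poisson g (poisson f k) := by
  have h01 (f) := pderiv_comm 1 0 f
  have h02 (f) := pderiv_comm 2 0 f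
  have h12 (f) := pderiv_comm 2 1 f
  have h2 (i : Fin 3) : MvPolynomial.pderiv i (2 : MvPolynomial (Fin 3) ℂ) = 0 :=
    (MvPolynomial.pderiv i).map_natCast 2
  simp only [poisson, map_add, map_sub, MvPolynomial.pderiv_mul, MvPolynomial.pderiv_X, h2, h01,
    h02, h12]
  simp
  ring

theorem poisson_add_left (f g k : MvPolynomial (Fin 3) ℂ) :
    poisson (f + g) k = poisson f k + poisson g k := by
  simp only [poisson, map_add]
  ring

theorem poisson_add_right (f g k : MvPolynomial (Fin 3) ℂ) :
    poisson f (g + k) = poisson f g + poisson f k := by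
  simp only [poisson, map_add]
  ring

theorem poisson_self (f : MvPolynomial (Fin 3) ℂ) : poisson f f = 0 := by
  simp only [poisson]
  ring

theorem poisson_smul_right (c : ℂ) (f g : MvPolynomial (Fin 3) ℂ) :
    poisson f (c • g) = c • poisson f g := by
  have h (i : Fin 3) : MvPolynomial.pderiv i (c • g) = c • MvPolynomial.pderiv i g :=
    (MvPolynomial.pderiv i).map_smul c g
  simp only [poisson, h]
  simp only [MvPolynomial.smul_eq_C_mul]
  ring

instance : LieRing Pol where
  bracket := poisson
  add_lie := poisson_add_left
  lie_add := poisson_add_right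
  lie_self := poisson_self
  leibniz_lie := poisson_jacobi

instance : LieAlgebra ℂ Pol where
  lie_smul := poisson_smul_right

/-- The polynomial `4 x y + h² - 1`; its zero set is a hyperboloid, an orbit of the coadjoint
representation of `sl(2)`. -/
def hyperboloid : MvPolynomial (Fin 3) ℂ := 4 * (.X 0 * .X 1) + .X 2 ^ 2 - 1

theorem poisson_hyperboloid (f g : MvPolynomial (Fin 3) ℂ) :
    poisson f (hyperboloid * g) = hyperboloid * poisson f g := by
  have h2 (i : Fin 3) : MvPolynomial.pderiv i (4 : MvPolynomial (Fin 3) ℂ) = 0 :=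
    (MvPolynomial.pderiv i).map_natCast 4
  simp only [poisson, hyperboloid, map_add, map_sub, MvPolynomial.pderiv_mul,
    MvPolynomial.pderiv_X, h2, pow_two]
  simp
  ring

/-- The Lie ideal of the polynomials that vanish on the hyperboloid, that is, of the multiples of
`hyperboloid`. -/
def hyperboloidIdeal : LieIdeal ℂ Pol where
  carrier := {f | ∃ g : MvPolynomial (Fin 3) ℂ, f = hyperboloid * g}
  add_mem' := by
    rintro _ _ ⟨g, rfl⟩ ⟨g', rfl⟩
    exact ⟨g + g', (mul_add hyperboloid g g').symm⟩
  zero_mem' := ⟨0, (mul_zero hyperboloid).symm⟩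
  smul_mem' := by
    rintro c _ ⟨g, rfl⟩
    exact ⟨c • g, (mul_smul_comm c hyperboloid g).symm⟩
  lie_mem := by
    rintro f _ ⟨g, rfl⟩
    exact ⟨poisson f g, poisson_hyperboloid f g⟩

/-- The Poisson Lie algebra of polynomial functions on the hyperboloid `4 x y + h² = 1`. -/
abbrev HypFun : Type := Pol ⧸ hyperboloidIdeal

/-- The restriction of a polynomial to the hyperboloid. -/
def toHyp (f : MvPolynomial (Fin 3) ℂ) : HypFun := LieSubmodule.Quotient.mk (show Pol from f)

theorem toHyp_lie (f g : MvPolynomial (Fin 3) ℂ) : ⁅toHyp f, toHyp g⁆ = toHyp (poisson f g) := rfl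

/-- The ideal of constant functions. -/
def constFun : LieIdeal ℂ HypFun where
  __ := Submodule.span ℂ {toHyp 1}
  lie_mem := by
    intro a m hm
    obtain ⟨c, rfl⟩ := Submodule.mem_span_singleton.1 hm
    obtain ⟨f, rfl⟩ := LieSubmodule.Quotient.surjective_mk' hyperboloidIdeal a
    have h (f : MvPolynomial (Fin 3) ℂ) : ⁅toHyp f, c • toHyp 1⁆ = 0 := by
      have h1 : poisson f 1 = 0 := by simp [poisson]
      rw [lie_smul, toHyp_lie, h1]
      exact smul_zero c
    have h2 := h f
    change ⁅toHyp f, c • toHyp 1⁆ ∈ _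
    rw [h2]
    exact Submodule.zero_mem _

/-- The Lie algebra `sl(*)`: polynomial functions on the hyperboloid modulo constants. -/
abbrev SlStar : Type := HypFun ⧸ constFun

/-- The class modulo constants. -/
def toSlStar (f : MvPolynomial (Fin 3) ℂ) : SlStar := LieSubmodule.Quotient.mk (toHyp f)

/-- The change of sign of all coordinates. -/
def signChange : MvPolynomial (Fin 3) ℂ →ₐ[ℂ] MvPolynomial (Fin 3) ℂ :=
  MvPolynomial.aeval fun i => -.X i

theorem pderiv_signChange (i : Fin 3) (f : MvPolynomial (Fin 3) ℂ) :
    MvPolynomial.pderiv i (signChange f) = -signChange (MvPolynomial.pderiv i f) := by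
  induction f using MvPolynomial.induction_on with
  | C a => simp [signChange]
  | add p q hp hq => simp only [map_add, hp, hq, neg_add]
  | mul_X p k hp =>
    have h : MvPolynomial.pderiv i (MvPolynomial.X k : MvPolynomial (Fin 3) ℂ) =
        MvPolynomial.C (if k = i then 1 else 0) := by
      rw [MvPolynomial.pderiv_X, Pi.single_apply]
      split_ifs <;> simp
    have h1 : signChange (.X k) = -.X k := by simp [signChange]
    have h2 (a : ℂ) : signChange (.C a) = .C a := by simp [signChange]
    simp only [MvPolynomial.pderiv_mul, map_add, map_mul, map_neg, h, hp, h1, h2]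
    ring

/-- The Lie algebra `o/sp(*)`: the odd functions on the hyperboloid, that is, the restrictions of
the polynomials `f` with `f (-x, -y, -h) = -f (x, y, h)`. -/
def oSpStar : LieSubalgebra ℂ HypFun where
  carrier := {a | ∃ f, signChange f = -f ∧ toHyp f = a}
  add_mem' := by
    rintro _ _ ⟨f, hf, rfl⟩ ⟨g, hg, rfl⟩
    exact ⟨f + g, by rw [map_add, hf, hg]; ring, rfl⟩
  zero_mem' := ⟨0, by simp, rfl⟩
  smul_mem' := by
    rintro c _ ⟨f, hf, rfl⟩
    exact ⟨c • f, by rw [map_smul, hf, smul_neg], rfl⟩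
  lie_mem' := by
    rintro _ _ ⟨f, hf, rfl⟩ ⟨g, hg, rfl⟩
    refine ⟨poisson f g, ?_, rfl⟩
    have h (f) (hf : signChange f = -f) (i : Fin 3) :
        signChange (MvPolynomial.pderiv i f) = MvPolynomial.pderiv i f := by
      have h1 := pderiv_signChange i f
      rw [hf, map_neg, neg_inj] at h1
      exact h1.symm
    have h1 (k : Fin 3) : signChange (.X k) = -.X k := by simp [signChange]
    simp only [poisson, map_add, map_sub, map_mul, h f hf, h g hg, h1, map_ofNat]
    ring

/-- The generator `x` of `o/sp(*)`. -/
def ospStarX : oSpStar := ⟨toHyp (.X 0), .X 0, by simp [signChange], rfl⟩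

/-- The generator `y` of `o/sp(*)`. -/
def ospStarY : oSpStar := ⟨toHyp (.X 1), .X 1, by simp [signChange], rfl⟩

/-- The generator `z = t y³` of `o/sp(*)`. -/
def ospStarZ (t : ℂ) : oSpStar :=
  t • ⟨toHyp (.X 1 ^ 3), .X 1 ^ 3, by simp [signChange, Odd.neg_pow (show Odd 3 by decide)], rfl⟩

/-- The limit, as `lam → ∞`, of a family of sets `K lam` of relations: the values at `s = 0` of
the polynomials in `s` with values in the free Lie algebra whose value at `s = 1 / lam` belongs to
`K lam` for all `lam ≠ 0`. -/
def limitAtInfinity (K : ℂ → Set Free) : Set Free :=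
  {r | ∃ (d : ℕ) (c : ℕ → Free), c 0 = r ∧
    ∀ lam : ℂ, lam ≠ 0 → ∑ i ∈ Finset.range (d + 1), (lam⁻¹ ^ i) • c i ∈ K lam}

end

end ComplexSize

set_option linter.unusedSimpArgs false

namespace ComplexSize

/-! ### Lowest weight vectors -/

section LowestWeight

variable {L : Type} [LieRing L] [LieAlgebra ℂ L]

/-! Put N = 4 for sl and N = 6 for o/sp, and z₁ = [x, z]. The argument rests on one sequence of
vectors, Y_m = (ad z₁)^m (-y/N), so that Y₀ is proportional to y, Y₁ = z, and the dimension-shearing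
relation of exponent k says Y_{k+1} = 0. In the concrete algebras Y_m is a nonzero multiple of
y^{m+1} (sl) or y^{2m+1} (o/sp), the lowest weight vector of one irreducible sl(2)-summand.

Upper bound. The relations alone force every Y_m to be a lowest weight vector killed by z, and force
z_j to send Y_m to an explicit combination of vectors (ad x)^i Y_{m'} with m' in {m-1, m, m+1}
(`SlAction`, `OspAction`). This is an induction on m: the first type 2 relation and its images under
ad x, acting on Y_{m+1}, give linear equations for z₂, z₃, ... on Y_{m+2}, solved one after another.
The equation for z₃ degenerates precisely in the step from Y₁ to Y₂, and there the last relation of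
type 3 supplies the missing value; the relation [z, [z, z₁]] = 0 gives [z, Y_m] = 0 for all m
(`lie_lowest_eq_zero`). Hence the vectors (ad x)^i Y_m, with i at most the weight, span a space that
contains x, y, z and is stable under their brackets: every element of the free Lie algebra has a
normal form modulo the relations (`IsFamily.hasNormalForm`).

Lower bound. In a concrete algebra the nonzero Y_m have different weights, so the vectors (ad x)^i
Y_m are linearly independent (`linearIndependent_map_vec`). A normal form in the kernel is therefore
zero, and the kernel is the ideal generated by the relations (`isPresentedBy_of_hasNormalForm`).
With the shearing relation only finitely many Y_m survive, exactly those for which the power of the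
nilpotent Jordan block is nonzero.

Two facts about the concrete algebras remain. The relations in U_λ are checked in a faithful model
by difference operators, where they become polynomial identities in one variable
(`shift_isSlTriple`, `shift_isOspTriple`). Generation holds because the elements (ad x)^i y^k span
(`span_derivation_pow_eq_top`, which serves U_λ and the hyperboloid at once).

Limits. The relations are parametrized by (p, q), equal to (t²λ², t²) or (tλ², t) in the quantum
case and to (t², 0) or (t, 0) in the dequantized one. After rescaling t, with s = 1/λ, they become
(t², t²s²) or (t, ts²). Thus normal forms have coefficients polynomial in s over a basis independent
of s; the family of quotients is flat, and the ideal at s = 0 is the limit of the others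
(`eq_limitAtInfinity`). -/

/-- `x`, `y`, `⁅x, y⁆` satisfy the commutation relations of `sl(2)`. -/
structure IsSl2Pair (x y : L) : Prop where
  lie_x : ⁅⁅x, y⁆, x⁆ = (2 : ℂ) • x
  lie_y : ⁅⁅x, y⁆, y⁆ = -((2 : ℂ) • y)

/-- `v` is a lowest weight vector of weight `-w`. -/
structure IsLowest (x y v : L) (w : ℕ) : Prop where
  lie_y : ⁅y, v⁆ = 0
  lie_h : ⁅⁅x, y⁆, v⁆ = -((w : ℂ) • v)

theorem ad_pow_succ_apply (x v : L) (i : ℕ) :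
    (LieAlgebra.ad ℂ L x ^ (i + 1)) v = ⁅x, (LieAlgebra.ad ℂ L x ^ i) v⁆ := by
  rw [pow_succ']; rfl

theorem ad_pow_add_apply (x v : L) (i j : ℕ) :
    (LieAlgebra.ad ℂ L x ^ (i + j)) v =
      (LieAlgebra.ad ℂ L x ^ i) ((LieAlgebra.ad ℂ L x ^ j) v) := by
  rw [pow_add]; rfl

theorem map_ad_pow {L' : Type} [LieRing L'] [LieAlgebra ℂ L'] (f : L →ₗ⁅ℂ⁆ L') (x v : L) (i : ℕ) :
    f ((LieAlgebra.ad ℂ L x ^ i) v) = (LieAlgebra.ad ℂ L' (f x) ^ i) (f v) := by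
  induction i with
  | zero => rfl
  | succ i ih => rw [ad_pow_succ_apply, ad_pow_succ_apply, LieHom.map_lie, ih]

namespace IsLowest

variable {x y v : L} {w : ℕ}

theorem lie_h_pow (hs : IsSl2Pair x y) (hv : IsLowest x y v w) (i : ℕ) :
    ⁅⁅x, y⁆, (LieAlgebra.ad ℂ L x ^ i) v⁆ =
      (2 * i - w : ℂ) • (LieAlgebra.ad ℂ L x ^ i) v := by
  induction i with
  | zero => simpa using hv.lie_h
  | succ i ih =>
    rw [ad_pow_succ_apply, leibniz_lie, hs.lie_x, ih, smul_lie, lie_smul]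
    push_cast
    module

theorem lie_y_pow (hs : IsSl2Pair x y) (hv : IsLowest x y v w) (i : ℕ) :
    ⁅y, (LieAlgebra.ad ℂ L x ^ (i + 1)) v⁆ =
      ((i + 1) * (w - i) : ℂ) • (LieAlgebra.ad ℂ L x ^ i) v := by
  have hyx : ⁅y, x⁆ = -⁅x, y⁆ := (lie_skew y x).symm
  induction i with
  | zero =>
    have h := hv.lie_h
    rw [ad_pow_succ_apply, pow_zero, Module.End.one_apply, leibniz_lie, hyx, neg_lie, h, hv.lie_y]
    simp
  | succ i ih =>
    rw [ad_pow_succ_apply, leibniz_lie, hyx, ih, neg_lie, hv.lie_h_pow hs, lie_smul,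
      ← ad_pow_succ_apply]
    push_cast
    module

/-- In `lie_y_pow` the factor w - i vanishes only at i = w. Hence, beyond exponent w + 1, applying
ad y to a vanishing power gives a nonzero multiple of the previous power, and the vanishing descends
to w + 1. -/
theorem pow_eq_zero (hs : IsSl2Pair x y) (hv : IsLowest x y v w) {n : ℕ}
    (hn : (LieAlgebra.ad ℂ L x ^ n) v = 0) : (LieAlgebra.ad ℂ L x ^ (w + 1)) v = 0 := by
  have key : ∀ d, (LieAlgebra.ad ℂ L x ^ (w + 1 + d)) v = 0 →
      (LieAlgebra.ad ℂ L x ^ (w + 1)) v = 0 := by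
    intro d
    induction d with
    | zero => exact id
    | succ d ih =>
      intro h
      apply ih
      have h1 := hv.lie_y_pow hs (w + 1 + d)
      rw [add_assoc (w + 1) d 1, h, lie_zero] at h1
      refine (smul_eq_zero.1 h1.symm).resolve_left ?_
      push_cast
      refine mul_ne_zero ?_ ?_
      · exact_mod_cast Nat.succ_ne_zero (w + 1 + d)
      · rw [show (w : ℂ) - (w + 1 + d) = -((d : ℂ) + 1) by ring, neg_ne_zero]
        exact_mod_cast Nat.succ_ne_zero d
  refine key n ?_
  rw [ad_pow_add_apply, hn, map_zero]

end IsLowest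

/-- The vectors `(ad x)^i v_k`, `i ≤ w_k`, for linearly independent lowest weight vectors `v_k` of
weights `-w_k` are linearly independent. -/
theorem linearIndependent_ad_pow {x y : L} (hs : IsSl2Pair x y) {κ : Type} (v : κ → L) (w : κ → ℕ)
    (hv : ∀ k, IsLowest x y (v k) (w k)) (hi : LinearIndependent ℂ v) :
    LinearIndependent ℂ (fun p : {p : κ × ℕ // p.2 ≤ w p.1} =>
      (LieAlgebra.ad ℂ L x ^ p.1.2) (v p.1.1)) := by
  classical
  -- lowering `m` times
  have low : ∀ (m : ℕ) (k : κ) (i : ℕ), i ≤ w k → ∃ c : ℂ, (i = m → c ≠ 0) ∧ (i < m → c = 0) ∧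
      (LieAlgebra.ad ℂ L y ^ m) ((LieAlgebra.ad ℂ L x ^ i) (v k)) =
        c • (LieAlgebra.ad ℂ L x ^ (i - m)) (v k) := by
    intro m
    induction m with
    | zero => exact fun k i _ => ⟨1, by simp, by simp, by simp⟩
    | succ m ih =>
      intro k i hik
      cases i with
      | zero =>
        refine ⟨0, by simp, by simp, ?_⟩
        rw [zero_smul, pow_succ]
        have : (LieAlgebra.ad ℂ L y) (v k) = 0 := (hv k).lie_y
        change (LieAlgebra.ad ℂ L y ^ m) ((LieAlgebra.ad ℂ L y) (v k)) = 0
        rw [this, map_zero]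
      | succ i =>
        obtain ⟨c, h1, h2, h3⟩ := ih k i (by omega)
        refine ⟨(i + 1) * (w k - i) * c, fun h => ?_, fun h => ?_, ?_⟩
        · refine mul_ne_zero (mul_ne_zero (by exact_mod_cast Nat.succ_ne_zero i) ?_) (h1 (by omega))
          rw [sub_ne_zero]
          exact_mod_cast (show w k ≠ i by omega)
        · rw [h2 (by omega), mul_zero]
        · rw [pow_succ]
          change (LieAlgebra.ad ℂ L y ^ m) ⁅y, _⁆ = _
          rw [(hv k).lie_y_pow hs, map_smul, h3, smul_smul, Nat.succ_sub_succ]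
  rw [linearIndependent_iff]
  intro l hl
  by_contra hne
  -- Let m be the largest exponent of ad x that occurs in the dependence. Then (ad y)^m kills all
  -- terms with smaller exponent and turns those with exponent m into nonzero multiples of the v_k,
  -- which are independent.
  obtain ⟨p0, hp0, hmax⟩ := Finset.exists_max_image l.support (fun p => p.1.2)
    (Finsupp.support_nonempty_iff.2 hne)
  set m := p0.1.2 with hm
  choose c hc1 hc2 hc3 using low m
  rw [Finsupp.linearCombination_apply, Finsupp.sum] at hl
  have h1 := congrArg (LieAlgebra.ad ℂ L y ^ m) hl
  rw [map_sum, map_zero] at h1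
  have h2 : ∑ p ∈ l.support, (if p.1.2 = m then l p * c p.1.1 p.1.2 p.2 else 0) • v p.1.1 = 0 := by
    rw [← h1]
    refine Finset.sum_congr rfl fun p hp => ?_
    rw [map_smul, hc3 p.1.1 p.1.2 p.2]
    have h3 := hmax p hp
    split_ifs with h
    · rw [show p.1.2 - m = 0 by omega, smul_smul]; rfl
    · rw [hc2 p.1.1 p.1.2 p.2 (lt_of_le_of_ne h3 h)]; simp
  have h4 : ∑ p ∈ l.support.filter (fun p => p.1.2 = m),
      (l p * c p.1.1 p.1.2 p.2) • v p.1.1 = 0 := by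
    refine (Finset.sum_filter _ _).trans (Eq.trans ?_ h2)
    exact Finset.sum_congr rfl fun p _ => by by_cases h : p.1.2 = m <;> simp [h]
  have h5 : LinearIndependent ℂ
      (fun p : {p : {p : κ × ℕ // p.2 ≤ w p.1} // p.1.2 = m} => v p.1.1.1) := by
    refine hi.comp (fun p : {p : {p : κ × ℕ // p.2 ≤ w p.1} // p.1.2 = m} => p.1.1.1) ?_
    rintro ⟨⟨⟨k, i⟩, hk⟩, hki⟩ ⟨⟨⟨k', i'⟩, hk'⟩, hki'⟩ h
    simp only at hki hki' h
    subst h hki hki'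
    rfl
  have h6 : LinearIndepOn ℂ (fun p : {p : κ × ℕ // p.2 ≤ w p.1} => v p.1.1) {p | p.1.2 = m} := h5
  have h7 := linearIndepOn_iff'.1 h6 (l.support.filter (fun p => p.1.2 = m))
    (fun p => l p * c p.1.1 p.1.2 p.2) (by intro p hp; simpa using (Finset.mem_filter.1 hp).2) h4 p0
    (Finset.mem_filter.2 ⟨hp0, rfl⟩)
  exact (mul_ne_zero (Finsupp.mem_support_iff.1 hp0) (hc1 _ _ _ rfl)) h7

end LowestWeight


/-! ### Consequences of the relations -/

section Relations

variable {L : Type} [LieRing L] [LieAlgebra ℂ L]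

/-- The vector `(ad x)^i v`. -/
def raise (x : L) (i : ℕ) (v : L) : L := (LieAlgebra.ad ℂ L x ^ i) v

theorem raise_zero (x v : L) : raise x 0 v = v := rfl

theorem raise_add (x v : L) (i j : ℕ) : raise x (i + j) v = raise x i (raise x j v) :=
  ad_pow_add_apply x v i j

theorem lie_raise (x v : L) (i : ℕ) : ⁅x, raise x i v⁆ = raise x (i + 1) v :=
  (ad_pow_succ_apply x v i).symm

theorem raise_smul (x v : L) (i : ℕ) (c : ℂ) : raise x i (c • v) = c • raise x i v := by
  simp [raise]

theorem raise_apply_zero (x : L) (i : ℕ) : raise x i (0 : L) = 0 := map_zero _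

theorem lie_raise_succ (x u v : L) (j i : ℕ) :
    ⁅raise x j u, raise x (i + 1) v⁆ =
      ⁅x, ⁅raise x j u, raise x i v⁆⁆ - ⁅raise x (j + 1) u, raise x i v⁆ := by
  rw [leibniz_lie x, lie_raise, lie_raise]
  abel

theorem raise_succ (x : L) (i : ℕ) (v : L) : raise x (i + 1) v = ⁅x, raise x i v⁆ :=
  ad_pow_succ_apply x v i

/-- The Leibniz rule solved for the bracket with x innermost. As a rewriting rule it moves every x
to the outside, until only brackets of z_j with lowest weight vectors are left. -/
theorem lie_raise_lie (x u v : L) (j : ℕ) :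
    ⁅raise x j u, ⁅x, v⁆⁆ = ⁅x, ⁅raise x j u, v⁆⁆ - ⁅raise x (j + 1) u, v⁆ := by
  rw [leibniz_lie x, lie_raise]
  abel

theorem lie_lie_raise (x u v : L) : ⁅u, ⁅x, v⁆⁆ = ⁅x, ⁅u, v⁆⁆ - ⁅raise x 1 u, v⁆ :=
  lie_raise_lie x u v 0

theorem map_raise {L' : Type} [LieRing L'] [LieAlgebra ℂ L'] (f : L →ₗ⁅ℂ⁆ L') (x v : L) (i : ℕ) :
    f (raise x i v) = raise (f x) i (f v) :=
  map_ad_pow f x v i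

/-- The sequence of vectors `Y_m = (ad z₁)^m (-y / N)`; here `z₁ = [x, z]`, and `Y_1 = z` if `z`
is a lowest weight vector of weight `-N`. -/
noncomputable def lowVec (N : ℕ) (x y z : L) (m : ℕ) : L := raise (raise x 1 z) m (-(N : ℂ)⁻¹ • y)

theorem lie_lowVec (N : ℕ) (x y z : L) (m : ℕ) :
    ⁅raise x 1 z, lowVec N x y z m⁆ = lowVec N x y z (m + 1) :=
  lie_raise _ _ _

theorem map_lowVec {L' : Type} [LieRing L'] [LieAlgebra ℂ L'] (f : L →ₗ⁅ℂ⁆ L') (N : ℕ)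
    (x y z : L) (m : ℕ) : f (lowVec N x y z m) = lowVec N (f x) (f y) (f z) m := by
  rw [lowVec, map_raise, map_raise, map_smul, lowVec]

/-- The relations of types 0 and 1: `x`, `y` generate `sl(2)` and `z` is a lowest weight vector of
weight `-N` of its module of dimension `N + 1`. -/
structure IsTriple (N : ℕ) (x y z : L) : Prop where
  pair : IsSl2Pair x y
  low : IsLowest x y z N
  top : raise x (N + 1) z = 0

namespace IsTriple

variable {N : ℕ} {x y z : L} (h : IsTriple N x y z)
include h

theorem lie_y (j : ℕ) :
    ⁅raise x (j + 1) z, y⁆ = -(((j + 1) * (N - j) : ℂ) • raise x j z) := by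
  rw [← lie_skew, raise, h.low.lie_y_pow h.pair, raise]

theorem lie_zero_y : ⁅z, y⁆ = 0 := by rw [← lie_skew, h.low.lie_y, neg_zero]

theorem lowVec_one (hN : N ≠ 0) : lowVec N x y z 1 = z := by
  have h1 : (N : ℂ) ≠ 0 := by exact_mod_cast hN
  have h2 := h.lie_y 0
  rw [← lie_lowVec, lowVec, raise_zero, lie_smul]
  rw [zero_add, raise_zero] at h2
  rw [h2, smul_neg, neg_smul, neg_neg, smul_smul]
  simp [h1]

theorem lie_x_y_x : ⁅x, ⁅x, y⁆⁆ = -((2 : ℂ) • x) := by rw [← lie_skew, h.pair.lie_x]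

end IsTriple

/-- If `⁅z, Y⁆`, `⁅z, Y_m⁆`, `⁅z, Y_{m+1}⁆` vanish and `⁅z, ⁅z₁, z⁆⁆ = 0`, then `⁅z, Y_{m+2}⁆`
vanishes. -/
theorem lie_lowest_eq_zero {x z Y Y' Y'' : L} {α : ℂ} (hz : ⁅z, ⁅z, raise x 1 z⁆⁆ = 0)
    (h0 : ⁅z, Y⁆ = 0) (h1 : ⁅raise x 1 z, Y⁆ = Y') (h2 : ⁅raise x 2 z, Y⁆ = α • raise x 1 Y')
    (h0' : ⁅z, Y'⁆ = 0) (h1' : ⁅raise x 1 z, Y'⁆ = Y'') (hα : 1 + α ≠ 0) : ⁅z, Y''⁆ = 0 := by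
  have e1 : ⁅z, raise x 1 Y⁆ = -Y' := by
    have h := lie_raise_succ x z Y 0 0
    simp only [raise_zero, zero_add] at h
    rw [h, h0, h1, lie_zero, zero_sub]
  have e1' : ⁅z, raise x 1 Y'⁆ = -Y'' := by
    have h := lie_raise_succ x z Y' 0 0
    simp only [raise_zero, zero_add] at h
    rw [h, h0', h1', lie_zero, zero_sub]
  have e2 : ⁅raise x 1 z, raise x 1 Y⁆ = (1 - α) • raise x 1 Y' := by
    have h := lie_raise_succ x z Y 1 0
    simp only [raise_zero, zero_add] at h
    rw [h, h1, h2]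
    have h3 := lie_raise x Y' 0
    rw [raise_zero] at h3
    rw [h3]
    module
  have e3 : ⁅⁅z, raise x 1 z⁆, raise x 1 Y⁆ = α • Y'' := by
    rw [lie_lie, e1, e2, lie_smul, e1', lie_neg, h1']
    module
  have e4 : ⁅⁅z, raise x 1 z⁆, Y'⁆ = ⁅z, Y''⁆ := by rw [lie_lie, h0', h1', lie_zero, sub_zero]
  -- The bracket of z with ⁅⁅z, z₁⁆, ⁅x, Y⁆⁆ is computed in two ways: by `e3` it is α⁅z, Y''⁆, and
  -- by the Leibniz rule, with ⁅z, ⁅z, z₁⁆⁆ = 0, it is -⁅z, Y''⁆.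
  have e5 : ⁅z, ⁅⁅z, raise x 1 z⁆, raise x 1 Y⁆⁆ = -⁅z, Y''⁆ := by
    rw [leibniz_lie, hz, e1, zero_lie, zero_add, lie_neg, e4]
  rw [e3, lie_smul] at e5
  have e6 : (1 + α) • ⁅z, Y''⁆ = 0 := by linear_combination (norm := module) e5
  exact (smul_eq_zero.1 e6).resolve_left hα

/-- The relations of the series `sl` with `a = p - 4 q`, `b = p - 9 q`. -/
structure IsSlTriple (p q : ℂ) (x y z : L) : Prop extends IsTriple 4 x y z where
  rel2 : (3 : ℂ) • ⁅raise x 1 z, raise x 2 z⁆ - (2 : ℂ) • ⁅z, raise x 3 z⁆ = (24 * (p - 4 * q)) • y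
  rel3 : ⁅z, ⁅z, raise x 1 z⁆⁆ = 0
  rel3' : (4 : ℂ) • ⁅raise x 3 z, ⁅z, raise x 1 z⁆⁆ - (3 : ℂ) • ⁅raise x 2 z, ⁅z, raise x 2 z⁆⁆ =
    (576 * (p - 9 * q)) • z

namespace IsSlTriple

variable {p q : ℂ} {x y z : L} (h : IsSlTriple p q x y z)
include h

/-- The relation of type 2 and its first two images under ad x determine z₂, z₃ and z₄, in this
order, on the next lowest weight vector. -/
theorem rel2_raise : ⁅raise x 1 z, raise x 3 z⁆ - (2 : ℂ) • ⁅z, raise x 4 z⁆ =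
    (24 * (p - 4 * q)) • ⁅x, y⁆ := by
  have h1 := congrArg (⁅x, ·⁆) h.rel2
  have h2 := lie_raise x z 0
  rw [raise_zero] at h2
  simp only [lie_sub, lie_smul, leibniz_lie x (raise x _ z), leibniz_lie x z, lie_raise, lie_self,
    h2] at h1
  linear_combination (norm := module) h1

theorem rel2_raise_two : ⁅raise x 2 z, raise x 3 z⁆ - ⁅raise x 1 z, raise x 4 z⁆ =
    -((48 * (p - 4 * q)) • x) := by
  have h1 := congrArg (⁅x, ·⁆) h.rel2_raise
  have h2 := lie_raise x z 0
  rw [raise_zero] at h2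
  simp only [lie_sub, lie_smul, leibniz_lie x (raise x _ z), leibniz_lie x z, lie_raise,
    h2, h.top, lie_zero, h.lie_x_y_x] at h1
  linear_combination (norm := module) h1

/-- The recursion for the action of `z₂` on the lowest weight vectors. -/
theorem recursion_two {Y₀ Y Y' Y'' : L} {w : ℕ} {α₂ α₃ g₃ : ℂ} (hY : IsLowest x y Y w)
    (h0 : ⁅z, Y₀⁆ = 0) (h0' : ⁅z, Y⁆ = 0) (h1' : ⁅raise x 1 z, Y⁆ = Y')
    (h2' : ⁅raise x 2 z, Y⁆ = α₂ • raise x 1 Y')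
    (h3' : ⁅raise x 3 z, Y⁆ = α₃ • raise x 2 Y' + g₃ • Y₀)
    (h0'' : ⁅z, Y'⁆ = 0) (h1'' : ⁅raise x 1 z, Y'⁆ = Y'') :
    (3 * α₂ + 3 + 2 * α₃) • ⁅raise x 2 z, Y'⁆ = (3 * α₂ + 4 * α₃) • raise x 1 Y'' := by
  -- Both sides of the relation act on Y. The action on Y is known, so the inner brackets can be
  -- replaced; moving x outwards leaves a linear equation for the one unknown bracket with Y'. The
  -- other recursions arise in the same way.
  have d := congrArg (⁅·, Y⁆) h.rel2
  simp only [sub_lie, smul_lie, hY.lie_y] at d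
  simp only [lie_lie, h0', h1', h2', h3', lie_add, lie_smul, lie_zero] at d
  simp only [raise_succ x _ Y', raise_zero x Y', lie_raise_lie, lie_lie_raise x z, h0, h0'', h1'',
    lie_zero, lie_sub, lie_smul, Nat.reduceAdd] at d
  rw [raise_succ x 0 Y'', raise_zero]
  linear_combination (norm := module) -d

/-- The recursion for the action of `z₃` on the lowest weight vectors. -/
theorem recursion_three {Y₀ Y Y' Y'' : L} {w : ℕ} {α₃ α₄ g₃ g₄ δ₂ : ℂ} (hY : IsLowest x y Y w)
    (h0 : ⁅z, Y₀⁆ = 0) (h1 : ⁅raise x 1 z, Y₀⁆ = Y)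
    (h0' : ⁅z, Y⁆ = 0) (h1' : ⁅raise x 1 z, Y⁆ = Y')
    (h3' : ⁅raise x 3 z, Y⁆ = α₃ • raise x 2 Y' + g₃ • Y₀)
    (h4' : ⁅raise x 4 z, Y⁆ = α₄ • raise x 3 Y' + g₄ • raise x 1 Y₀)
    (h0'' : ⁅z, Y'⁆ = 0) (h1'' : ⁅raise x 1 z, Y'⁆ = Y'')
    (h2'' : ⁅raise x 2 z, Y'⁆ = δ₂ • raise x 1 Y'') :
    (α₃ - 1 + 2 * α₄) • ⁅raise x 3 z, Y'⁆ =
      ((2 * α₃ + 6 * α₄) * δ₂ - (α₃ + 6 * α₄)) • raise x 2 Y''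
        + (-(g₃ + 2 * g₄ + 24 * (p - 4 * q) * w)) • Y := by
  have d := congrArg (⁅·, Y⁆) h.rel2_raise
  simp only [sub_lie, smul_lie, hY.lie_h] at d
  simp only [lie_lie, h0', h1', h3', h4', lie_add, lie_smul, lie_zero] at d
  simp only [raise_succ x _ Y', raise_zero x Y', raise_succ x _ Y'', raise_zero x Y'',
    raise_succ x _ Y₀, raise_zero x Y₀, lie_raise_lie, lie_lie_raise x z, h0, h1, h0'', h1'',
    h2'', lie_zero, lie_sub, lie_smul, Nat.reduceAdd] at d ⊢
  linear_combination (norm := module) d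

/-- The recursion for the action of `z₄` on the lowest weight vectors. -/
theorem recursion_four {Y₀ Y Y' Y'' : L} {α₂ α₃ α₄ g₃ g₄ β δ₂ δ₃ e₃ : ℂ}
    (h1 : ⁅raise x 1 z, Y₀⁆ = Y) (h2 : ⁅raise x 2 z, Y₀⁆ = β • raise x 1 Y)
    (h1' : ⁅raise x 1 z, Y⁆ = Y')
    (h2' : ⁅raise x 2 z, Y⁆ = α₂ • raise x 1 Y')
    (h3' : ⁅raise x 3 z, Y⁆ = α₃ • raise x 2 Y' + g₃ • Y₀)
    (h4' : ⁅raise x 4 z, Y⁆ = α₄ • raise x 3 Y' + g₄ • raise x 1 Y₀)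
    (h1'' : ⁅raise x 1 z, Y'⁆ = Y'')
    (h2'' : ⁅raise x 2 z, Y'⁆ = δ₂ • raise x 1 Y'')
    (h3'' : ⁅raise x 3 z, Y'⁆ = δ₃ • raise x 2 Y'' + e₃ • Y) :
    (α₃ + α₂ + α₄ + 1) • ⁅raise x 4 z, Y'⁆ =
      (-((α₃ + 3 * α₄) * δ₂) + (2 * α₃ + α₂ + 3 * α₄) * δ₃ + α₄) • raise x 3 Y''
        + ((2 * α₃ + α₂ + 3 * α₄) * e₃ - g₃ * β + g₄ * (1 - β) - 48 * (p - 4 * q)) •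
          raise x 1 Y := by
  have d := congrArg (⁅·, Y⁆) h.rel2_raise_two
  simp only [sub_lie, smul_lie, neg_lie] at d
  simp only [lie_lie, h1', h2', h3', h4', lie_add, lie_smul, lie_zero] at d
  simp only [raise_succ x _ Y', raise_zero x Y', raise_succ x _ Y'', raise_zero x Y'',
    raise_succ x _ Y, raise_zero x Y, raise_succ x _ Y₀, raise_zero x Y₀,
    lie_raise_lie, h1, h1'', h2, h2'', h3'', lie_zero, lie_sub, lie_add,
    lie_smul, Nat.reduceAdd] at d ⊢
  linear_combination (norm := module) d

end IsSlTriple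

end Relations

/-! ### The series sl: closed formulas for the action on the lowest weight vectors -/

section

variable {L : Type} [LieRing L] [LieAlgebra ℂ L]

/-- The weight of the vector `Y_m` is `-lowWt N m`. -/
def lowWt (N m : ℕ) : ℕ := 2 + m * (N - 2)

theorem IsTriple.isLowest_zero {N : ℕ} {x y z : L} (h : IsTriple N x y z) :
    IsLowest x y (lowVec N x y z 0) (lowWt N 0) := by
  refine ⟨?_, ?_⟩
  · simp [lowVec, raise_zero]
  · rw [lowVec, raise_zero, lie_smul, h.pair.lie_y]
    simp only [lowWt, zero_mul, add_zero]
    push_cast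
    module

/-- The bracket of y with z₁ is a multiple of z, which kills Y_m, so y kills [z₁, Y_m]; the weight
grows by N - 2, the weight of z₁ up to sign. -/
theorem IsTriple.isLowest_succ {N : ℕ} (hN : 2 ≤ N) {x y z : L} (h : IsTriple N x y z) {m : ℕ}
    (hm : IsLowest x y (lowVec N x y z m) (lowWt N m)) (hz : ⁅z, lowVec N x y z m⁆ = 0) :
    IsLowest x y (lowVec N x y z (m + 1)) (lowWt N (m + 1)) := by
  have h1 := h.low.lie_y_pow h.pair 0
  have h2 := h.low.lie_h_pow h.pair 1
  change ⁅y, raise x 1 z⁆ = _ • z at h1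
  change ⁅⁅x, y⁆, raise x 1 z⁆ = _ • raise x 1 z at h2
  refine ⟨?_, ?_⟩
  · rw [← lie_lowVec, leibniz_lie, h1, smul_lie, hz, hm.lie_y, lie_zero, smul_zero, add_zero]
  · rw [← lie_lowVec, leibniz_lie, h2, smul_lie, hm.lie_h, lie_neg, lie_smul, lowWt, lowWt]
    obtain ⟨n, rfl⟩ := Nat.exists_eq_add_of_le hN
    rw [Nat.add_sub_cancel_left]
    push_cast
    module

theorem eq_smul_of_smul_eq {c d e : ℂ} {u v : L} (h : c • u = d • v) (hc : c ≠ 0)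
    (hd : d = c * e) : u = e • v := by
  refine smul_right_injective L hc ?_
  simp only [h, hd, smul_smul]

theorem eq_smul_add_smul_of_smul_eq {c d f e g : ℂ} {u v w : L} (h : c • u = d • v + f • w)
    (hc : c ≠ 0) (hd : d = c * e) (hf : f = c * g) : u = e • v + g • w := by
  refine smul_right_injective L hc ?_
  simp only [h, hd, hf, smul_smul, smul_add]

/-- The action of the vectors `z_i` on the lowest weight vectors `Y_m` in the series `sl`. -/
structure SlAction (p q : ℂ) (x y z : L) (m : ℕ) : Prop where
  low : IsLowest x y (lowVec 4 x y z m) (lowWt 4 m)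
  zero : ⁅z, lowVec 4 x y z m⁆ = 0
  two : ⁅raise x 2 z, lowVec 4 x y z m⁆ =
    (3 / (m + 2) : ℂ) • raise x 1 (lowVec 4 x y z (m + 1))
  three : ⁅raise x 3 z, lowVec 4 x y z m⁆ =
    (9 / ((m + 2) * (2 * m + 3)) : ℂ) • raise x 2 (lowVec 4 x y z (m + 1)) +
      (-(48 * (m + 1) * m ^ 2 * (p - (m + 1) ^ 2 * q) / (2 * m + 3)) : ℂ) •
        lowVec 4 x y z (m - 1)
  four : ⁅raise x 4 z, lowVec 4 x y z m⁆ =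
    (6 / ((m + 1) * (m + 2) * (2 * m + 3)) : ℂ) • raise x 3 (lowVec 4 x y z (m + 1)) +
      (-(96 * (m + 1) * m * (p - (m + 1) ^ 2 * q) / (2 * m + 3)) : ℂ) •
        raise x 1 (lowVec 4 x y z (m - 1))

namespace IsSlTriple

variable {p q : ℂ} {x y z : L} (h : IsSlTriple p q x y z)
include h

/-- Since Y₀ is a multiple of y, only the sl(2)-module generated by z matters. The terms with
Y_{m-1} carry a factor m, so that the truncated index m - 1 = 0 does no harm. -/
theorem action_zero : SlAction p q x y z 0 := by
  have e (j : ℕ) : ⁅raise x (j + 1) z, lowVec 4 x y z 0⁆ =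
      (((j + 1) * (4 - j)) / 4 : ℂ) • raise x j (lowVec 4 x y z 1) := by
    rw [h.lowVec_one (by decide), lowVec, raise_zero, lie_smul, h.lie_y]
    push_cast
    module
  refine ⟨h.isLowest_zero, ?_, ?_, ?_, ?_⟩
  · rw [lowVec, raise_zero, lie_smul, h.lie_zero_y, smul_zero]
  · rw [e]; norm_num
  · rw [e]; norm_num
  · rw [e]; norm_num

/-- Here Y₁ = z and Y₂ = [z₁, z], so (ad x)^i Y₂ is a combination of brackets of the z_j. The type 2
relation and its image under ad x give the second equation from which [z₃, z] and [z₄, z] are found.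
-/
theorem action_one : SlAction p q x y z 1 := by
  have h1 : lowVec 4 x y z 1 = z := h.lowVec_one (by decide)
  have h2 : lowVec 4 x y z 2 = ⁅raise x 1 z, z⁆ := by rw [← lie_lowVec, h1]
  have h0 : lowVec 4 x y z 0 = (-(4 : ℂ)⁻¹) • y := rfl
  have s (i : ℕ) : ⁅raise x i z, z⁆ = -⁅z, raise x i z⁆ := (lie_skew _ _).symm
  have e0 : ⁅x, z⁆ = raise x 1 z := lie_raise x z 0
  have r1 : raise x 1 ⁅raise x 1 z, z⁆ = ⁅raise x 2 z, z⁆ := by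
    rw [raise_succ, raise_zero, leibniz_lie, e0, lie_self, lie_raise, add_zero]
  have r2 : raise x 2 ⁅raise x 1 z, z⁆ = ⁅raise x 3 z, z⁆ - ⁅raise x 1 z, raise x 2 z⁆ := by
    rw [raise_succ, r1, leibniz_lie, e0, lie_raise, ← lie_skew (raise x 2 z)]
    abel
  have r3 : raise x 3 ⁅raise x 1 z, z⁆ = ⁅raise x 4 z, z⁆ - (2 : ℂ) • ⁅raise x 1 z,
    raise x 3 z⁆ := by
    rw [raise_succ, r2, lie_sub, leibniz_lie, leibniz_lie x (raise x 1 z), e0, lie_raise, lie_raise,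
      lie_raise, lie_self, ← lie_skew (raise x 3 z)]
    module
  have low1 := h.isLowest_succ (by decide) h.isLowest_zero h.action_zero.zero
  refine ⟨low1, ?_, ?_, ?_, ?_⟩
  · rw [h1, lie_self]
  · rw [h1, h2, r1]; norm_num
  · have d := h.rel2
    rw [h1, h2, r2, Nat.sub_self, h0, s]
    push_cast
    linear_combination (norm := module) ((1 / 5 : ℂ)) • d
  · have d := h.rel2_raise
    rw [h1, h2, r3, Nat.sub_self, h0, s, raise_smul, raise_succ x 0 y, raise_zero x y]
    push_cast
    linear_combination (norm := module) ((2 / 5 : ℂ)) • d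

/-- The recursions involve four consecutive vectors Y_m, ..., Y_{m+3}, hence the induction over two
steps. All that remains is to check that the leading coefficients do not vanish and that the closed
formulas solve the equations. -/
theorem action_succ {m : ℕ} (hm : SlAction p q x y z m) (hm' : SlAction p q x y z (m + 1)) :
    SlAction p q x y z (m + 2) := by
  have n1 : (m : ℂ) + 1 ≠ 0 := by exact_mod_cast (by omega : m + 1 ≠ 0)
  have n2 : (m : ℂ) + 2 ≠ 0 := by exact_mod_cast (by omega : m + 2 ≠ 0)
  have n3 : (m : ℂ) + 3 ≠ 0 := by exact_mod_cast (by omega : m + 3 ≠ 0)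
  have n4 : (m : ℂ) + 4 ≠ 0 := by exact_mod_cast (by omega : m + 4 ≠ 0)
  have n5 : 2 * (m : ℂ) + 3 ≠ 0 := by exact_mod_cast (by omega : 2 * m + 3 ≠ 0)
  have n6 : 2 * (m : ℂ) + 5 ≠ 0 := by exact_mod_cast (by omega : 2 * m + 5 ≠ 0)
  have n7 : 2 * (m : ℂ) + 7 ≠ 0 := by exact_mod_cast (by omega : 2 * m + 7 ≠ 0)
  have n8 : 2 * (m : ℂ) + 9 ≠ 0 := by exact_mod_cast (by omega : 2 * m + 9 ≠ 0)
  have n5' : (m : ℂ) * 2 + 3 ≠ 0 := by rwa [mul_comm]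
  have n6' : (m : ℂ) * 2 + 5 ≠ 0 := by rwa [mul_comm]
  have n7' : (m : ℂ) * 2 + 7 ≠ 0 := by rwa [mul_comm]
  have n8' : (m : ℂ) * 2 + 9 ≠ 0 := by rwa [mul_comm]
  have h1 : lowVec 4 x y z 1 = z := h.lowVec_one (by decide)
  have t2 : _ = (3 / (m + 3) : ℂ) • _ := hm'.two.trans (by congr 2; push_cast; ring)
  have t3 : _ = (9 / ((m + 3) * (2 * m + 5)) : ℂ) • _ +
      (-(48 * (m + 2) * (m + 1) ^ 2 * (p - (m + 2) ^ 2 * q) / (2 * m + 5)) : ℂ) • _ :=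
    hm'.three.trans (by congr 3 <;> push_cast <;> ring)
  have t4 : _ = (6 / ((m + 2) * (m + 3) * (2 * m + 5)) : ℂ) • _ +
      (-(96 * (m + 2) * (m + 1) * (p - (m + 2) ^ 2 * q) / (2 * m + 5)) : ℂ) • _ :=
    hm'.four.trans (by congr 3 <;> push_cast <;> ring)
  rw [Nat.add_sub_cancel] at t3 t4
  -- For m = 0 this is the first relation of type 3 itself, since Y₂ = [z₁, z].
  have z0 : ⁅z, lowVec 4 x y z (m + 2)⁆ = 0 := by
    rcases Nat.eq_zero_or_pos m with rfl | hpos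
    · rw [← lie_lowVec, h1, ← lie_skew (raise x 1 z) z, lie_neg, h.rel3, neg_zero]
    · refine lie_lowest_eq_zero h.rel3 hm.zero (lie_lowVec 4 x y z m) hm.two hm'.zero
        (lie_lowVec 4 x y z (m + 1)) ?_
      rw [show (1 + 3 / (m + 2) : ℂ) = (m + 5) / (m + 2) by field_simp; ring]
      exact div_ne_zero (by exact_mod_cast (by omega : m + 5 ≠ 0)) n2
  have z2 : ⁅raise x 2 z, lowVec 4 x y z (m + 2)⁆ =
      (3 / (m + 4) : ℂ) • raise x 1 (lowVec 4 x y z (m + 2 + 1)) := by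
    refine eq_smul_of_smul_eq (h.recursion_two hm'.low hm.zero hm'.zero (lie_lowVec ..) t2 t3
      z0 (lie_lowVec ..)) ?_ ?_
    · rw [show (3 * (3 / (m + 3)) + 3 + 2 * (9 / ((m + 3) * (2 * m + 5))) : ℂ) =
        3 * (2 * m + 9) * (m + 4) / ((m + 3) * (2 * m + 5)) by field_simp; ring]
      simp [n3, n4, n6, n8]
    · field_simp
      ring
  have z3 : ⁅raise x 3 z, lowVec 4 x y z (m + 2)⁆ =
      (9 / ((m + 4) * (2 * m + 7)) : ℂ) • raise x 2 (lowVec 4 x y z (m + 2 + 1)) +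
        (-(48 * (m + 3) * (m + 2) ^ 2 * (p - (m + 3) ^ 2 * q) / (2 * m + 7)) : ℂ) •
          lowVec 4 x y z (m + 1) := by
    -- The leading coefficient of `recursion_three` is proportional to m. At m = 0 the equation says
    -- nothing about z₃ on Y₂, and the second relation of type 3 takes its place.
    rcases Nat.eq_zero_or_pos m with rfl | hpos
    · have d := h.rel3'
      have s (v : L) : ⁅z, v⁆ = -⁅v, z⁆ := (lie_skew _ _).symm
      have r : ⁅raise x 2 z, z⁆ = ⁅x, lowVec 4 x y z 2⁆ := by
        rw [← lie_lowVec, h1, leibniz_lie, lie_raise, ← raise_zero x z, lie_raise, raise_zero,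
          lie_self, add_zero]
      have e : ⁅raise x 1 z, z⁆ = lowVec 4 x y z 2 := by rw [← lie_lowVec, h1]
      simp only [s (raise x _ z), lie_neg, r, e, lie_raise_lie, Nat.reduceAdd] at d
      simp only [zero_add, Nat.cast_zero] at z2 ⊢
      rw [z2, lie_smul, lie_raise] at d
      rw [h1]
      linear_combination (norm := module) (-(1 / 7 : ℂ)) • d
    · have n0 : (m : ℂ) ≠ 0 := by exact_mod_cast hpos.ne'
      have d := h.recursion_three hm'.low hm.zero (lie_lowVec ..) hm'.zero (lie_lowVec ..) t3 t4 z0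
        (lie_lowVec ..) z2
      refine eq_smul_add_smul_of_smul_eq d ?_ ?_ ?_
      · rw [show (9 / ((m + 3) * (2 * m + 5)) - 1 + 2 * (6 / ((m + 2) * (m + 3) * (2 * m + 5))) :
          ℂ) =
          -(m * (2 * m + 7) * (m + 4)) / ((m + 2) * (m + 3) * (2 * m + 5)) by field_simp; ring]
        simp [n0, n2, n3, n4, n6, n7]
      · field_simp
        ring
      · rw [lowWt]
        push_cast
        field_simp
        ring
  have z4 : ⁅raise x 4 z, lowVec 4 x y z (m + 2)⁆ =
      (6 / ((m + 3) * (m + 4) * (2 * m + 7)) : ℂ) • raise x 3 (lowVec 4 x y z (m + 2 + 1)) +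
        (-(96 * (m + 3) * (m + 2) * (p - (m + 3) ^ 2 * q) / (2 * m + 7)) : ℂ) •
          raise x 1 (lowVec 4 x y z (m + 1)) := by
    refine eq_smul_add_smul_of_smul_eq (h.recursion_four (lie_lowVec ..) hm.two (lie_lowVec ..) t2
      t3 t4
      (lie_lowVec ..) z2 z3) ?_ ?_ ?_
    · rw [show (9 / ((m + 3) * (2 * m + 5)) + 3 / (m + 3) + 6 / ((m + 2) * (m + 3) * (2 * m + 5)) +
        1 : ℂ) = (2 * m + 7) * (m + 4) / ((m + 2) * (2 * m + 5)) by field_simp; ring]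
      simp [n2, n4, n6, n7]
    · field_simp
      ring
    · field_simp
      ring
  refine ⟨h.isLowest_succ (by decide) hm'.low hm'.zero, z0, z2.trans ?_, z3.trans ?_, z4.trans ?_⟩
  · congr 2; push_cast; ring
  · congr 3 <;> push_cast <;> ring
  · congr 3 <;> push_cast <;> ring

theorem action (m : ℕ) : SlAction p q x y z m := by
  have key : SlAction p q x y z m ∧ SlAction p q x y z (m + 1) := by
    induction m with
    | zero => exact ⟨h.action_zero, h.action_one⟩
    | succ m ih => exact ⟨ih.2, h.action_succ ih.1 ih.2⟩
  exact key.1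

end IsSlTriple
end

/-! ### The series o/sp: recursions for the action on the lowest weight vectors -/

section

variable {L : Type} [LieRing L] [LieAlgebra ℂ L]

/-- The relations of the series `o/sp` with `a = p - 19 q`, `b = (p - 4 q) (p - 9 q)`,
`c = p - 49 q`. -/
structure IsOspTriple (p q : ℂ) (x y z : L) : Prop extends IsTriple 6 x y z where
  rel2 : (2 : ℂ) • ⁅raise x 1 z, raise x 2 z⁆ - ⁅z, raise x 3 z⁆ = (72 * (p - 19 * q)) • z
  rel2' : (9 : ℂ) • ⁅raise x 2 z, raise x 3 z⁆ - (5 : ℂ) • ⁅raise x 1 z, raise x 4 z⁆ =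
    (216 * (p - 19 * q)) • raise x 2 z + (432 * ((p - 4 * q) * (p - 9 * q))) • y
  rel3 : ⁅z, ⁅z, raise x 1 z⁆⁆ = 0
  rel3' : (7 : ℂ) • ⁅raise x 3 z, ⁅z, raise x 1 z⁆⁆ - (6 : ℂ) • ⁅raise x 2 z, ⁅z, raise x 2 z⁆⁆ =
    (720 * (p - 49 * q)) • ⁅z, raise x 1 z⁆

namespace IsOspTriple

variable {p q : ℂ} {x y z : L} (h : IsOspTriple p q x y z)
include h

/-- The first relation of type 2 and its four images under ad x determine, one after another, z₂,
..., z₆ on the next lowest weight vector. -/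
theorem rel2_raise : ⁅raise x 1 z, raise x 3 z⁆ - ⁅z, raise x 4 z⁆ =
    (72 * (p - 19 * q)) • raise x 1 z := by
  have h1 := congrArg (⁅x, ·⁆) h.rel2
  have h2 : ⁅x, z⁆ = raise x 1 z := lie_raise x z 0
  simp only [lie_sub, lie_smul, leibniz_lie x (raise x _ z), leibniz_lie x z, lie_raise, lie_self,
    h2] at h1
  linear_combination (norm := module) h1

theorem rel2_raise_two : ⁅raise x 2 z, raise x 3 z⁆ - ⁅z, raise x 5 z⁆ =
    (72 * (p - 19 * q)) • raise x 2 z := by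
  have h1 := congrArg (⁅x, ·⁆) h.rel2_raise
  have h2 : ⁅x, z⁆ = raise x 1 z := lie_raise x z 0
  simp only [lie_sub, lie_smul, leibniz_lie x (raise x _ z), leibniz_lie x z, lie_raise, h2] at h1
  linear_combination (norm := module) h1

theorem rel2_raise_three : ⁅raise x 2 z, raise x 4 z⁆ - ⁅raise x 1 z, raise x 5 z⁆ -
    ⁅z, raise x 6 z⁆ = (72 * (p - 19 * q)) • raise x 3 z := by
  have h1 := congrArg (⁅x, ·⁆) h.rel2_raise_two
  have h2 : ⁅x, z⁆ = raise x 1 z := lie_raise x z 0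
  simp only [lie_sub, lie_smul, leibniz_lie x (raise x _ z), leibniz_lie x z, lie_raise, lie_self,
    h2] at h1
  linear_combination (norm := module) h1

theorem rel2_raise_four : ⁅raise x 3 z, raise x 4 z⁆ - (2 : ℂ) • ⁅raise x 1 z, raise x 6 z⁆ =
    (72 * (p - 19 * q)) • raise x 4 z := by
  have h1 := congrArg (⁅x, ·⁆) h.rel2_raise_three
  have h2 : ⁅x, z⁆ = raise x 1 z := lie_raise x z 0
  simp only [lie_sub, lie_smul, leibniz_lie x (raise x _ z), leibniz_lie x z, lie_raise, h2,
    h.top, lie_zero] at h1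
  linear_combination (norm := module) h1

/-- The second relation of type 2 enters only through the initial values of z₅ and z₆ on Y₁ = z; all
later values follow from the first one. -/
theorem rel2'_raise : (4 : ℂ) • ⁅raise x 2 z, raise x 4 z⁆ -
    (5 : ℂ) • ⁅raise x 1 z, raise x 5 z⁆ =
    (216 * (p - 19 * q)) • raise x 3 z + (432 * ((p - 4 * q) * (p - 9 * q))) • ⁅x, y⁆ := by
  have h1 := congrArg (⁅x, ·⁆) h.rel2'
  have h2 : ⁅x, z⁆ = raise x 1 z := lie_raise x z 0
  simp only [lie_sub, lie_add, lie_smul, leibniz_lie x (raise x _ z), leibniz_lie x z, lie_raise,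
    lie_self, h2] at h1
  linear_combination (norm := module) h1

/-- The recursion for the action of `z_2` on the lowest weight vectors. -/
theorem recursion_two {Y Y' Y'' : L} {α₂ α₃ γ₃ : ℂ}
    (h0' : ⁅z, Y⁆ = 0)
    (h1' : ⁅raise x 1 z, Y⁆ = Y')
    (h2' : ⁅raise x 2 z, Y⁆ = α₂ • raise x 1 Y')
    (h3' : ⁅raise x 3 z, Y⁆ = α₃ • raise x 2 Y' + γ₃ • Y)
    (h0'' : ⁅z, Y'⁆ = 0)
    (h1'' : ⁅raise x 1 z, Y'⁆ = Y'') :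
    (-(2) - 2 * α₂ - α₃) • ⁅raise x 2 z, Y'⁆ =
      (-(2 * α₂) - 2 * α₃) • raise x 1 Y'' := by
  have d := congrArg (⁅·, Y⁆) h.rel2
  simp only [sub_lie, smul_lie] at d
  simp only [lie_lie, h0', h1', h2', h3', lie_add, lie_smul, lie_zero] at d
  simp only [raise_succ x _ Y, raise_zero x Y, raise_succ x _ Y', raise_zero x Y',
    raise_succ x _ Y'', raise_zero x Y'',
    lie_raise_lie, lie_lie_raise x z, h0', h1', h2', h3', h0'', h1'', lie_zero,
    lie_sub, lie_add, lie_smul, Nat.reduceAdd] at d ⊢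
  linear_combination (norm := module) d

/-- The recursion for the action of `z_3` on the lowest weight vectors. -/
theorem recursion_three {Y Y' Y'' : L} {α₃ α₄ γ₃ γ₄ δ₂ : ℂ}
    (h0' : ⁅z, Y⁆ = 0)
    (h1' : ⁅raise x 1 z, Y⁆ = Y')
    (h3' : ⁅raise x 3 z, Y⁆ = α₃ • raise x 2 Y' + γ₃ • Y)
    (h4' : ⁅raise x 4 z, Y⁆ = α₄ • raise x 3 Y' + γ₄ • raise x 1 Y)
    (h0'' : ⁅z, Y'⁆ = 0)
    (h1'' : ⁅raise x 1 z, Y'⁆ = Y'')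
    (h2'' : ⁅raise x 2 z, Y'⁆ = δ₂ • raise x 1 Y'') :
    (-(1) + α₃ + α₄) • ⁅raise x 3 z, Y'⁆ =
      (-(α₃) + 2 * α₃ * δ₂ - 3 * α₄ + 3 * α₄ * δ₂) • raise x 2 Y'' +
        ((72 * (p - 19 * q)) - γ₃ - γ₄) • Y' := by
  have d := congrArg (⁅·, Y⁆) h.rel2_raise
  simp only [sub_lie, smul_lie] at d
  simp only [lie_lie, h0', h1', h3', h4', lie_add, lie_smul, lie_zero] at d
  simp only [raise_succ x _ Y, raise_zero x Y, raise_succ x _ Y', raise_zero x Y',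
    raise_succ x _ Y'', raise_zero x Y'',
    lie_raise_lie, lie_lie_raise x z, h0', h1', h3', h4', h0'', h1'', h2'', lie_zero,
    lie_sub, lie_add, lie_smul, Nat.reduceAdd] at d ⊢
  linear_combination (norm := module) d

/-- The recursion for the action of `z_4` on the lowest weight vectors. -/
theorem recursion_four {Y₀ Y Y' Y'' : L} {α₂ α₃ α₅ γ₃ γ₅ δ₂ δ₃ ε₃ η₅ : ℂ}
    (h0 : ⁅z, Y₀⁆ = 0)
    (h0' : ⁅z, Y⁆ = 0)
    (h1' : ⁅raise x 1 z, Y⁆ = Y')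
    (h2' : ⁅raise x 2 z, Y⁆ = α₂ • raise x 1 Y')
    (h3' : ⁅raise x 3 z, Y⁆ = α₃ • raise x 2 Y' + γ₃ • Y)
    (h5' : ⁅raise x 5 z, Y⁆ = α₅ • raise x 4 Y' + γ₅ • raise x 2 Y + η₅ • Y₀)
    (h0'' : ⁅z, Y'⁆ = 0)
    (h1'' : ⁅raise x 1 z, Y'⁆ = Y'')
    (h2'' : ⁅raise x 2 z, Y'⁆ = δ₂ • raise x 1 Y'')
    (h3'' : ⁅raise x 3 z, Y'⁆ = δ₃ • raise x 2 Y'' + ε₃ • Y') :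
    (α₂ + α₃ - α₅) • ⁅raise x 4 z, Y'⁆ =
      (α₂ * δ₃ - α₃ * δ₂ + 2 * α₃ * δ₃ - 4 * α₅ + 6 * α₅ * δ₂ - 4 * α₅ * δ₃) • raise x 3 Y'' +
        ((72 * (p - 19 * q)) * α₂ - α₂ * γ₃ + α₂ * γ₅ + α₂ * ε₃ + 2 * α₃ * ε₃ - 4 * α₅ * ε₃ - 2 *
        γ₅) • raise x 1 Y' := by
  have d := congrArg (⁅·, Y⁆) h.rel2_raise_two
  simp only [sub_lie, smul_lie] at d
  simp only [lie_lie, h0', h1', h2', h3', h5', lie_add, lie_smul, lie_zero] at d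
  simp only [raise_succ x _ Y₀, raise_zero x Y₀, raise_succ x _ Y, raise_zero x Y,
    raise_succ x _ Y', raise_zero x Y', raise_succ x _ Y'', raise_zero x Y'',
    lie_raise_lie, lie_lie_raise x z, h0, h0', h1', h2', h3', h5', h0'', h1'', h2'', h3'', lie_zero,
    lie_sub, lie_add, lie_smul, Nat.reduceAdd] at d ⊢
  linear_combination (norm := module) d

/-- The recursion for the action of `z_5` on the lowest weight vectors. -/
theorem recursion_five {Y₀ Y Y' Y'' : L} {α₂ α₃ α₄ α₅ α₆ γ₃ γ₄ γ₅ γ₆ δ₂ δ₃ δ₄ ε₃ ε₄ η₅ η₆ : ℂ}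
    (h0 : ⁅z, Y₀⁆ = 0)
    (h1 : ⁅raise x 1 z, Y₀⁆ = Y)
    (h0' : ⁅z, Y⁆ = 0)
    (h1' : ⁅raise x 1 z, Y⁆ = Y')
    (h2' : ⁅raise x 2 z, Y⁆ = α₂ • raise x 1 Y')
    (h3' : ⁅raise x 3 z, Y⁆ = α₃ • raise x 2 Y' + γ₃ • Y)
    (h4' : ⁅raise x 4 z, Y⁆ = α₄ • raise x 3 Y' + γ₄ • raise x 1 Y)
    (h5' : ⁅raise x 5 z, Y⁆ = α₅ • raise x 4 Y' + γ₅ • raise x 2 Y + η₅ • Y₀)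
    (h6' : ⁅raise x 6 z, Y⁆ = α₆ • raise x 5 Y' + γ₆ • raise x 3 Y + η₆ • raise x 1 Y₀)
    (h0'' : ⁅z, Y'⁆ = 0)
    (h1'' : ⁅raise x 1 z, Y'⁆ = Y'')
    (h2'' : ⁅raise x 2 z, Y'⁆ = δ₂ • raise x 1 Y'')
    (h3'' : ⁅raise x 3 z, Y'⁆ = δ₃ • raise x 2 Y'' + ε₃ • Y')
    (h4'' : ⁅raise x 4 z, Y'⁆ = δ₄ • raise x 3 Y'' + ε₄ • raise x 1 Y') :
    (1 + α₂ - α₄ - α₅ + α₆) • ⁅raise x 5 z, Y'⁆ =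
      (α₂ * δ₄ - α₄ * δ₂ + 3 * α₄ * δ₃ - 3 * α₄ * δ₄ + α₅ - 4 * α₅ * δ₂ + 6 * α₅ * δ₃ - 4 * α₅ *
      δ₄ - 5 * α₆ + 10 * α₆ * δ₂ - 10 * α₆ * δ₃ + 5 * α₆ * δ₄) • raise x 4 Y'' +
        ((72 * (p - 19 * q)) * α₃ - α₂ * γ₄ - 2 * α₂ * γ₅ + 3 * α₂ * γ₆ + α₂ * ε₄ + α₃ * γ₄ + α₃ *
        γ₅ - α₃ * γ₆ + 3 * α₄ * ε₃ - 3 * α₄ * ε₄ + 6 * α₅ * ε₃ - 4 * α₅ * ε₄ - 10 * α₆ * ε₃ + 5 *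
        α₆ * ε₄ + γ₅ - 3 * γ₆) • raise x 2 Y' +
        ((72 * (p - 19 * q)) * γ₃ + γ₃ * γ₄ + γ₃ * γ₅ - γ₃ * γ₆ + η₅ - η₆) • Y := by
  have d := congrArg (⁅·, Y⁆) h.rel2_raise_three
  simp only [sub_lie, smul_lie] at d
  simp only [lie_lie, h0', h1', h2', h3', h4', h5', h6', lie_add, lie_smul, lie_zero] at d
  simp only [raise_succ x _ Y₀, raise_zero x Y₀, raise_succ x _ Y, raise_zero x Y,
    raise_succ x _ Y', raise_zero x Y', raise_succ x _ Y'', raise_zero x Y'',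
    lie_raise_lie, lie_lie_raise x z, h0, h1, h0', h1', h2', h3', h4', h5', h6', h0'', h1'', h2'',
    h3'', h4'', lie_zero,
    lie_sub, lie_add, lie_smul, Nat.reduceAdd] at d ⊢
  linear_combination (norm := module) d

/-- The recursion for the action of `z_6` on the lowest weight vectors. -/
theorem recursion_six {Y₀ Y Y' Y'' : L} {α₂ α₃ α₄ α₆ β₂ γ₃ γ₄ γ₆ δ₂ δ₃ δ₄ δ₅ ε₃ ε₄ ε₅ ζ₅ η₆ : ℂ}
    (h1 : ⁅raise x 1 z, Y₀⁆ = Y)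
    (h2 : ⁅raise x 2 z, Y₀⁆ = β₂ • raise x 1 Y)
    (h1' : ⁅raise x 1 z, Y⁆ = Y')
    (h2' : ⁅raise x 2 z, Y⁆ = α₂ • raise x 1 Y')
    (h3' : ⁅raise x 3 z, Y⁆ = α₃ • raise x 2 Y' + γ₃ • Y)
    (h4' : ⁅raise x 4 z, Y⁆ = α₄ • raise x 3 Y' + γ₄ • raise x 1 Y)
    (h6' : ⁅raise x 6 z, Y⁆ = α₆ • raise x 5 Y' + γ₆ • raise x 3 Y + η₆ • raise x 1 Y₀)
    (h1'' : ⁅raise x 1 z, Y'⁆ = Y'')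
    (h2'' : ⁅raise x 2 z, Y'⁆ = δ₂ • raise x 1 Y'')
    (h3'' : ⁅raise x 3 z, Y'⁆ = δ₃ • raise x 2 Y'' + ε₃ • Y')
    (h4'' : ⁅raise x 4 z, Y'⁆ = δ₄ • raise x 3 Y'' + ε₄ • raise x 1 Y')
    (h5'' : ⁅raise x 5 z, Y'⁆ = δ₅ • raise x 4 Y'' + ε₅ • raise x 2 Y' + ζ₅ • Y) :
    (2 - α₃ - α₄ + 2 * α₆) • ⁅raise x 6 z, Y'⁆ =
      (α₃ * δ₄ - 2 * α₃ * δ₅ - α₄ * δ₃ + 3 * α₄ * δ₄ - 3 * α₄ * δ₅ + 2 * α₆ - 10 * α₆ * δ₂ + 20 *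
      α₆ * δ₃ - 20 * α₆ * δ₄ + 10 * α₆ * δ₅) • raise x 5 Y'' +
        ((72 * (p - 19 * q)) * α₄ - 6 * α₂ * γ₆ - α₃ * γ₄ + 6 * α₃ * γ₆ + α₃ * ε₄ - 2 * α₃ * ε₅ +
        α₄ * γ₃ + α₄ * γ₄ - 2 * α₄ * γ₆ - α₄ * ε₃ + 3 * α₄ * ε₄ - 3 * α₄ * ε₅ + 20 * α₆ * ε₃ - 20
        * α₆ * ε₄ + 10 * α₆ * ε₅ + 2 * γ₆) • raise x 3 Y' +
        ((72 * (p - 19 * q)) * γ₄ - 2 * α₃ * ζ₅ - 3 * α₄ * ζ₅ + 10 * α₆ * ζ₅ - 2 * β₂ * η₆ + 6 *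
        γ₃ * γ₆ + γ₄ * γ₄ - 2 * γ₄ * γ₆ + 2 * η₆) • raise x 1 Y := by
  have d := congrArg (⁅·, Y⁆) h.rel2_raise_four
  simp only [sub_lie, smul_lie] at d
  simp only [lie_lie, h1', h2', h3', h4', h6', lie_add, lie_smul, lie_zero] at d
  simp only [raise_succ x _ Y₀, raise_zero x Y₀, raise_succ x _ Y, raise_zero x Y,
    raise_succ x _ Y', raise_zero x Y', raise_succ x _ Y'', raise_zero x Y'',
    lie_raise_lie, lie_lie_raise x z, h1, h2, h1', h2', h3', h4', h6', h1'', h2'', h3'', h4'',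
    h5'', lie_zero,
    lie_sub, lie_add, lie_smul, Nat.reduceAdd] at d ⊢
  linear_combination (norm := module) d

end IsOspTriple

end

end ComplexSize

namespace ComplexSize

/-! ### The series o/sp: closed formulas for the action on the lowest weight vectors -/

section

variable {L : Type} [LieRing L] [LieAlgebra ℂ L]

theorem eq_smul_add_smul_add_smul_of_smul_eq {c d f r e g s : ℂ} {u v w t : L}
    (h : c • u = d • v + f • w + r • t) (hc : c ≠ 0) (hd : d = c * e) (hf : f = c * g)
    (hr : r = c * s) : u = e • v + g • w + s • t := by
  refine smul_right_injective L hc ?_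
  simp only [h, hd, hf, hr, smul_smul, smul_add]

/-- The action of the vectors `z_i` on the lowest weight vectors `Y_m` in the series `o/sp`;
here `k = 2 m + 1`. -/
structure OspAction (p q : ℂ) (x y z : L) (m : ℕ) (k : ℂ) : Prop where
  index : k = 2 * m + 1
  low : IsLowest x y (lowVec 6 x y z m) (lowWt 6 m)
  zero : ⁅z, lowVec 6 x y z m⁆ = 0
  two : ⁅raise x 2 z, lowVec 6 x y z m⁆ = (5 / (k + 2)) • raise x 1 (lowVec 6 x y z (m + 1))
  three : ⁅raise x 3 z, lowVec 6 x y z m⁆ =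
    (30 / ((k + 2) * (2 * k + 3))) • raise x 2 (lowVec 6 x y z (m + 1)) +
      (12 * k * (k - 1) * (3 * p - (5 * k * (k + 1) - 3) * q) / (2 * k + 3)) • lowVec 6 x y z m
  four : ⁅raise x 4 z, lowVec 6 x y z m⁆ =
    (60 / ((k + 2) * (2 * k + 3) * (k + 1))) • raise x 3 (lowVec 6 x y z (m + 1)) +
      (72 * (k - 1) * (3 * p - (5 * k * (k + 1) - 3) * q) / (2 * k + 3)) •
        raise x 1 (lowVec 6 x y z m)
  five : ⁅raise x 5 z, lowVec 6 x y z m⁆ =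
    (150 / ((k + 2) * (2 * k + 3) * (k + 1) * (2 * k + 1))) •
        raise x 4 (lowVec 6 x y z (m + 1)) +
      (360 * (k - 1) * (3 * p - (5 * k * (k + 1) - 3) * q) / ((2 * k + 3) * (2 * k - 1))) •
        raise x 2 (lowVec 6 x y z m) +
      (1080 * k * (k - 1) * (k - 2) ^ 2 * ((p - k ^ 2 * q) * (p - (k - 1) ^ 2 * q)) /
        ((2 * k + 1) * (2 * k - 1))) • lowVec 6 x y z (m - 1)
  six : ⁅raise x 6 z, lowVec 6 x y z m⁆ =
    (90 / ((k + 2) * (2 * k + 3) * (k + 1) * (2 * k + 1) * k)) •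
        raise x 5 (lowVec 6 x y z (m + 1)) +
      (360 * (3 * p - (5 * k * (k + 1) - 3) * q) / ((2 * k + 3) * (2 * k - 1))) •
        raise x 3 (lowVec 6 x y z m) +
      (3240 * k * (k - 1) * (k - 2) * ((p - k ^ 2 * q) * (p - (k - 1) ^ 2 * q)) /
        ((2 * k + 1) * (2 * k - 1))) • raise x 1 (lowVec 6 x y z (m - 1))

namespace IsOspTriple

variable {p q : ℂ} {x y z : L} (h : IsOspTriple p q x y z)
include h

theorem action_zero : OspAction p q x y z 0 1 := by
  have e (j : ℕ) : ⁅raise x (j + 1) z, lowVec 6 x y z 0⁆ =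
      (((j + 1) * (6 - j)) / 6 : ℂ) • raise x j (lowVec 6 x y z 1) := by
    rw [h.lowVec_one (by decide), lowVec, raise_zero, lie_smul, h.lie_y]
    push_cast
    module
  -- The coefficient of (ad x)³ Y_m in the formula for z₆ does not contain the factor k - 1, so at k
  -- = 1 that term disappears only because y generates a three-dimensional module.
  have hx : raise x 3 (lowVec 6 x y z 0) = 0 := by
    rw [lowVec, raise_zero, raise_smul, raise_succ, raise_succ, raise_succ, raise_zero, h.lie_x_y_x]
    simp
  refine ⟨by norm_num, h.isLowest_zero, ?_, ?_, ?_, ?_, ?_, ?_⟩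
  · rw [lowVec, raise_zero, lie_smul, h.lie_zero_y, smul_zero]
  · rw [e]; norm_num
  · rw [e]; norm_num
  · rw [e]; norm_num
  · rw [e]; norm_num
  · rw [e, hx]; norm_num

/-- As Y₂ = [z₁, z], every (ad x)^i Y₂ is a combination of brackets of the z_j. The first relation
of type 2 and its image under ad x settle z₃ and z₄; for z₅ and z₆ there is one more unknown
bracket, and the second relation of type 2 is needed. -/
theorem action_one : OspAction p q x y z 1 3 := by
  have h1 : lowVec 6 x y z 1 = z := h.lowVec_one (by decide)
  have h2 : lowVec 6 x y z 2 = ⁅raise x 1 z, z⁆ := by rw [← lie_lowVec, h1]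
  have h0 : lowVec 6 x y z 0 = (-(6 : ℂ)⁻¹) • y := rfl
  have s (i : ℕ) : ⁅raise x i z, z⁆ = -⁅z, raise x i z⁆ := (lie_skew _ _).symm
  have e0 : ⁅x, z⁆ = raise x 1 z := lie_raise x z 0
  have r1 : raise x 1 ⁅raise x 1 z, z⁆ = ⁅raise x 2 z, z⁆ := by
    rw [raise_succ, raise_zero, leibniz_lie, e0, lie_self, lie_raise, add_zero]
  have r2 : raise x 2 ⁅raise x 1 z, z⁆ = ⁅raise x 3 z, z⁆ - ⁅raise x 1 z, raise x 2 z⁆ := by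
    rw [raise_succ, r1, leibniz_lie, e0, lie_raise, ← lie_skew (raise x 2 z)]
    abel
  have r3 : raise x 3 ⁅raise x 1 z, z⁆ =
      ⁅raise x 4 z, z⁆ - (2 : ℂ) • ⁅raise x 1 z, raise x 3 z⁆ := by
    rw [raise_succ, r2, lie_sub, leibniz_lie, leibniz_lie x (raise x 1 z), e0, lie_raise, lie_raise,
      lie_raise, lie_self, ← lie_skew (raise x 3 z)]
    module
  have r4 : raise x 4 ⁅raise x 1 z, z⁆ = ⁅raise x 5 z, z⁆ -
      (3 : ℂ) • ⁅raise x 1 z, raise x 4 z⁆ - (2 : ℂ) • ⁅raise x 2 z, raise x 3 z⁆ := by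
    rw [raise_succ, r3, lie_sub, lie_smul, leibniz_lie, leibniz_lie x (raise x 1 z), e0, lie_raise,
      lie_raise, lie_raise, ← lie_skew (raise x 4 z)]
    module
  have r5 : raise x 5 ⁅raise x 1 z, z⁆ = ⁅raise x 6 z, z⁆ -
      (4 : ℂ) • ⁅raise x 1 z, raise x 5 z⁆ - (5 : ℂ) • ⁅raise x 2 z, raise x 4 z⁆ := by
    rw [raise_succ, r4, lie_sub, lie_sub, lie_smul, lie_smul, leibniz_lie,
      leibniz_lie x (raise x 1 z), leibniz_lie x (raise x 2 z), e0, lie_raise, lie_raise, lie_raise,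
      lie_raise, lie_raise, lie_self, ← lie_skew (raise x 5 z)]
    module
  have low1 := h.isLowest_succ (by decide) h.isLowest_zero h.action_zero.zero
  refine ⟨by norm_num, low1, ?_, ?_, ?_, ?_, ?_, ?_⟩
  · rw [h1, lie_self]
  · rw [h1, h2, r1]; norm_num
  · rw [h1, h2, r2, s]
    linear_combination (norm := module) (1 / 3 : ℂ) • h.rel2
  · rw [h1, h2, r3, s]
    linear_combination (norm := module) (2 / 3 : ℂ) • h.rel2_raise
  · rw [h1, h2, r4, Nat.sub_self, h0, s]
    linear_combination (norm := module) (37 / 42 : ℂ) • h.rel2_raise_two - (1 / 14 : ℂ) • h.rel2'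
  · rw [h1, h2, r5, Nat.sub_self, h0, s, raise_smul, raise_succ x 0 y, raise_zero x y]
    linear_combination (norm := module) (41 / 42 : ℂ) • h.rel2_raise_three -
      (3 / 14 : ℂ) • h.rel2'_raise

/-- The formulas are rational in the exponent k of y, which grows by 2 at each step: k - 2, k and k
+ 2 belong to Y_m, Y_{m+1} and Y_{m+2}. -/
theorem action_succ {m : ℕ} {k : ℂ} (hm : OspAction p q x y z m (k - 2))
    (hm' : OspAction p q x y z (m + 1) k) : OspAction p q x y z (m + 2) (k + 2) := by
  have hk := hm'.index
  -- Since k = 2m + 3, each of the factors below is a m + b with natural a and b > 0.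
  have nz (a b : ℕ) (hb : 0 < b) {c : ℂ} (hc : c = a * m + b) : c ≠ 0 := by
    rw [hc]
    exact_mod_cast (by omega : a * m + b ≠ 0)
  have n0 : k ≠ 0 := nz 2 3 (by decide) (by rw [hk]; push_cast; ring)
  have n1 : k + 1 ≠ 0 := nz 2 4 (by decide) (by rw [hk]; push_cast; ring)
  have n1' : k - 1 ≠ 0 := nz 2 2 (by decide) (by rw [hk]; push_cast; ring)
  have n2 : k + 2 ≠ 0 := nz 2 5 (by decide) (by rw [hk]; push_cast; ring)
  have n3 : k + 3 ≠ 0 := nz 2 6 (by decide) (by rw [hk]; push_cast; ring)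
  have n4 : k + 4 ≠ 0 := nz 2 7 (by decide) (by rw [hk]; push_cast; ring)
  have n6 : k + 6 ≠ 0 := nz 2 9 (by decide) (by rw [hk]; push_cast; ring)
  have d1 : k * 2 + 1 ≠ 0 := nz 4 7 (by decide) (by rw [hk]; push_cast; ring)
  have c1 : 2 * k + 1 ≠ 0 := by rwa [mul_comm]
  have d1' : k * 2 - 1 ≠ 0 := nz 4 5 (by decide) (by rw [hk]; push_cast; ring)
  have c1' : 2 * k - 1 ≠ 0 := by rwa [mul_comm]
  have d3 : k * 2 + 3 ≠ 0 := nz 4 9 (by decide) (by rw [hk]; push_cast; ring)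
  have c3 : 2 * k + 3 ≠ 0 := by rwa [mul_comm]
  have d3' : k * 2 - 3 ≠ 0 := nz 4 3 (by decide) (by rw [hk]; push_cast; ring)
  have c3' : 2 * k - 3 ≠ 0 := by rwa [mul_comm]
  have d5 : k * 2 + 5 ≠ 0 := nz 4 11 (by decide) (by rw [hk]; push_cast; ring)
  have c5 : 2 * k + 5 ≠ 0 := by rwa [mul_comm]
  have d7 : k * 2 + 7 ≠ 0 := nz 4 13 (by decide) (by rw [hk]; push_cast; ring)
  have c7 : 2 * k + 7 ≠ 0 := by rwa [mul_comm]
  have d9 : k * 2 + 9 ≠ 0 := nz 4 15 (by decide) (by rw [hk]; push_cast; ring)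
  have c9 : 2 * k + 9 ≠ 0 := by rwa [mul_comm]
  have h1 : lowVec 6 x y z 1 = z := h.lowVec_one (by decide)
  have t2 := hm'.two
  have t3 := hm'.three
  have t4 := hm'.four
  have t5 := hm'.five
  have t6 := hm'.six
  rw [Nat.add_sub_cancel] at t5 t6
  have z0 : ⁅z, lowVec 6 x y z (m + 2)⁆ = 0 := by
    rcases Nat.eq_zero_or_pos m with rfl | hpos
    · rw [← lie_lowVec, h1, ← lie_skew (raise x 1 z) z, lie_neg, h.rel3, neg_zero]
    · refine lie_lowest_eq_zero h.rel3 hm.zero (lie_lowVec 6 x y z m) hm.two hm'.zero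
        (lie_lowVec 6 x y z (m + 1)) ?_
      rw [sub_add_cancel, show 1 + 5 / k = (k + 5) / k by field_simp]
      exact div_ne_zero (nz 2 8 (by decide) (by rw [hk]; push_cast; ring)) n0
  have z2 : ⁅raise x 2 z, lowVec 6 x y z (m + 2)⁆ =
      (5 / (k + 4)) • raise x 1 (lowVec 6 x y z (m + 2 + 1)) := by
    refine eq_smul_of_smul_eq (h.recursion_two hm'.zero (lie_lowVec ..) t2 t3 z0 (lie_lowVec ..))
      ?_ ?_
    · rw [show -2 - 2 * (5 / (k + 2)) - 30 / ((k + 2) * (2 * k + 3)) =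
        -(2 * (k * 2 + 9) * (k + 4)) / ((k + 2) * (k * 2 + 3)) by field_simp; ring]
      simp [n2, n4, d3, d9]
    · field_simp
      ring
  have z3 : ⁅raise x 3 z, lowVec 6 x y z (m + 2)⁆ =
      (30 / ((k + 4) * (2 * k + 7))) • raise x 2 (lowVec 6 x y z (m + 2 + 1)) +
        (12 * (k + 2) * (k + 1) * (3 * p - (5 * (k + 2) * (k + 3) - 3) * q) / (2 * k + 7)) •
          lowVec 6 x y z (m + 2) := by
    -- The leading coefficient of `recursion_three` contains k - 3 = 2m. At m = 0 the last relation
    -- of type 3 replaces the degenerate equation.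
    rcases Nat.eq_zero_or_pos m with rfl | hpos
    · have d := h.rel3'
      have s (v : L) : ⁅z, v⁆ = -⁅v, z⁆ := (lie_skew _ _).symm
      have r : ⁅raise x 2 z, z⁆ = ⁅x, lowVec 6 x y z 2⁆ := by
        rw [← lie_lowVec, h1, leibniz_lie, lie_raise, ← raise_zero x z, lie_raise, raise_zero,
          lie_self, add_zero]
      have e : ⁅raise x 1 z, z⁆ = lowVec 6 x y z 2 := by rw [← lie_lowVec, h1]
      have hk3 : k = 3 := by rw [hk]; norm_num
      simp only [s (raise x _ z), lie_neg, r, e, lie_raise_lie, Nat.reduceAdd] at d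
      simp only [zero_add, hk3] at z2 ⊢
      rw [z2, lie_smul, lie_raise] at d
      linear_combination (norm := module) (-(1 / 13 : ℂ)) • d
    · have n3' : k - 3 ≠ 0 := by
        rw [hk, show 2 * ((m + 1 : ℕ) : ℂ) + 1 - 3 = 2 * m by push_cast; ring]
        exact_mod_cast (by omega : 2 * m ≠ 0)
      refine eq_smul_add_smul_of_smul_eq (h.recursion_three hm'.zero (lie_lowVec ..) t3 t4 z0
        (lie_lowVec ..) z2) ?_ ?_ ?_
      · rw [show -1 + 30 / ((k + 2) * (2 * k + 3)) + 60 / ((k + 2) * (2 * k + 3) * (k + 1)) =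
          -((k - 3) * (k * 2 + 7) * (k + 4)) / ((k + 1) * (k + 2) * (k * 2 + 3)) by
            field_simp; ring]
        simp [n1, n2, n4, d3, d7, n3']
      · field_simp
        ring
      · field_simp
        ring
  have z4 : ⁅raise x 4 z, lowVec 6 x y z (m + 2)⁆ =
      (60 / ((k + 4) * (2 * k + 7) * (k + 3))) • raise x 3 (lowVec 6 x y z (m + 2 + 1)) +
        (72 * (k + 1) * (3 * p - (5 * (k + 2) * (k + 3) - 3) * q) / (2 * k + 7)) •
          raise x 1 (lowVec 6 x y z (m + 2)) := by
    refine eq_smul_add_smul_of_smul_eq (h.recursion_four hm.zero hm'.zero (lie_lowVec ..) t2 t3 t5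
      z0
      (lie_lowVec ..) z2 z3) ?_ ?_ ?_
    · rw [show 5 / (k + 2) + 30 / ((k + 2) * (2 * k + 3)) -
        150 / ((k + 2) * (2 * k + 3) * (k + 1) * (2 * k + 1)) =
        5 * (k * 2 - 1) * (k * 2 + 7) * (k + 3) /
          ((k + 2) * (k * 2 + 3) * (k + 1) * (k * 2 + 1)) by field_simp; ring]
      simp [n1, n2, n3, d1, d1', d3, d7]
    · field_simp
      ring
    · field_simp
      ring
  have z5 : ⁅raise x 5 z, lowVec 6 x y z (m + 2)⁆ =
      (150 / ((k + 4) * (2 * k + 7) * (k + 3) * (2 * k + 5))) •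
          raise x 4 (lowVec 6 x y z (m + 2 + 1)) +
        (360 * (k + 1) * (3 * p - (5 * (k + 2) * (k + 3) - 3) * q) /
          ((2 * k + 7) * (2 * k + 3))) • raise x 2 (lowVec 6 x y z (m + 2)) +
        (1080 * (k + 2) * (k + 1) * k ^ 2 * ((p - (k + 2) ^ 2 * q) * (p - (k + 1) ^ 2 * q)) /
          ((2 * k + 5) * (2 * k + 3))) • lowVec 6 x y z (m + 1) := by
    refine eq_smul_add_smul_add_smul_of_smul_eq (h.recursion_five hm.zero (lie_lowVec ..) hm'.zero
      (lie_lowVec ..) t2 t3 t4 t5 t6 z0 (lie_lowVec ..) z2 z3 z4) ?_ ?_ ?_ ?_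
    · rw [show 1 + 5 / (k + 2) - 60 / ((k + 2) * (2 * k + 3) * (k + 1)) -
        150 / ((k + 2) * (2 * k + 3) * (k + 1) * (2 * k + 1)) +
        90 / ((k + 2) * (2 * k + 3) * (k + 1) * (2 * k + 1) * k) =
        (k - 1) * (k * 2 - 1) * (k + 3) * (k * 2 + 5) * (k + 6) /
          ((k + 2) * (k * 2 + 3) * (k + 1) * (k * 2 + 1) * k) by field_simp; ring]
      simp [n0, n1, n1', n2, n3, n6, d1, d1', d3, d5]
    · field_simp
      ring
    · field_simp
      ring
    · field_simp
      ring
  have z6 : ⁅raise x 6 z, lowVec 6 x y z (m + 2)⁆ =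
      (90 / ((k + 4) * (2 * k + 7) * (k + 3) * (2 * k + 5) * (k + 2))) •
          raise x 5 (lowVec 6 x y z (m + 2 + 1)) +
        (360 * (3 * p - (5 * (k + 2) * (k + 3) - 3) * q) /
          ((2 * k + 7) * (2 * k + 3))) • raise x 3 (lowVec 6 x y z (m + 2)) +
        (3240 * (k + 2) * (k + 1) * k * ((p - (k + 2) ^ 2 * q) * (p - (k + 1) ^ 2 * q)) /
          ((2 * k + 5) * (2 * k + 3))) • raise x 1 (lowVec 6 x y z (m + 1)) := by
    -- This recursion also needs z₂ on Y_m, whose coefficient for the exponent k - 2 is 5 / k.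
    have hβ := hm.two
    rw [sub_add_cancel] at hβ
    refine eq_smul_add_smul_add_smul_of_smul_eq (h.recursion_six (lie_lowVec ..) hβ
      (lie_lowVec ..) t2 t3 t4 t6 (lie_lowVec ..) z2 z3 z4 z5) ?_ ?_ ?_ ?_
    · rw [show 2 - 30 / ((k + 2) * (2 * k + 3)) - 60 / ((k + 2) * (2 * k + 3) * (k + 1)) +
        2 * (90 / ((k + 2) * (2 * k + 3) * (k + 1) * (2 * k + 1) * k)) =
        2 * (k - 1) * (k * 2 - 3) * (k * 2 + 5) * (k + 3) /
          ((k * 2 + 3) * (k + 1) * (k * 2 + 1) * k) by field_simp; ring]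
      simp [n0, n1, n1', n3, d1, d3, d3', d5]
    · field_simp
      ring
    · field_simp
      ring
    · field_simp
      ring
  refine ⟨by rw [hk]; push_cast; ring, h.isLowest_succ (by decide) hm'.low hm'.zero, z0,
    z2.trans ?_, z3.trans ?_, z4.trans ?_, z5.trans ?_, z6.trans ?_⟩
  · congr 2; ring
  all_goals
    congr 3 <;> ring

theorem action (m : ℕ) : OspAction p q x y z m (2 * m + 1) := by
  have key : OspAction p q x y z m (2 * m + 1) ∧
      OspAction p q x y z (m + 1) (2 * m + 3) := by
    induction m with
    | zero => simpa using And.intro h.action_zero h.action_one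
    | succ m ih =>
      have e1 : (2 * ((m + 1 : ℕ) : ℂ) + 1) = 2 * m + 3 := by push_cast; ring
      have e2 : (2 * ((m + 1 : ℕ) : ℂ) + 3) = 2 * m + 3 + 2 := by push_cast; ring
      have e3 : (2 * (m : ℂ) + 1) = 2 * m + 3 - 2 := by ring
      rw [e1, e2]
      exact ⟨ih.2, h.action_succ (e3 ▸ ih.1) ih.2⟩
  exact key.1

end IsOspTriple
end

/-! ### Normal forms modulo the relations -/

section Generic

variable {L L' : Type} [LieRing L] [LieAlgebra ℂ L] [LieRing L'] [LieAlgebra ℂ L']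

/-- The quotient homomorphism of Lie algebras. -/
def quotHom (I : LieIdeal ℂ L) : L →ₗ⁅ℂ⁆ L ⧸ I :=
  { (LieSubmodule.Quotient.mk' I : L →ₗ[ℂ] L ⧸ I) with
    map_lie' := fun {x y} => LieSubmodule.Quotient.mk_bracket I x y }

theorem quotHom_eq_zero {I : LieIdeal ℂ L} {a : L} : quotHom I a = 0 ↔ a ∈ I :=
  LieSubmodule.Quotient.mk_eq_zero I

theorem quotHom_eq {I : LieIdeal ℂ L} {a b : L} : quotHom I a = quotHom I b ↔ a - b ∈ I := by
  rw [← sub_eq_zero, ← map_sub, quotHom_eq_zero]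

theorem quotHom_surjective (I : LieIdeal ℂ L) : Function.Surjective (quotHom I) :=
  LieSubmodule.Quotient.surjective_mk' I

/-- The third generator of the free Lie algebra. -/
noncomputable def genZ : Free := FreeLieAlgebra.of ℂ Gen.z

theorem fZ_eq (i : ℕ) : fZ i = raise fX i genZ := rfl

theorem evalHom_fX (a b c : L) : evalHom a b c fX = a := FreeLieAlgebra.lift_of_apply ..

theorem evalHom_fY (a b c : L) : evalHom a b c fY = b := FreeLieAlgebra.lift_of_apply ..

theorem evalHom_genZ (a b c : L) : evalHom a b c genZ = c := FreeLieAlgebra.lift_of_apply ..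

theorem hom_eq_evalHom (f : Free →ₗ⁅ℂ⁆ L) : f = evalHom (f fX) (f fY) (f genZ) := by
  refine FreeLieAlgebra.hom_ext fun g => ?_
  cases g
  · exact (evalHom_fX ..).symm
  · exact (evalHom_fY ..).symm
  · exact (evalHom_genZ ..).symm

theorem map_evalHom (f : L →ₗ⁅ℂ⁆ L') (a b c : L) (r : Free) :
    f (evalHom a b c r) = evalHom (f a) (f b) (f c) r := by
  have h := hom_eq_evalHom (f.comp (evalHom a b c))
  simp only [LieHom.comp_apply, evalHom_fX, evalHom_fY, evalHom_genZ] at h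
  exact congrArg (fun g : Free →ₗ⁅ℂ⁆ L' => g r) h

theorem evalHom_self (r : Free) : evalHom fX fY genZ r = r := by
  have h := hom_eq_evalHom (LieHom.id : Free →ₗ⁅ℂ⁆ Free)
  exact (congrArg (fun g : Free →ₗ⁅ℂ⁆ Free => g r) h).symm

/-- A Lie subalgebra of the free Lie algebra that contains the generators is everything. -/
theorem mem_of_gen_mem (S : LieSubalgebra ℂ Free) (hx : fX ∈ S) (hy : fY ∈ S) (hz : genZ ∈ S)
    (r : Free) : r ∈ S := by
  have h := map_evalHom S.incl ⟨fX, hx⟩ ⟨fY, hy⟩ ⟨genZ, hz⟩ r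
  have h1 : evalHom fX fY genZ r = r := evalHom_self r
  change (evalHom (⟨fX, hx⟩ : S) ⟨fY, hy⟩ ⟨genZ, hz⟩ r : Free) = evalHom fX fY genZ r at h
  rw [h1] at h
  rw [← h]
  exact Subtype.property _

/-- The elements killed by some power of ad x form a subalgebra, the Engel subalgebra. It contains
x, y and z, hence Y_m, and for a lowest weight vector `pow_eq_zero` gives the exact exponent. -/
theorem IsTriple.raise_lowVec_eq_zero {N : ℕ} {x y z : L} (h : IsTriple N x y z) (m : ℕ)
    (hm : IsLowest x y (lowVec N x y z m) (lowWt N m)) :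
    raise x (lowWt N m + 1) (lowVec N x y z m) = 0 := by
  have hx : x ∈ LieSubalgebra.engel ℂ x := LieSubalgebra.self_mem_engel ℂ x
  have hy : y ∈ LieSubalgebra.engel ℂ x := by
    rw [LieSubalgebra.mem_engel_iff]
    refine ⟨3, ?_⟩
    rw [ad_pow_succ_apply, ad_pow_succ_apply, ad_pow_succ_apply]
    change ⁅x, ⁅x, ⁅x, y⁆⁆⁆ = 0
    rw [h.lie_x_y_x, lie_neg, lie_smul, lie_self, smul_zero, neg_zero]
  have hz : z ∈ LieSubalgebra.engel ℂ x := by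
    rw [LieSubalgebra.mem_engel_iff]
    exact ⟨N + 1, h.top⟩
  have hm' : lowVec N x y z m ∈ LieSubalgebra.engel ℂ x := by
    clear hm
    induction m with
    | zero => exact (LieSubalgebra.engel ℂ x).smul_mem _ hy
    | succ m ih =>
      rw [← lie_lowVec]
      refine LieSubalgebra.lie_mem _ ?_ ih
      exact LieSubalgebra.lie_mem _ hx hz
  rw [LieSubalgebra.mem_engel_iff] at hm'
  obtain ⟨n, hn⟩ := hm'
  exact hm.pow_eq_zero h.pair hn

end Generic

/-- The vector `(ad x)^i Y_m` of the free Lie algebra, for `v = (m, i)`. -/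
noncomputable def vec (N : ℕ) (v : ℕ × ℕ) : Free := raise fX v.2 (lowVec N fX fY genZ v.1)

/-- The pairs `(m, i)` with `m ∈ K` and `i` at most the weight of `Y_m`. -/
abbrev Index (N : ℕ) (K : Set ℕ) : Type := {v : ℕ × ℕ // v.1 ∈ K ∧ v.2 ≤ lowWt N v.1}

/-- The linear combination of the vectors `vec` with given polynomial coefficients, specialized at
`s`. -/
noncomputable def combo (N : ℕ) (K : Set ℕ) (s : ℂ) : (Index N K →₀ ℂ[X]) →ₗ[ℂ] Free :=
  Finsupp.linearCombination ℂ (fun v : Index N K => vec N v) ∘ₗ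
    Finsupp.mapRange.linearMap (Polynomial.leval s)

theorem combo_single (N : ℕ) (K : Set ℕ) (s : ℂ) (v : Index N K) (P : ℂ[X]) :
    combo N K s (Finsupp.single v P) = P.eval s • vec N v := by
  simp [combo, Polynomial.leval]

theorem combo_smul (N : ℕ) (K : Set ℕ) (s : ℂ) (P : ℂ[X]) (c : Index N K →₀ ℂ[X]) :
    combo N K s (P • c) = P.eval s • combo N K s c := by
  induction c using Finsupp.induction_linear with
  | zero => simp
  | add c c' h h' => rw [smul_add, map_add, map_add, h, h', smul_add]
  | single v Q => rw [Finsupp.smul_single, combo_single, combo_single, smul_eq_mul, eval_mul,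
      mul_smul]

/-- The family `f` of elements of the free Lie algebra is, modulo the ideals `I s`, a linear
combination of the vectors `vec` with polynomial coefficients. -/
def HasNormalForm (N : ℕ) (K : Set ℕ) (I : ℂ → LieIdeal ℂ Free) (f : ℂ → Free) : Prop :=
  ∃ c : Index N K →₀ ℂ[X], ∀ s, f s - combo N K s c ∈ I s

namespace HasNormalForm

variable {N : ℕ} {K : Set ℕ} {I : ℂ → LieIdeal ℂ Free} {f g : ℂ → Free}

theorem of_mem (h : ∀ s, f s ∈ I s) : HasNormalForm N K I f := ⟨0, by simpa using h⟩

theorem congr (hf : HasNormalForm N K I f) (h : ∀ s, g s - f s ∈ I s) :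
    HasNormalForm N K I g := by
  obtain ⟨c, hc⟩ := hf
  refine ⟨c, fun s => ?_⟩
  have := add_mem (h s) (hc s)
  rwa [sub_add_sub_cancel] at this

theorem add (hf : HasNormalForm N K I f) (hg : HasNormalForm N K I g) :
    HasNormalForm N K I (fun s => f s + g s) := by
  obtain ⟨c, hc⟩ := hf
  obtain ⟨d, hd⟩ := hg
  refine ⟨c + d, fun s => ?_⟩
  have := add_mem (hc s) (hd s)
  rwa [map_add, add_sub_add_comm]

theorem poly_smul (P : ℂ[X]) (hf : HasNormalForm N K I f) :
    HasNormalForm N K I (fun s => P.eval s • f s) := by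
  obtain ⟨c, hc⟩ := hf
  refine ⟨P • c, fun s => ?_⟩
  rw [combo_smul, ← smul_sub]
  exact (I s).smul_mem _ (hc s)

theorem smul (a : ℂ) (hf : HasNormalForm N K I f) : HasNormalForm N K I (fun s => a • f s) := by
  simpa using hf.poly_smul (C a)

theorem sub (hf : HasNormalForm N K I f) (hg : HasNormalForm N K I g) :
    HasNormalForm N K I (fun s => f s - g s) := by
  simpa [sub_eq_add_neg] using hf.add (hg.smul (-1))

theorem single (v : Index N K) : HasNormalForm N K I (fun _ => vec N v) :=
  ⟨Finsupp.single v 1, fun s => by simp [combo_single]⟩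

/-- By linearity only the basis vectors matter: the element a does not depend on s, so the
polynomial coefficients pass through the bracket. -/
theorem lie {a : Free} (ha : ∀ v : Index N K, HasNormalForm N K I (fun _ => ⁅a, vec N v⁆))
    (hf : HasNormalForm N K I f) : HasNormalForm N K I (fun s => ⁅a, f s⁆) := by
  obtain ⟨c, hc⟩ := hf
  have key : HasNormalForm N K I (fun s => ⁅a, combo N K s c⁆) := by
    clear hc
    induction c using Finsupp.induction_linear with
    | zero => exact of_mem fun s => by simp
    | add c d h h' => simpa only [map_add, lie_add] using h.add h'
    | single v P => simpa only [combo_single, lie_smul] using (ha v).poly_smul P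
  refine key.congr fun s => ?_
  rw [← lie_sub]
  exact (I s).lie_mem (hc s)

end HasNormalForm

/-- The relations of types 0 and 1 hold modulo the ideals `I s`, the vectors `Y_m` are lowest weight
vectors modulo these ideals, and vanish for `m ∉ K`. -/
structure IsFamily (N : ℕ) (K : Set ℕ) (I : ℂ → LieIdeal ℂ Free) : Prop where
  triple : ∀ s, IsTriple N (quotHom (I s) fX) (quotHom (I s) fY) (quotHom (I s) genZ)
  low : ∀ s m, IsLowest (quotHom (I s) fX) (quotHom (I s) fY)
    (quotHom (I s) (lowVec N fX fY genZ m)) (lowWt N m)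
  mem : ∀ s, ∀ m ∉ K, lowVec N fX fY genZ m ∈ I s

namespace IsFamily

variable {N : ℕ} {K : Set ℕ} {I : ℂ → LieIdeal ℂ Free} (hI : IsFamily N K I)
include hI

/-- Pairs outside the index set are allowed too: there the vector lies in the ideals, either because
Y_m does or because i exceeds the weight. -/
theorem hasNormalForm_vec (v : ℕ × ℕ) : HasNormalForm N K I (fun _ => vec N v) := by
  by_cases h1 : v.1 ∈ K
  · by_cases h2 : v.2 ≤ lowWt N v.1
    · exact HasNormalForm.single ⟨v, h1, h2⟩
    · refine HasNormalForm.of_mem fun s => ?_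
      obtain ⟨j, hj⟩ := Nat.exists_eq_add_of_lt (not_le.1 h2)
      have h3 := hI.low s v.1
      rw [map_lowVec] at h3
      have h4 := (hI.triple s).raise_lowVec_eq_zero v.1 h3
      rw [← quotHom_eq_zero, vec, map_raise, map_lowVec, hj,
        show lowWt N v.1 + j + 1 = j + (lowWt N v.1 + 1) by omega, raise_add, h4,
        raise_apply_zero]
  · refine HasNormalForm.of_mem fun s => ?_
    rw [← quotHom_eq_zero, vec, map_raise, quotHom_eq_zero.2 (hI.mem s v.1 h1), raise_apply_zero]

theorem hasNormalForm_lie_fX (v : ℕ × ℕ) : HasNormalForm N K I (fun _ => ⁅fX, vec N v⁆) := by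
  have h := hI.hasNormalForm_vec (v.1, v.2 + 1)
  rwa [vec, ← lie_raise] at h

theorem hasNormalForm_lie_fY (v : ℕ × ℕ) : HasNormalForm N K I (fun _ => ⁅fY, vec N v⁆) := by
  obtain ⟨m, i⟩ := v
  cases i with
  | zero =>
    refine HasNormalForm.of_mem fun s => ?_
    rw [← quotHom_eq_zero, LieHom.map_lie, vec, raise_zero]
    exact (hI.low s m).lie_y
  | succ i =>
    refine ((hI.hasNormalForm_vec (m, i)).smul ((i + 1) * (lowWt N m - i))).congr fun s => ?_
    rw [← quotHom_eq, LieHom.map_lie, vec, map_raise, map_smul, vec, map_raise]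
    exact (hI.low s m).lie_y_pow (hI.triple s).pair i

/-- Moving x out of the second argument trades (ad x)^{i+1} Y_m for (ad x)^i Y_m at the price of
replacing z_j by z_{j+1}; hence an induction on i for all j at once, starting from the lowest weight
vectors. -/
theorem hasNormalForm_lie_fZ (h : ∀ m j, HasNormalForm N K I (fun _ => ⁅fZ j, vec N (m, 0)⁆))
    (v : ℕ × ℕ) (j : ℕ) : HasNormalForm N K I (fun _ => ⁅fZ j, vec N v⁆) := by
  obtain ⟨m, i⟩ := v
  induction i generalizing j with
  | zero => exact h m j
  | succ i ih =>
    have h1 := (HasNormalForm.lie (fun v => hI.hasNormalForm_lie_fX v) (ih j)).sub (ih (j + 1))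
    have h2 : ⁅fZ j, vec N (m, i + 1)⁆ = ⁅fX, ⁅fZ j, vec N (m, i)⁆⁆ - ⁅fZ (j + 1), vec N (m, i)⁆ :=
      lie_raise_succ ..
    rwa [h2]

/-- Two subalgebras that contain the generators. The elements whose bracket with each basis vector
has a normal form are a subalgebra `S`, hence everything; therefore the elements that have a normal
form are closed under brackets and are a subalgebra `T`, hence everything. -/
theorem hasNormalForm (hN : N ≠ 0)
    (h : ∀ m j, HasNormalForm N K I (fun _ => ⁅fZ j, vec N (m, 0)⁆)) (r : Free) :
    HasNormalForm N K I (fun _ => r) := by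
  let S : LieSubalgebra ℂ Free :=
    { carrier := {a | ∀ v : Index N K, HasNormalForm N K I (fun _ => ⁅a, vec N v⁆)}
      add_mem' := fun {a b} ha hb v => by simpa only [add_lie] using (ha v).add (hb v)
      zero_mem' := fun v => HasNormalForm.of_mem fun s => by simp
      smul_mem' := fun c a ha v => by simpa only [smul_lie] using (ha v).smul c
      lie_mem' := fun {a b} ha hb v => by
        simpa only [lie_lie] using
          (HasNormalForm.lie ha (hb v)).sub (HasNormalForm.lie hb (ha v)) }
  have hS (a : Free) : a ∈ S := mem_of_gen_mem S (fun v => hI.hasNormalForm_lie_fX v)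
    (fun v => hI.hasNormalForm_lie_fY v) (fun v => hI.hasNormalForm_lie_fZ h v 0) a
  let T : LieSubalgebra ℂ Free :=
    { carrier := {a | HasNormalForm N K I (fun _ => a)}
      add_mem' := fun {a b} ha hb => HasNormalForm.add ha hb
      zero_mem' := HasNormalForm.of_mem fun s => by simp
      smul_mem' := fun c a ha => HasNormalForm.smul c ha
      lie_mem' := fun {a b} ha hb => HasNormalForm.lie (hS a) hb }
  have hN' : (N : ℂ) ≠ 0 := by exact_mod_cast hN
  refine mem_of_gen_mem T ?_ ?_ ?_ r
  -- Modulo the ideals (ad x)² y = -2x and Y₀ = -y/N, so that x = (N/2) (ad x)² Y₀.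
  · refine ((hI.hasNormalForm_vec (0, 2)).smul (N / 2)).congr fun s => ?_
    rw [← quotHom_eq, map_smul, vec, map_raise, map_lowVec, lowVec, raise_zero, raise_smul,
      raise_succ, raise_succ, raise_zero, (hI.triple s).lie_x_y_x, smul_neg, smul_smul, smul_neg,
      smul_smul]
    field_simp
    simp
  · refine ((hI.hasNormalForm_vec (0, 0)).smul (-N)).congr fun s => ?_
    rw [← quotHom_eq, map_smul, vec, lowVec, raise_zero, raise_zero, map_smul, smul_smul]
    field_simp
    simp
  · refine (hI.hasNormalForm_vec (1, 0)).congr fun s => ?_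
    rw [← quotHom_eq, vec, raise_zero, map_lowVec, (hI.triple s).lowVec_one hN]

end IsFamily


/-! ### Presentations and limits from normal forms -/

section Presentation

variable {L : Type} [LieRing L] [LieAlgebra ℂ L]

/-- The relations of types 0 to 3 for `sl`, with `a = p - 4 q`, `b = p - 9 q`. -/
def slRel (p q : ℂ) : Set Free := rel0 ∪ rel1 4 ∪ relSl23 (p - 4 * q) (p - 9 * q)

/-- The relations of types 0 to 3 for `o/sp`, with `a = p - 19 q`, `b = (p - 4 q) (p - 9 q)`,
`c = p - 49 q`. -/
def ospRel (p q : ℂ) : Set Free :=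
  rel0 ∪ rel1 6 ∪ relOsp23 (p - 19 * q) ((p - 4 * q) * (p - 9 * q)) (p - 49 * q)

theorem relSl_eq (lam t : ℂ) : relSl lam t = slRel (t ^ 2 * lam ^ 2) (t ^ 2) := by
  rw [relSl, slRel, mul_sub, mul_sub, mul_comm _ (4 : ℂ), mul_comm _ (9 : ℂ)]

theorem relOsp_eq (lam t : ℂ) : relOsp lam t = ospRel (t * lam ^ 2) t := by
  rw [relOsp, ospRel]
  congr 2 <;> ring

theorem relSlStar_eq (t : ℂ) : relSlStar t = slRel (t ^ 2) 0 := by simp [relSlStar, slRel]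

theorem relOspStar_eq (t : ℂ) : relOspStar t = ospRel t 0 := by
  simp [relOspStar, ospRel, pow_two]

theorem forall_mem_rel01 {N : ℕ} {f : Free →ₗ⁅ℂ⁆ L} :
    (∀ r ∈ rel0 ∪ rel1 N, f r = 0) ↔ IsTriple N (f fX) (f fY) (f genZ) := by
  simp only [rel0, rel1, Set.mem_union, Set.mem_insert_iff, Set.mem_singleton_iff, or_imp,
    forall_and, forall_eq, fZ_eq, raise_zero, map_sub, map_add, map_smul, LieHom.map_lie,
    map_raise, sub_eq_zero, add_eq_zero_iff_eq_neg]
  exact ⟨fun h => ⟨⟨h.1.1, h.1.2⟩, ⟨h.2.1, h.2.2.1⟩, h.2.2.2⟩,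
    fun h => ⟨⟨h.pair.lie_x, h.pair.lie_y⟩, h.low.lie_y, h.low.lie_h, h.top⟩⟩

theorem forall_mem_slRel {p q : ℂ} {f : Free →ₗ⁅ℂ⁆ L} :
    (∀ r ∈ slRel p q, f r = 0) ↔ IsSlTriple p q (f fX) (f fY) (f genZ) := by
  have h1 := forall_mem_rel01 (N := 4) (f := f)
  have h2 : (∀ r ∈ slRel p q, f r = 0) ↔ (∀ r ∈ rel0 ∪ rel1 4, f r = 0) ∧
      ∀ r ∈ relSl23 (p - 4 * q) (p - 9 * q), f r = 0 := by
    simp only [slRel, Set.mem_union, or_imp, forall_and]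
  rw [h2, h1]
  simp only [relSl23, Set.mem_insert_iff, Set.mem_singleton_iff, or_imp,
    forall_and, forall_eq, fZ_eq, raise_zero, map_sub, map_smul, LieHom.map_lie, map_raise,
    sub_eq_zero]
  exact ⟨fun h => ⟨h.1, h.2.1, h.2.2.1, h.2.2.2⟩, fun h => ⟨h.1, h.2, h.3, h.4⟩⟩

theorem forall_mem_ospRel {p q : ℂ} {f : Free →ₗ⁅ℂ⁆ L} :
    (∀ r ∈ ospRel p q, f r = 0) ↔ IsOspTriple p q (f fX) (f fY) (f genZ) := by
  have h1 := forall_mem_rel01 (N := 6) (f := f)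
  have h2 : (∀ r ∈ ospRel p q, f r = 0) ↔ (∀ r ∈ rel0 ∪ rel1 6, f r = 0) ∧
      ∀ r ∈ relOsp23 (p - 19 * q) ((p - 4 * q) * (p - 9 * q)) (p - 49 * q), f r = 0 := by
    simp only [ospRel, Set.mem_union, or_imp, forall_and]
  rw [h2, h1]
  simp only [relOsp23, Set.mem_insert_iff, Set.mem_singleton_iff, or_imp,
    forall_and, forall_eq, fZ_eq, raise_zero, map_sub, map_smul, LieHom.map_lie,
    map_raise]
  rw [sub_sub (_ - _)]
  simp only [sub_eq_zero (b := _ • _), sub_eq_zero (b := _ + _)]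
  exact ⟨fun h => ⟨h.1, h.2.1, h.2.2.1, h.2.2.2.1, h.2.2.2.2⟩,
    fun h => ⟨h.1, h.2, h.3, h.4, h.5⟩⟩

theorem isSlTriple_iff {p q : ℂ} {x y z : L} :
    IsSlTriple p q x y z ↔ ∀ r ∈ slRel p q, evalHom x y z r = 0 := by
  rw [forall_mem_slRel, evalHom_fX, evalHom_fY, evalHom_genZ]

theorem isOspTriple_iff {p q : ℂ} {x y z : L} :
    IsOspTriple p q x y z ↔ ∀ r ∈ ospRel p q, evalHom x y z r = 0 := by
  rw [forall_mem_ospRel, evalHom_fX, evalHom_fY, evalHom_genZ]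

theorem IsSlTriple.map {L' : Type} [LieRing L'] [LieAlgebra ℂ L'] {p q : ℂ} {x y z : L}
    (h : IsSlTriple p q x y z) (f : L →ₗ⁅ℂ⁆ L') : IsSlTriple p q (f x) (f y) (f z) :=
  isSlTriple_iff.2 fun r hr => by rw [← map_evalHom, isSlTriple_iff.1 h r hr, map_zero]

theorem IsOspTriple.map {L' : Type} [LieRing L'] [LieAlgebra ℂ L'] {p q : ℂ} {x y z : L}
    (h : IsOspTriple p q x y z) (f : L →ₗ⁅ℂ⁆ L') : IsOspTriple p q (f x) (f y) (f z) :=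
  isOspTriple_iff.2 fun r hr => by rw [← map_evalHom, isOspTriple_iff.1 h r hr, map_zero]

theorem IsSlTriple.of_injective {L' : Type} [LieRing L'] [LieAlgebra ℂ L'] {p q : ℂ} {x y z : L}
    (f : L →ₗ⁅ℂ⁆ L') (hf : Function.Injective f) (h : IsSlTriple p q (f x) (f y) (f z)) :
    IsSlTriple p q x y z :=
  isSlTriple_iff.2 fun r hr =>
    hf (by rw [map_evalHom, isSlTriple_iff.1 h r hr, map_zero])

theorem IsOspTriple.of_injective {L' : Type} [LieRing L'] [LieAlgebra ℂ L'] {p q : ℂ}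
    {x y z : L} (f : L →ₗ⁅ℂ⁆ L') (hf : Function.Injective f)
    (h : IsOspTriple p q (f x) (f y) (f z)) : IsOspTriple p q x y z :=
  isOspTriple_iff.2 fun r hr =>
    hf (by rw [map_evalHom, isOspTriple_iff.1 h r hr, map_zero])

/-- Since Y₁ = z, applying ad z₁ another k times gives Y_{k+1}: dimension shearing is the vanishing
of one lowest weight vector. -/
theorem map_shear (f : Free →ₗ⁅ℂ⁆ L) {N : ℕ} (hN : N ≠ 0)
    (h : IsTriple N (f fX) (f fY) (f genZ)) (k : ℕ) :
    f (shear k) = lowVec N (f fX) (f fY) (f genZ) (k + 1) := by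
  have h1 := h.lowVec_one hN
  change f (raise (raise fX 1 genZ) k genZ) = raise (raise _ 1 _) (k + 1) _
  change raise (raise _ 1 _) 1 _ = _ at h1
  rw [map_raise, map_raise, raise_add, h1]

/-- The vectors `Y_m`, `m ≥ n + 1`, belong to an ideal that contains the relation
`(ad z₁)^n z = 0`. -/
theorem lowVec_mem_of_shear_mem {I : LieIdeal ℂ Free} {N : ℕ} (hN : N ≠ 0)
    (h : IsTriple N (quotHom I fX) (quotHom I fY) (quotHom I genZ)) {n : ℕ} (hn : shear n ∈ I)
    {m : ℕ} (hm : n < m) : lowVec N fX fY genZ m ∈ I := by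
  obtain ⟨j, rfl⟩ := Nat.exists_eq_add_of_lt hm
  have h1 := map_shear _ hN h n
  rw [quotHom_eq_zero.2 hn, ← map_lowVec, eq_comm, quotHom_eq_zero] at h1
  clear hm
  induction j with
  | zero => exact h1
  | succ j ih =>
    have h2 := I.lie_mem (x := raise fX 1 genZ) ih
    rwa [lie_lowVec] at h2

/-- The coefficients in `SlAction` are polynomial in p and q, so they stay polynomial in s when p
and q are. The brackets with z_j need attention only for j ≤ 4, as z₅ = 0. -/
theorem hasNormalForm_slRel {K : Set ℕ} {I : ℂ → LieIdeal ℂ Free} (p q : ℂ[X])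
    (h : ∀ s, ∀ r ∈ slRel (p.eval s) (q.eval s), r ∈ I s)
    (hK : ∀ s, ∀ m ∉ K, lowVec 4 fX fY genZ m ∈ I s) (r : Free) :
    HasNormalForm 4 K I (fun _ => r) := by
  have hT (s : ℂ) : IsSlTriple (p.eval s) (q.eval s) (quotHom (I s) fX) (quotHom (I s) fY)
      (quotHom (I s) genZ) :=
    forall_mem_slRel.1 fun r hr => quotHom_eq_zero.2 (h s r hr)
  have hI : IsFamily 4 K I := ⟨fun s => (hT s).toIsTriple,
    fun s m => by rw [map_lowVec]; exact ((hT s).action m).low, hK⟩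
  refine hI.hasNormalForm (by decide) (fun m j => ?_) r
  have e (s : ℂ) : quotHom (I s) ⁅fZ j, vec 4 (m, 0)⁆ = ⁅raise (quotHom (I s) fX) j
      (quotHom (I s) genZ), lowVec 4 (quotHom (I s) fX) (quotHom (I s) fY)
      (quotHom (I s) genZ) m⁆ := by
    rw [LieHom.map_lie, fZ_eq, vec, raise_zero, map_raise, map_lowVec]
  match j, e with
  | 0, e =>
    refine HasNormalForm.of_mem fun s => ?_
    rw [← quotHom_eq_zero, e]
    exact ((hT s).action m).zero
  | 1, e =>
    have h1 := hI.hasNormalForm_vec (m + 1, 0)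
    rw [vec, raise_zero, ← lie_lowVec] at h1
    exact h1
  | 2, e =>
    refine ((hI.hasNormalForm_vec (m + 1, 1)).smul (3 / (m + 2))).congr fun s => ?_
    rw [← quotHom_eq, e, ((hT s).action m).two, map_smul, vec, map_raise, map_lowVec]
  | 3, e =>
    refine (((hI.hasNormalForm_vec (m + 1, 2)).smul (9 / ((m + 2) * (2 * m + 3)))).add
      ((hI.hasNormalForm_vec (m - 1, 0)).poly_smul
        (C (-(48 * (m + 1) * m ^ 2 / (2 * m + 3)) : ℂ) * (p - C ((m + 1) ^ 2 : ℂ) * q)))).congr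
      fun s => ?_
    rw [← quotHom_eq, e, ((hT s).action m).three]
    simp only [map_add, map_smul, vec, map_raise, map_lowVec, raise_zero, eval_mul, eval_sub,
      eval_C]
    congr 2
    ring
  | 4, e =>
    refine (((hI.hasNormalForm_vec (m + 1, 3)).smul (6 / ((m + 1) * (m + 2) * (2 * m + 3)))).add
      ((hI.hasNormalForm_vec (m - 1, 1)).poly_smul
        (C (-(96 * (m + 1) * m / (2 * m + 3)) : ℂ) * (p - C ((m + 1) ^ 2 : ℂ) * q)))).congr fun s
        => ?_
    rw [← quotHom_eq, e, ((hT s).action m).four]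
    simp only [map_add, map_smul, vec, map_raise, map_lowVec, eval_mul, eval_sub, eval_C]
    congr 2
    ring
  | j + 5, e =>
    refine HasNormalForm.of_mem fun s => ?_
    rw [← quotHom_eq_zero, e, raise_add, (hT s).top, raise_apply_zero, zero_lie]

theorem hasNormalForm_ospRel {K : Set ℕ} {I : ℂ → LieIdeal ℂ Free} (p q : ℂ[X])
    (h : ∀ s, ∀ r ∈ ospRel (p.eval s) (q.eval s), r ∈ I s)
    (hK : ∀ s, ∀ m ∉ K, lowVec 6 fX fY genZ m ∈ I s) (r : Free) :
    HasNormalForm 6 K I (fun _ => r) := by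
  have hT (s : ℂ) : IsOspTriple (p.eval s) (q.eval s) (quotHom (I s) fX) (quotHom (I s) fY)
      (quotHom (I s) genZ) :=
    forall_mem_ospRel.1 fun r hr => quotHom_eq_zero.2 (h s r hr)
  have hI : IsFamily 6 K I := ⟨fun s => (hT s).toIsTriple,
    fun s m => by rw [map_lowVec]; exact ((hT s).action m).low, hK⟩
  refine hI.hasNormalForm (by decide) (fun m j => ?_) r
  have e (s : ℂ) : quotHom (I s) ⁅fZ j, vec 6 (m, 0)⁆ = ⁅raise (quotHom (I s) fX) j
      (quotHom (I s) genZ), lowVec 6 (quotHom (I s) fX) (quotHom (I s) fY)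
      (quotHom (I s) genZ) m⁆ := by
    rw [LieHom.map_lie, fZ_eq, vec, raise_zero, map_raise, map_lowVec]
  obtain ⟨k, hk⟩ : ∃ k : ℂ, k = 2 * m + 1 := ⟨_, rfl⟩
  have hA (s : ℂ) := (hT s).action m
  rw [← hk] at hA
  match j, e with
  | 0, e =>
    refine HasNormalForm.of_mem fun s => ?_
    rw [← quotHom_eq_zero, e]
    exact (hA s).zero
  | 1, e =>
    have h1 := hI.hasNormalForm_vec (m + 1, 0)
    rw [vec, raise_zero, ← lie_lowVec] at h1
    exact h1
  | 2, e =>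
    refine ((hI.hasNormalForm_vec (m + 1, 1)).smul (5 / (k + 2))).congr fun s => ?_
    rw [← quotHom_eq, e, (hA s).two, map_smul, vec, map_raise, map_lowVec]
  | 3, e =>
    refine (((hI.hasNormalForm_vec (m + 1, 2)).smul (30 / ((k + 2) * (2 * k + 3)))).add
      ((hI.hasNormalForm_vec (m, 0)).poly_smul
        (C (12 * k * (k - 1) / (2 * k + 3)) * (C 3 * p - C (5 * k * (k + 1) - 3) * q)))).congr
      fun s => ?_
    rw [← quotHom_eq, e, (hA s).three]
    simp only [map_add, map_smul, vec, map_raise, map_lowVec, raise_zero, eval_mul, eval_sub,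
      eval_C]
    congr 2
    ring
  | 4, e =>
    refine (((hI.hasNormalForm_vec (m + 1, 3)).smul
      (60 / ((k + 2) * (2 * k + 3) * (k + 1)))).add
      ((hI.hasNormalForm_vec (m, 1)).poly_smul
        (C (72 * (k - 1) / (2 * k + 3)) * (C 3 * p - C (5 * k * (k + 1) - 3) * q)))).congr
      fun s => ?_
    rw [← quotHom_eq, e, (hA s).four]
    simp only [map_add, map_smul, vec, map_raise, map_lowVec, eval_mul, eval_sub, eval_C]
    congr 2
    ring
  | 5, e =>
    refine ((((hI.hasNormalForm_vec (m + 1, 4)).smul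
      (150 / ((k + 2) * (2 * k + 3) * (k + 1) * (2 * k + 1)))).add
      ((hI.hasNormalForm_vec (m, 2)).poly_smul
        (C (360 * (k - 1) / ((2 * k + 3) * (2 * k - 1))) *
          (C 3 * p - C (5 * k * (k + 1) - 3) * q)))).add
      ((hI.hasNormalForm_vec (m - 1, 0)).poly_smul
        (C (1080 * k * (k - 1) * (k - 2) ^ 2 / ((2 * k + 1) * (2 * k - 1))) *
          ((p - C (k ^ 2) * q) * (p - C ((k - 1) ^ 2) * q))))).congr fun s => ?_
    rw [← quotHom_eq, e, (hA s).five]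
    simp only [map_add, map_smul, vec, map_raise, map_lowVec, raise_zero, eval_mul, eval_sub,
      eval_C]
    congr 2
    · congr 2
      ring
    · ring
  | 6, e =>
    refine ((((hI.hasNormalForm_vec (m + 1, 5)).smul
      (90 / ((k + 2) * (2 * k + 3) * (k + 1) * (2 * k + 1) * k))).add
      ((hI.hasNormalForm_vec (m, 3)).poly_smul
        (C (360 / ((2 * k + 3) * (2 * k - 1))) *
          (C 3 * p - C (5 * k * (k + 1) - 3) * q)))).add
      ((hI.hasNormalForm_vec (m - 1, 1)).poly_smul
        (C (3240 * k * (k - 1) * (k - 2) / ((2 * k + 1) * (2 * k - 1))) *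
          ((p - C (k ^ 2) * q) * (p - C ((k - 1) ^ 2) * q))))).congr fun s => ?_
    rw [← quotHom_eq, e, (hA s).six]
    simp only [map_add, map_smul, vec, map_raise, map_lowVec, eval_mul, eval_sub, eval_C]
    congr 2
    · congr 2
      ring
    · ring
  | j + 7, e =>
    refine HasNormalForm.of_mem fun s => ?_
    rw [← quotHom_eq_zero, e, raise_add, (hT s).top, raise_apply_zero, zero_lie]

/-- Nonzero lowest weight vectors of different weights are linearly independent. -/
theorem linearIndependent_of_isLowest {x y : L} {κ : Type} {v : κ → L} {w : κ → ℕ}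
    (hw : Function.Injective w) (hv : ∀ k, IsLowest x y (v k) (w k)) (hne : ∀ k, v k ≠ 0) :
    LinearIndependent ℂ v := by
  refine Module.End.eigenvectors_linearIndependent' (LieAlgebra.ad ℂ L ⁅x, y⁆)
    (fun k => -(w k : ℂ)) (fun k k' h => hw (by simpa using h)) v
    fun k => ⟨Module.End.mem_eigenspace_iff.2 ?_, hne k⟩
  rw [LieAlgebra.ad_apply, (hv k).lie_h, neg_smul]

/-- The images of the vectors `vec` are linearly independent if the images of the lowest weight
vectors are nonzero. -/
theorem linearIndependent_map_vec {N : ℕ} (hN : 3 ≤ N) {K : Set ℕ} {x y z : L}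
    (hs : IsSl2Pair x y) (hlow : ∀ m, IsLowest x y (lowVec N x y z m) (lowWt N m))
    (hne : ∀ m ∈ K, lowVec N x y z m ≠ 0) :
    LinearIndependent ℂ fun v : Index N K => evalHom x y z (vec N v) := by
  have hw : Function.Injective fun m : K => lowWt N m := fun m m' h => by
    have h1 : (m : ℕ) * (N - 2) = m' * (N - 2) := Nat.add_left_cancel h
    exact Subtype.ext (Nat.eq_of_mul_eq_mul_right (by omega) h1)
  have hi := linearIndependent_of_isLowest hw (fun m : K => hlow m) fun m => hne m m.2
  have h1 := linearIndependent_ad_pow hs (fun m : K => lowVec N x y z m)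
    (fun m => lowWt N m) (fun m => hlow m) hi
  have h2 := h1.comp (fun v : Index N K => ⟨(⟨v.1.1, v.2.1⟩, v.1.2), v.2.2⟩) (by
    rintro ⟨⟨m, i⟩, hm⟩ ⟨⟨m', i'⟩, hm'⟩ h
    simp only [Subtype.mk.injEq, Prod.mk.injEq] at h
    obtain ⟨rfl, rfl⟩ := h
    rfl)
  convert h2 using 2 with v
  rw [vec, map_raise, map_lowVec, evalHom_fX, evalHom_fY, evalHom_genZ]
  rfl

/-- An element of the kernel differs from its normal form by an element of the ideal, so the normal
form is in the kernel too; by independence its coefficients vanish. The family of ideals is constant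
here, and s = 0 is an arbitrary choice. -/
theorem isPresentedBy_of_hasNormalForm {N : ℕ} {K : Set ℕ} {a b c : L} {R : Set Free}
    (hR : ∀ r ∈ R, evalHom a b c r = 0)
    (hnf : ∀ r, HasNormalForm N K (fun _ => LieSubmodule.lieSpan ℂ Free R) (fun _ => r))
    (hi : LinearIndependent ℂ fun v : Index N K => evalHom a b c (vec N v))
    (hs : Function.Surjective (evalHom a b c)) : IsPresentedBy a b c R := by
  have hle : LieSubmodule.lieSpan ℂ Free R ≤ (evalHom a b c).ker :=
    LieSubmodule.lieSpan_le.2 fun r hr => (evalHom a b c).mem_ker.2 (hR r hr)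
  refine ⟨hs, le_antisymm (fun r hr => ?_) hle⟩
  obtain ⟨d, hd⟩ := hnf r
  have h1 := hd 0
  have h2 := sub_mem hr (hle h1)
  rw [sub_sub_cancel, LieHom.mem_ker] at h2
  have h3 : Finsupp.mapRange.linearMap (Polynomial.leval (0 : ℂ)) d = 0 := by
    refine linearIndependent_iff.1 hi _ ?_
    rw [← h2, combo, LinearMap.comp_apply]
    exact (Finsupp.apply_linearCombination ℂ (evalHom a b c : Free →ₗ[ℂ] L) _ _).symm
  rw [combo, LinearMap.comp_apply, h3, map_zero, sub_zero] at h1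
  exact h1

theorem isPresentedBy_slRel {K : Set ℕ} {p q : ℂ} {a b c : L} {R : Set Free}
    (hT : IsSlTriple p q a b c) (hR : ∀ r ∈ R, evalHom a b c r = 0)
    (hK : ∀ m ∉ K, lowVec 4 fX fY genZ m ∈ LieSubmodule.lieSpan ℂ Free (slRel p q ∪ R))
    (hne : ∀ m ∈ K, lowVec 4 a b c m ≠ 0)
    (hs : Function.Surjective (evalHom a b c)) : IsPresentedBy a b c (slRel p q ∪ R) := by
  refine isPresentedBy_of_hasNormalForm (N := 4) (K := K) ?_ ?_
    (linearIndependent_map_vec (by decide) hT.pair (fun m => (hT.action m).low) hne) hs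
  · rintro r (hr | hr)
    · refine forall_mem_slRel.2 ?_ r hr
      rwa [evalHom_fX, evalHom_fY, evalHom_genZ]
    · exact hR r hr
  · refine hasNormalForm_slRel (C p) (C q) (fun s r hr => ?_) (fun s => hK)
    rw [eval_C, eval_C] at hr
    exact LieSubmodule.subset_lieSpan (Or.inl hr)

theorem isPresentedBy_ospRel {K : Set ℕ} {p q : ℂ} {a b c : L} {R : Set Free}
    (hT : IsOspTriple p q a b c) (hR : ∀ r ∈ R, evalHom a b c r = 0)
    (hK : ∀ m ∉ K, lowVec 6 fX fY genZ m ∈ LieSubmodule.lieSpan ℂ Free (ospRel p q ∪ R))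
    (hne : ∀ m ∈ K, lowVec 6 a b c m ≠ 0)
    (hs : Function.Surjective (evalHom a b c)) : IsPresentedBy a b c (ospRel p q ∪ R) := by
  refine isPresentedBy_of_hasNormalForm (N := 6) (K := K) ?_ ?_
    (linearIndependent_map_vec (by decide) hT.pair (fun m => (hT.action m).low) hne) hs
  · rintro r (hr | hr)
    · refine forall_mem_ospRel.2 ?_ r hr
      rwa [evalHom_fX, evalHom_fY, evalHom_genZ]
    · exact hR r hr
  · refine hasNormalForm_ospRel (C p) (C q) (fun s r hr => ?_) (fun s => hK)
    rw [eval_C, eval_C] at hr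
    exact LieSubmodule.subset_lieSpan (Or.inl hr)

theorem isPresentedBy_slRel_univ {p q : ℂ} {a b c : L} (hT : IsSlTriple p q a b c)
    (hne : ∀ m, lowVec 4 a b c m ≠ 0)
    (hs : Function.Surjective (evalHom a b c)) : IsPresentedBy a b c (slRel p q) := by
  rw [← Set.union_empty (slRel p q)]
  exact isPresentedBy_slRel (K := Set.univ) hT (by simp) (by simp)
    (fun m _ => hne m) hs

theorem isPresentedBy_ospRel_univ {p q : ℂ} {a b c : L} (hT : IsOspTriple p q a b c)
    (hne : ∀ m, lowVec 6 a b c m ≠ 0)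
    (hs : Function.Surjective (evalHom a b c)) : IsPresentedBy a b c (ospRel p q) := by
  rw [← Set.union_empty (ospRel p q)]
  exact isPresentedBy_ospRel (K := Set.univ) hT (by simp) (by simp)
    (fun m _ => hne m) hs

/-- The relation puts Y_{n+1}, and with it all later Y_m, into the ideal, so only m ≤ n index the
basis. -/
theorem isPresentedBy_slRel_shear {p q : ℂ} {a b c : L} (hT : IsSlTriple p q a b c) (n : ℕ)
    (hn : lowVec 4 a b c (n + 1) = 0)
    (hne : ∀ m ≤ n, lowVec 4 a b c m ≠ 0)
    (hs : Function.Surjective (evalHom a b c)) :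
    IsPresentedBy a b c (slRel p q ∪ {shear n}) := by
  refine isPresentedBy_slRel (K := Set.Iic n) hT ?_ (fun m hm => ?_) hne hs
  · rintro r rfl
    rw [map_shear (N := 4) _ (by decide), evalHom_fX, evalHom_fY, evalHom_genZ, hn]
    rw [evalHom_fX, evalHom_fY, evalHom_genZ]
    exact hT.toIsTriple
  · refine lowVec_mem_of_shear_mem (by decide) (IsSlTriple.toIsTriple (p := p) (q := q) ?_)
      (LieSubmodule.subset_lieSpan (Or.inr rfl)) (not_le.1 hm)
    exact forall_mem_slRel.1 fun r hr =>
      quotHom_eq_zero.2 (LieSubmodule.subset_lieSpan (Or.inl hr))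

theorem isPresentedBy_ospRel_shear {p q : ℂ} {a b c : L} (hT : IsOspTriple p q a b c) (n : ℕ)
    (hn : lowVec 6 a b c (n + 1) = 0)
    (hne : ∀ m ≤ n, lowVec 6 a b c m ≠ 0)
    (hs : Function.Surjective (evalHom a b c)) :
    IsPresentedBy a b c (ospRel p q ∪ {shear n}) := by
  refine isPresentedBy_ospRel (K := Set.Iic n) hT ?_ (fun m hm => ?_) hne hs
  · rintro r rfl
    rw [map_shear (N := 6) _ (by decide), evalHom_fX, evalHom_fY, evalHom_genZ, hn]
    rw [evalHom_fX, evalHom_fY, evalHom_genZ]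
    exact hT.toIsTriple
  · refine lowVec_mem_of_shear_mem (by decide) (IsOspTriple.toIsTriple (p := p) (q := q) ?_)
      (LieSubmodule.subset_lieSpan (Or.inr rfl)) (not_le.1 hm)
    exact forall_mem_ospRel.1 fun r hr =>
      quotHom_eq_zero.2 (LieSubmodule.subset_lieSpan (Or.inl hr))

end Presentation

/-! ### Limits -/

section Limit

theorem HasNormalForm.sum_range {N : ℕ} {K : Set ℕ} {I : ℂ → LieIdeal ℂ Free} {c : ℕ → Free}
    (hc : ∀ i, HasNormalForm N K I (fun _ => c i)) (d : ℕ) :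
    HasNormalForm N K I (fun s => ∑ i ∈ Finset.range d, s ^ i • c i) := by
  induction d with
  | zero => exact of_mem fun s => by simp
  | succ d ih =>
    simp only [Finset.sum_range_succ]
    exact ih.add (by simpa using (hc d).poly_smul (X ^ d))

/-- Collecting the powers of s turns a normal form into the kind of polynomial that occurs in
`limitAtInfinity`. -/
theorem exists_combo_eq_sum (N : ℕ) (K : Set ℕ) (c : Index N K →₀ ℂ[X]) :
    ∃ (d : ℕ) (a : ℕ → Free), ∀ s, combo N K s c = ∑ i ∈ Finset.range (d + 1), s ^ i • a i := by
  have pad {d d' : ℕ} (h : d ≤ d') (a : ℕ → Free) (s : ℂ) :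
      ∑ i ∈ Finset.range (d' + 1), s ^ i • (if i ≤ d then a i else 0) =
        ∑ i ∈ Finset.range (d + 1), s ^ i • a i := by
    rw [← Finset.sum_subset (Finset.range_subset_range.2 (Nat.succ_le_succ h))]
    · refine Finset.sum_congr rfl fun i hi => ?_
      rw [if_pos (Nat.lt_succ_iff.1 (Finset.mem_range.1 hi))]
    · intro i _ hi
      rw [Finset.mem_range, not_lt] at hi
      rw [if_neg (by omega), smul_zero]
  induction c using Finsupp.induction_linear with
  | zero => exact ⟨0, 0, by simp⟩
  | add c c' h h' =>
    obtain ⟨d, a, h⟩ := h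
    obtain ⟨d', a', h'⟩ := h'
    refine ⟨max d d', fun i => (if i ≤ d then a i else 0) + (if i ≤ d' then a' i else 0),
      fun s => ?_⟩
    simp only [smul_add, Finset.sum_add_distrib]
    rw [pad (le_max_left _ _), pad (le_max_right _ _), map_add, h, h']
  | single v P =>
    refine ⟨P.natDegree, fun i => P.coeff i • vec N v, fun s => ?_⟩
    rw [combo_single, eval_eq_sum_range, Finset.sum_smul]
    exact Finset.sum_congr rfl fun i _ => by rw [smul_smul, mul_comm]

/-- In a family of ideals with a normal form, given by linearly independent vectors, the ideal at
`s = 0` is the limit of the ideals at `s = 1 / lam`, `lam → ∞`. -/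
theorem eq_limitAtInfinity {N : ℕ} {K : Set ℕ} {I : ℂ → LieIdeal ℂ Free}
    (hnf : ∀ r, HasNormalForm N K I (fun _ => r))
    (hi : ∀ s, ∀ c : Index N K →₀ ℂ,
      Finsupp.linearCombination ℂ (fun v : Index N K => vec N v) c ∈ I s → c = 0)
    {S : ℂ → Set Free} (hS : ∀ lam ≠ 0, S lam = I lam⁻¹) :
    (I 0 : Set Free) = limitAtInfinity S := by
  ext r
  constructor
  · intro hr
    obtain ⟨c, hc⟩ := hnf r
    have h0 : combo N K 0 c = 0 := by
      have h1 : combo N K 0 c ∈ I 0 := by simpa using sub_mem hr (hc 0)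
      have h2 := hi 0 _ h1
      rw [combo, LinearMap.comp_apply, h2, map_zero]
    obtain ⟨d, a, ha⟩ := exists_combo_eq_sum N K c
    -- The polynomial is r minus its normal form. The normal form vanishes at s = 0 because r is in
    -- the ideal there, so the constant term is r, while at every s the difference lies in the ideal
    -- by definition.
    refine ⟨d, fun i => if i = 0 then r else -a i, if_pos rfl, fun lam hlam => ?_⟩
    have ha0 := ha 0
    rw [h0, Finset.sum_range_succ'] at ha0
    have h3 : ∑ i ∈ Finset.range (d + 1), lam⁻¹ ^ i • (if i = 0 then r else -a i) =
        r - combo N K lam⁻¹ c := by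
      rw [ha, Finset.sum_range_succ', Finset.sum_range_succ']
      have h4 : a 0 = 0 := by simpa using ha0.symm
      simp [h4, sub_eq_add_neg, add_comm]
    rw [h3, hS lam hlam]
    exact hc _
  · rintro ⟨d, a, rfl, h⟩
    -- Conversely, the normal form of the given polynomial has coefficients that vanish at every s ≠
    -- 0, hence identically. At s = 0 the constant term is then congruent to zero.
    obtain ⟨c, hc⟩ := HasNormalForm.sum_range (fun i => hnf (a i)) (d + 1)
    have h1 : c = 0 := by
      ext1 v
      refine Polynomial.eq_zero_of_infinite_isRoot _ (Set.Infinite.mono ?_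
        (Set.infinite_of_finite_compl (s := {s : ℂ | s ≠ 0})
          ((Set.finite_singleton (0 : ℂ)).subset (by simp [Set.compl_ofPred]))))
      intro s hs
      have h2 := h s⁻¹ (inv_ne_zero hs)
      rw [hS _ (inv_ne_zero hs), inv_inv] at h2
      have h3 : combo N K s c ∈ I s := by simpa using sub_mem h2 (hc s)
      have h4 := hi s _ h3
      exact DFunLike.congr_fun h4 v
    have h2 := hc 0
    simp only [h1, map_zero, sub_zero, Finset.sum_range_succ'] at h2
    simpa using h2

variable {L : Type} [LieRing L] [LieAlgebra ℂ L]

theorem IsPresentedBy.eq_zero_of_mem {N : ℕ} {K : Set ℕ} {a b c : L} {R : Set Free}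
    (h : IsPresentedBy a b c R)
    (hi : LinearIndependent ℂ fun v : Index N K => evalHom a b c (vec N v))
    (d : Index N K →₀ ℂ) (hd : Finsupp.linearCombination ℂ (fun v : Index N K => vec N v) d ∈
      LieSubmodule.lieSpan ℂ Free R) : d = 0 := by
  rw [← h.2, LieHom.mem_ker] at hd
  refine linearIndependent_iff.1 hi _ ?_
  rw [← hd]
  exact (Finsupp.apply_linearCombination ℂ (evalHom a b c : Free →ₗ[ℂ] L) _ _).symm

end Limit


/-! ### Spanning by the images of powers under a derivation -/

section Span

variable {A : Type} [Ring A] [Algebra ℂ A]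

/-- The sum S of the span and N contains 1, so it suffices that S is stable under left
multiplication by x, y and h. On the powers of y this comes from applying δ: δ(y^{k+1}) yields h
y^k, and δ(h y^k) yields x y^k once the Casimir relation has eliminated h². The Leibniz rule extends
it to all δ^i(y^k). The parameter ε is 1 for U_λ, with N = 0, and 0 for commutative polynomials,
with N the ideal of the hyperboloid. -/
theorem span_derivation_pow_eq_top {δ : A →ₗ[ℂ] A} (hδ : ∀ a b, δ (a * b) = δ a * b + a * δ b)
    {x y h : A} {ε c : ℂ} (hx : δ x = 0) (hy : δ y = h) (hh : δ h = -((2 : ℂ) • x))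
    (hyh : y * h = h * y + (2 * ε) • y) {N : Submodule ℂ A} (hNmul : ∀ a, ∀ n ∈ N, a * n ∈ N)
    (hNδ : ∀ n ∈ N, δ n ∈ N)
    (hN : ∀ a, h * (h * a) + (4 : ℂ) • (x * (y * a)) - (2 * ε) • (h * a) - c • a ∈ N)
    (hgen : Algebra.adjoin ℂ {x, y, h} = ⊤) :
    Submodule.span ℂ (Set.range fun v : ℕ × ℕ => (δ ^ v.2) (y ^ v.1)) ⊔ N = ⊤ := by
  set S := Submodule.span ℂ (Set.range fun v : ℕ × ℕ => (δ ^ v.2) (y ^ v.1)) ⊔ N with hS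
  have hNS : N ≤ S := le_sup_right
  have he (k i : ℕ) : (δ ^ i) (y ^ k) ∈ S :=
    Submodule.mem_sup_left (Submodule.subset_span ⟨(k, i), rfl⟩)
  have hy' (k : ℕ) : y ^ k ∈ S := he k 0
  have hSδ : ∀ a ∈ S, δ a ∈ S := by
    have h1 : S ≤ S.comap δ := by
      refine sup_le (Submodule.span_le.2 ?_) fun n hn => hNS (hNδ n hn)
      rintro _ ⟨v, rfl⟩
      change δ ((δ ^ v.2) (y ^ v.1)) ∈ S
      have h2 := he v.1 (v.2 + 1)
      rwa [pow_succ'] at h2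
    exact h1
  have h1 : δ 1 = 0 := by
    have h2 := hδ 1 1
    rw [mul_one, one_mul, mul_one] at h2
    exact left_eq_add.1 h2
  have hcomm (k : ℕ) : y ^ k * h = h * y ^ k + (2 * ε * k) • y ^ k := by
    induction k with
    | zero => simp
    | succ k ih =>
      rw [pow_succ', mul_assoc, ih, mul_add, ← mul_assoc, hyh, add_mul, mul_smul_comm,
        smul_mul_assoc, mul_assoc, ← pow_succ']
      push_cast
      module
  have hδy (k : ℕ) : δ (y ^ (k + 1)) =
      ((k : ℂ) + 1) • (h * y ^ k) + (ε * k * (k + 1)) • y ^ k := by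
    induction k with
    | zero => simp [hy]
    | succ k ih =>
      have h3 : (δ (y ^ (k + 1))) * y + y ^ (k + 1) * h =
          (((k + 1 : ℕ) : ℂ) + 1) • (h * y ^ (k + 1)) +
            (ε * (k + 1 : ℕ) * ((k + 1 : ℕ) + 1)) • y ^ (k + 1) := by
        rw [ih, hcomm, add_mul, smul_mul_assoc, smul_mul_assoc, mul_assoc, ← pow_succ]
        push_cast
        module
      rw [pow_succ, hδ, hy, h3]
  have hhy (k : ℕ) : h * y ^ k ∈ S := by
    have h3 := S.sub_mem (hSδ _ (hy' (k + 1))) (S.smul_mem (ε * k * (k + 1)) (hy' k))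
    rw [hδy, add_sub_cancel_right] at h3
    exact (S.smul_mem_iff (by exact_mod_cast Nat.succ_ne_zero k)).1 h3
  have hxy (k : ℕ) : x * y ^ k ∈ S := by
    have h3 := hSδ _ (hhy k)
    rw [hδ, hh] at h3
    cases k with
    | zero =>
      rw [pow_zero, h1, mul_zero, add_zero, mul_one, ← neg_smul] at h3
      rw [pow_zero, mul_one]
      exact (S.smul_mem_iff (by norm_num)).1 h3
    | succ k =>
      rw [hδy] at h3
      have h4 := hNS (hN (y ^ k))
      rw [← pow_succ'] at h4
      -- Substituting the Casimir relation for h(h y^k) in δ(h y^{k+1}) gives x y^{k+1} the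
      -- coefficient -2 - 4(k + 1), which is not zero.
      have h5 : (-(2 : ℂ) - 4 * (k + 1)) • (x * y ^ (k + 1)) =
          (-((2 : ℂ) • x) * y ^ (k + 1) +
            h * (((k : ℂ) + 1) • (h * y ^ k) + (ε * k * (k + 1)) • y ^ k)) -
          (((k : ℂ) + 1) • (h * (h * y ^ k) + (4 : ℂ) • (x * y ^ (k + 1)) -
            (2 * ε) • (h * y ^ k) - c • y ^ k) +
            ((ε * k * (k + 1) + 2 * ε * (k + 1)) • (h * y ^ k) + (c * (k + 1)) • y ^ k)) := by
        rw [mul_add h, mul_smul_comm, mul_smul_comm, neg_mul, smul_mul_assoc]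
        module
      refine (S.smul_mem_iff (s := -(2 : ℂ) - 4 * (k + 1)) ?_).1 ?_
      · rw [show -(2 : ℂ) - 4 * (k + 1) = -((4 * (k + 1) + 1 + 1 : ℕ) : ℂ) by push_cast; ring,
          neg_ne_zero]
        exact Nat.cast_ne_zero.2 (Nat.succ_ne_zero _)
      · rw [h5]
        exact S.sub_mem h3 (S.add_mem (S.smul_mem _ h4)
          (S.add_mem (S.smul_mem _ (hhy k)) (S.smul_mem _ (hy' k))))
  have key (k i : ℕ) : x * (δ ^ i) (y ^ k) ∈ S ∧ y * (δ ^ i) (y ^ k) ∈ S ∧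
      h * (δ ^ i) (y ^ k) ∈ S := by
    induction i with
    | zero => exact ⟨hxy k, by simpa [← pow_succ'] using hy' (k + 1), hhy k⟩
    | succ i ih =>
      obtain ⟨h3, h4, h5⟩ := ih
      rw [pow_succ', Module.End.mul_apply]
      set e := (δ ^ i) (y ^ k)
      refine ⟨?_, ?_, ?_⟩
      · rw [show x * δ e = δ (x * e) by rw [hδ, hx, zero_mul, zero_add]]
        exact hSδ _ h3
      · rw [show y * δ e = δ (y * e) - h * e by rw [hδ, hy]; abel]
        exact S.sub_mem (hSδ _ h4) h5
      · rw [show h * δ e = δ (h * e) + (2 : ℂ) • (x * e) by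
          rw [hδ, hh, neg_mul, smul_mul_assoc]; abel]
        exact S.add_mem (hSδ _ h5) (S.smul_mem _ h3)
  have hmul (a : A) (ha : ∀ k i, a * (δ ^ i) (y ^ k) ∈ S) : ∀ s ∈ S, a * s ∈ S := by
    have h3 : S ≤ S.comap (LinearMap.mulLeft ℂ a) := by
      refine sup_le (Submodule.span_le.2 ?_) fun n hn => hNS (hNmul a n hn)
      rintro _ ⟨v, rfl⟩
      exact ha v.1 v.2
    exact h3
  let T : Subalgebra ℂ A :=
    { carrier := {a | ∀ s ∈ S, a * s ∈ S}
      mul_mem' := fun {a b} ha hb s hs => by rw [mul_assoc]; exact ha _ (hb _ hs)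
      add_mem' := fun {a b} ha hb s hs => by rw [add_mul]; exact S.add_mem (ha _ hs) (hb _ hs)
      algebraMap_mem' := fun r s hs => by
        rw [Algebra.algebraMap_eq_smul_one, smul_mul_assoc, one_mul]
        exact S.smul_mem _ hs }
  have hT : (⊤ : Subalgebra ℂ A) ≤ T := by
    rw [← hgen, Algebra.adjoin_le_iff]
    rintro a (rfl | rfl | rfl)
    · exact hmul _ fun k i => (key k i).1
    · exact hmul _ fun k i => (key k i).2.1
    · exact hmul _ fun k i => (key k i).2.2
  rw [eq_top_iff]
  intro a _
  have h3 : a ∈ T := hT trivial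
  have h4 := h3 1 (by simpa using hy' 0)
  rwa [mul_one] at h4

end Span

/-! ### The algebra `U lam` -/

section U

variable {lam : ℂ} {A : Type} [Ring A] [Algebra ℂ A]

theorem sl2_eq (g : Sl2) : g = g.val 0 1 • sl2X + g.val 1 0 • sl2Y + g.val 0 0 • sl2H := by
  have h3 : Matrix.trace g.val = 0 := LinearMap.mem_ker.1 g.property
  rw [Matrix.trace_fin_two] at h3
  apply Subtype.ext
  change g.val = g.val 0 1 • sl2X.val + g.val 1 0 • sl2Y.val + g.val 0 0 • sl2H.val
  ext i j
  fin_cases i <;> fin_cases j <;> simp [sl2X, sl2Y, sl2H]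
  linear_combination h3

theorem U.hom_ext {f g : U lam →ₐ[ℂ] A} (hx : f (uX lam) = g (uX lam))
    (hy : f (uY lam) = g (uY lam)) (hh : f (uH lam) = g (uH lam)) : f = g := by
  refine RingQuot.ringQuot_ext' _ _ _ 
    (UniversalEnvelopingAlgebra.hom_ext ℂ (LieHom.ext fun a => ?_))
  change f (toU lam a) = g (toU lam a)
  have h : toU lam a = a.val 0 1 • uX lam + a.val 1 0 • uY lam + a.val 0 0 • uH lam := by
    conv_lhs => rw [sl2_eq a]
    simp only [toU, uX, uY, uH, map_add, map_smul]
  rw [h]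
  simp only [map_add, map_smul, hx, hy, hh]

/-- The universal property gives a homomorphism into the subalgebra generated by the three elements,
and its composite with the inclusion fixes the generators, so it is the identity. -/
theorem U.adjoin_eq_top (lam : ℂ) : Algebra.adjoin ℂ {uX lam, uY lam, uH lam} = ⊤ := by
  set B := Algebra.adjoin ℂ {uX lam, uY lam, uH lam} with hB
  have hx : uX lam ∈ B := Algebra.subset_adjoin (by simp)
  have hy : uY lam ∈ B := Algebra.subset_adjoin (by simp)
  have hh : uH lam ∈ B := Algebra.subset_adjoin (by simp)
  let f : U lam →ₐ[ℂ] B := U.lift lam ⟨uX lam, hx⟩ ⟨uY lam, hy⟩ ⟨uH lam, hh⟩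
    (Subtype.ext (uX_uY lam)) (Subtype.ext (uH_uX lam)) (Subtype.ext (uH_uY lam))
    (Subtype.ext (u_casimir lam))
  have hf : B.val.comp f = AlgHom.id ℂ (U lam) := by
    refine U.hom_ext ?_ ?_ ?_
    · exact congrArg Subtype.val (U.lift_uX ..)
    · exact congrArg Subtype.val (U.lift_uY ..)
    · exact congrArg Subtype.val (U.lift_uH ..)
  rw [eq_top_iff]
  intro a _
  rw [show a = (f a).val from (DFunLike.congr_fun hf a).symm]
  exact (f a).property

theorem U.isSl2Pair (lam : ℂ) : IsSl2Pair (uX lam) (uY lam) := by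
  have h : ⁅uX lam, uY lam⁆ = uH lam := by rw [Ring.lie_def, uX_uY]
  exact ⟨by rw [h, Ring.lie_def, uH_uX], by rw [h, Ring.lie_def, uH_uY]⟩

theorem lie_pow_of_lie_eq_smul {a b : A} {c : ℂ} (h : ⁅a, b⁆ = c • b) (k : ℕ) :
    ⁅a, b ^ k⁆ = (k * c) • b ^ k := by
  induction k with
  | zero => simp [Ring.lie_def]
  | succ k ih =>
    have h1 : ⁅a, b ^ (k + 1)⁆ = ⁅a, b ^ k⁆ * b + b ^ k * ⁅a, b⁆ := by
      simp only [Ring.lie_def, pow_succ]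
      noncomm_ring
    rw [h1, ih, h, smul_mul_assoc, mul_smul_comm, ← pow_succ]
    push_cast
    module

theorem IsSl2Pair.isLowest_pow {x y : A} (h : IsSl2Pair x y) (k : ℕ) :
    IsLowest x y (y ^ k) (2 * k) := by
  refine ⟨?_, ?_⟩
  · rw [Ring.lie_def, ← pow_succ, ← pow_succ', sub_self]
  · rw [lie_pow_of_lie_eq_smul (c := -2) (by rw [h.lie_y, neg_smul])]
    push_cast
    module

theorem U.span_eq_top (lam : ℂ) :
    Submodule.span ℂ (Set.range fun v : ℕ × ℕ => raise (uX lam) v.2 (uY lam ^ v.1)) = ⊤ := by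
  have h := span_derivation_pow_eq_top (δ := (LieAlgebra.ad ℂ (U lam) (uX lam) : _ →ₗ[ℂ] _))
    (x := uX lam) (y := uY lam) (h := uH lam) (ε := 1) (c := lam ^ 2 - 1) (N := ⊥)
    (fun a b => by simp only [LieAlgebra.ad_apply, Ring.lie_def]; noncomm_ring)
    (by simp)
    (by rw [LieAlgebra.ad_apply, Ring.lie_def, uX_uY])
    (by rw [LieAlgebra.ad_apply, ← lie_skew, Ring.lie_def, uH_uX])
    (by linear_combination (norm := module) -uH_uY lam)
    (by simp) (by simp) ?_ (U.adjoin_eq_top lam)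
  · rw [sup_bot_eq] at h
    exact h
  · intro a
    have h1 := congrArg (· * a) (u_casimir lam)
    have h2 := congrArg (· * a) (uX_uY lam)
    simp only [add_mul, smul_mul_assoc, pow_two, mul_assoc, sub_mul,
      Algebra.algebraMap_eq_smul_one, one_mul] at h1 h2
    rw [Submodule.mem_bot]
    linear_combination (norm := module) h1 + (2 : ℂ) • h2

theorem exists_pow_derivation_mul_eq_zero {δ : Module.End ℂ A}
    (hδ : ∀ a b, δ (a * b) = δ a * b + a * δ b) (d : ℕ) :
    ∀ m n, m + n = d → ∀ a b, (δ ^ m) a = 0 → (δ ^ n) b = 0 → (δ ^ d) (a * b) = 0 := by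
  induction d with
  | zero =>
    intro m n hd a b ha _
    obtain rfl : m = 0 := by omega
    rw [pow_zero, Module.End.one_apply] at ha
    rw [ha, zero_mul, map_zero]
  | succ d ih =>
    intro m n hd a b ha hb
    rw [pow_succ, Module.End.mul_apply, hδ, map_add]
    have h1 : (δ ^ d) (δ a * b) = 0 := by
      cases m with
      | zero =>
        rw [pow_zero, Module.End.one_apply] at ha
        rw [ha, map_zero, zero_mul, map_zero]
      | succ m =>
        rw [pow_succ, Module.End.mul_apply] at ha
        exact ih m n (by omega) _ _ ha hb
    have h2 : (δ ^ d) (a * δ b) = 0 := by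
      cases n with
      | zero =>
        rw [pow_zero, Module.End.one_apply] at hb
        rw [hb, map_zero, mul_zero, map_zero]
      | succ n =>
        rw [pow_succ, Module.End.mul_apply] at hb
        exact ih m n (by omega) _ _ ha hb
    rw [h1, h2, add_zero]

/-- Since ad x is a derivation with (ad x)³ y = 0, some power of it kills y^k. This crude bound
suffices, because y^k is a lowest weight vector of weight -2k. -/
theorem IsSl2Pair.raise_pow_eq_zero {x y : A} (h : IsSl2Pair x y) (k : ℕ) :
    raise x (2 * k + 1) (y ^ k) = 0 := by
  have hδ (a b : A) : (LieAlgebra.ad ℂ A x) (a * b) = (LieAlgebra.ad ℂ A x) a * b +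
      a * (LieAlgebra.ad ℂ A x) b := by
    simp only [LieAlgebra.ad_apply, Ring.lie_def]; noncomm_ring
  have h1 : ∃ n, (LieAlgebra.ad ℂ A x ^ n) (y ^ k) = 0 := by
    induction k with
    | zero => exact ⟨1, by simp [Ring.lie_def]⟩
    | succ k ih =>
      obtain ⟨n, hn⟩ := ih
      refine ⟨n + 3, ?_⟩
      rw [pow_succ y]
      refine exists_pow_derivation_mul_eq_zero hδ _ n 3 rfl _ _ hn ?_
      rw [ad_pow_succ_apply, ad_pow_succ_apply, ad_pow_succ_apply, pow_zero,
        Module.End.one_apply, ← lie_skew x ⁅x, y⁆, h.lie_x, lie_neg, lie_smul, lie_self,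
        smul_zero, neg_zero]
  obtain ⟨n, hn⟩ := h1
  exact (h.isLowest_pow k).pow_eq_zero h hn

/-- A homomorphism from `U lam` is injective if it does not annihilate any power of `X⁻`. -/
theorem U.injective_of_pow_ne_zero (f : U lam →ₐ[ℂ] A) (hf : ∀ k, f (uY lam) ^ k ≠ 0) :
    Function.Injective f := by
  have hp : IsSl2Pair (f (uX lam)) (f (uY lam)) := by
    have h := U.isSl2Pair lam
    have e (a b : U lam) : ⁅f a, f b⁆ = f ⁅a, b⁆ := (f.toLieHom.map_lie a b).symm
    exact ⟨by rw [e, e, h.lie_x, map_smul], by rw [e, e, h.lie_y, map_neg, map_smul]⟩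
  have hi := linearIndependent_ad_pow hp (fun k => f (uY lam) ^ k) (fun k => 2 * k)
    (fun k => hp.isLowest_pow k)
    (linearIndependent_of_isLowest (fun k l h => Nat.eq_of_mul_eq_mul_left two_pos h)
      (fun k => hp.isLowest_pow k) hf)
  rw [injective_iff_map_eq_zero]
  intro a ha
  -- The elements (ad x)^i y^k with i ≤ 2k span U_λ, and by `hi` their images are independent; so a
  -- has only zero coefficients.
  have h1 : a ∈ Submodule.span ℂ (Set.range fun p : {p : ℕ × ℕ // p.2 ≤ 2 * p.1} =>
      raise (uX lam) p.1.2 (uY lam ^ p.1.1)) := by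
    have h2 : Submodule.span ℂ (Set.range fun v : ℕ × ℕ => raise (uX lam) v.2 (uY lam ^ v.1)) ≤
        Submodule.span ℂ (Set.range fun p : {p : ℕ × ℕ // p.2 ≤ 2 * p.1} =>
          raise (uX lam) p.1.2 (uY lam ^ p.1.1)) := by
      refine Submodule.span_le.2 ?_
      rintro _ ⟨v, rfl⟩
      by_cases hv : v.2 ≤ 2 * v.1
      · exact Submodule.subset_span ⟨⟨v, hv⟩, rfl⟩
      · obtain ⟨j, hj⟩ := Nat.exists_eq_add_of_lt (not_le.1 hv)
        simp only
        rw [hj, show 2 * v.1 + j + 1 = j + (2 * v.1 + 1) by omega, raise_add,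
          (U.isSl2Pair lam).raise_pow_eq_zero, raise_apply_zero]
        exact Submodule.zero_mem _
    exact h2 (U.span_eq_top lam ▸ trivial)
  obtain ⟨c, rfl⟩ := Finsupp.mem_span_range_iff_exists_finsupp.1 h1
  have h3 : c = 0 := by
    refine linearIndependent_iff.1 hi c ?_
    rw [← ha, Finsupp.linearCombination_apply, map_finsuppSum]
    refine Finsupp.sum_congr fun p _ => ?_
    have h4 := map_ad_pow f.toLieHom (uX lam) (uY lam ^ p.1.1) p.1.2
    change f (raise _ _ _) = (LieAlgebra.ad ℂ A (f (uX lam)) ^ p.1.2) (f (uY lam ^ p.1.1)) at h4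
    rw [map_smul, h4, map_pow f]
  rw [h3, Finsupp.sum_zero_index]

/-- The operator (d/du)^k is not zero, as it takes u^k to k!. -/
theorem realization_injective (lam : ℂ) : Function.Injective (realization lam) := by
  refine U.injective_of_pow_ne_zero _ fun k h => ?_
  have h1 := LinearMap.congr_fun h (X ^ k)
  rw [realization_uY, ← neg_one_smul ℂ opD, _root_.smul_pow] at h1
  have h2 : (opD ^ k) (X ^ k) = C (k.factorial : ℂ) := by
    rw [opD, Module.End.pow_apply, Polynomial.iterate_derivative_X_pow_eq_C_mul]
    simp [Nat.descFactorial_self]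
  rw [LinearMap.smul_apply, h2] at h1
  simp [Nat.factorial_ne_zero] at h1

end U


/-! ### The realization of `U lam` by difference operators -/

section Shift

/-- The operator `f ↦ P(η) f(η + 2 n)` on functions of `η`. -/
def shiftOp (P : ℂ → ℂ) (n : ℤ) : Module.End ℂ (ℂ → ℂ) where
  toFun f η := P η * f (η + 2 * n)
  map_add' _ _ := funext fun _ => mul_add _ _ _
  map_smul' _ _ := funext fun _ => mul_left_comm _ _ _

theorem shiftOp_apply (P : ℂ → ℂ) (n : ℤ) (f : ℂ → ℂ) (η : ℂ) :
    shiftOp P n f η = P η * f (η + 2 * n) := rfl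

theorem shiftOp_mul (P Q : ℂ → ℂ) (n m : ℤ) :
    shiftOp P n * shiftOp Q m = shiftOp (fun η => P η * Q (η + 2 * n)) (n + m) := by
  refine LinearMap.ext fun f => funext fun η => ?_
  rw [Module.End.mul_apply, shiftOp_apply, shiftOp_apply, shiftOp_apply, mul_assoc]
  push_cast
  rw [mul_add, add_assoc]

theorem shiftOp_add (P Q : ℂ → ℂ) (n : ℤ) :
    shiftOp P n + shiftOp Q n = shiftOp (fun η => P η + Q η) n :=
  LinearMap.ext fun _ => funext fun _ => (add_mul _ _ _).symm

theorem shiftOp_sub (P Q : ℂ → ℂ) (n : ℤ) :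
    shiftOp P n - shiftOp Q n = shiftOp (fun η => P η - Q η) n :=
  LinearMap.ext fun _ => funext fun _ => (sub_mul _ _ _).symm

theorem shiftOp_smul (c : ℂ) (P : ℂ → ℂ) (n : ℤ) :
    c • shiftOp P n = shiftOp (fun η => c * P η) n :=
  LinearMap.ext fun _ => funext fun _ => (mul_assoc _ _ _).symm

theorem shiftOp_neg (P : ℂ → ℂ) (n : ℤ) : -shiftOp P n = shiftOp (fun η => -P η) n :=
  LinearMap.ext fun _ => funext fun _ => (neg_mul _ _).symm

theorem shiftOp_zero (n : ℤ) : shiftOp (fun _ => 0) n = 0 :=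
  LinearMap.ext fun _ => funext fun _ => zero_mul _

theorem shiftOp_lie (P Q : ℂ → ℂ) (n m : ℤ) :
    ⁅shiftOp P n, shiftOp Q m⁆ =
      shiftOp (fun η => P η * Q (η + 2 * n) - Q η * P (η + 2 * m)) (n + m) := by
  rw [Ring.lie_def, shiftOp_mul, shiftOp_mul, add_comm m n, shiftOp_sub]

theorem algebraMap_eq_shiftOp (c : ℂ) :
    algebraMap ℂ (Module.End ℂ (ℂ → ℂ)) c = shiftOp (fun _ => c) 0 := by
  refine LinearMap.ext fun f => funext fun η => ?_
  simp [shiftOp_apply, Algebra.algebraMap_eq_smul_one]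

/-- The image of `X⁺`. -/
noncomputable def shiftX (lam : ℂ) : Module.End ℂ (ℂ → ℂ) :=
  -- The coefficient is forced by the Casimir relation, which reads 4 X⁺ X⁻ = λ² - (H - 1)², with H
  -- acting as η.
  shiftOp (fun η => (lam ^ 2 - (η - 1) ^ 2) / 4) (-1)

/-- The image of `X⁻`. -/
def shiftY : Module.End ℂ (ℂ → ℂ) := shiftOp (fun _ => 1) 1

/-- The realization of `U lam` by difference operators, where `H` acts as the multiplication by the
variable. -/
noncomputable def shiftRep (lam : ℂ) : U lam →ₐ[ℂ] Module.End ℂ (ℂ → ℂ) :=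
  U.lift lam (shiftX lam) shiftY (shiftOp (fun η => η) 0)
    (by
      simp only [shiftX, shiftY, shiftOp_mul, Int.reduceAdd, Int.reduceNeg, shiftOp_sub]
      refine congrArg (shiftOp · _) (funext fun η => ?_)
      push_cast
      ring)
    (by
      simp only [shiftX, shiftOp_mul, Int.reduceAdd, Int.reduceNeg, shiftOp_sub, shiftOp_smul]
      refine congrArg (shiftOp · _) (funext fun η => ?_)
      push_cast
      ring)
    (by
      simp only [shiftY, shiftOp_mul, Int.reduceAdd, shiftOp_sub, shiftOp_smul, shiftOp_neg]
      refine congrArg (shiftOp · _) (funext fun η => ?_)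
      push_cast
      ring)
    (by
      simp only [shiftX, shiftY, shiftOp_mul, Int.reduceAdd, Int.reduceNeg, shiftOp_add,
        shiftOp_smul, algebraMap_eq_shiftOp, pow_two (shiftOp _ _)]
      refine congrArg (shiftOp · _) (funext fun η => ?_)
      push_cast
      ring)

theorem shiftRep_uX (lam : ℂ) : shiftRep lam (uX lam) = shiftX lam := U.lift_uX ..

theorem shiftRep_uY (lam : ℂ) : shiftRep lam (uY lam) = shiftY := U.lift_uY ..

theorem shiftY_pow (k : ℕ) : shiftY ^ k = shiftOp (fun _ => 1) k := by
  induction k with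
  | zero => rw [pow_zero, Nat.cast_zero, ← algebraMap_eq_shiftOp, map_one]
  | succ k ih => rw [pow_succ, ih, shiftY, shiftOp_mul, mul_one, Nat.cast_succ]

theorem shiftY_pow_ne_zero (k : ℕ) : shiftY ^ k ≠ 0 := by
  intro h
  have h1 := congrFun (LinearMap.congr_fun h fun _ => 1) 0
  rw [shiftY_pow, shiftOp_apply] at h1
  simp at h1

theorem shiftRep_injective (lam : ℂ) : Function.Injective (shiftRep lam) :=
  U.injective_of_pow_ne_zero _ fun k => by rw [shiftRep_uY]; exact shiftY_pow_ne_zero k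

theorem uY_pow_ne_zero (lam : ℂ) (k : ℕ) : uY lam ^ k ≠ 0 := by
  intro h
  have h1 := congrArg (shiftRep lam) h
  rw [map_pow, shiftRep_uY, map_zero] at h1
  exact shiftY_pow_ne_zero k h1

theorem lie_shiftX {lam : ℂ} {P Q : ℂ → ℂ} {n m : ℤ} (hm : -1 + n = m)
    (h : ∀ η, (lam ^ 2 - (η - 1) ^ 2) / 4 * P (η - 2) -
      P η * ((lam ^ 2 - (η + 2 * n - 1) ^ 2) / 4) = Q η) :
    ⁅shiftX lam, shiftOp P n⁆ = shiftOp Q m := by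
  rw [shiftX, shiftOp_lie, hm]
  refine congrArg (shiftOp · _) (funext fun η => ?_)
  rw [← h η]
  push_cast
  rw [mul_neg_one, ← sub_eq_add_neg]

theorem shift_isSl2Pair (lam : ℂ) : IsSl2Pair (shiftX lam) shiftY := by
  constructor <;>
  · simp only [shiftX, shiftY, shiftOp_lie, Int.reduceAdd, Int.reduceNeg, shiftOp_smul, shiftOp_neg]
    refine congrArg (shiftOp · _) (funext fun η => ?_)
    push_cast
    ring

/-- Every z_i is a shift with an explicit polynomial coefficient, so each relation is a polynomial
identity in η, λ and t. -/
theorem shift_isSlTriple (lam t : ℂ) :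
    IsSlTriple (t ^ 2 * lam ^ 2) (t ^ 2) (shiftX lam) shiftY (t • shiftY ^ 2) := by
  have e0 : t • shiftY ^ 2 = shiftOp (fun _ => t) 2 := by
    rw [shiftY_pow, shiftOp_smul]
    exact congrArg (shiftOp · _) (funext fun η => mul_one t)
  rw [e0]
  have e1 : raise (shiftX lam) 1 (shiftOp (fun _ => t) 2) = shiftOp (fun η => t * (2 * η + 2)) 1
    := by
    rw [raise_succ, raise_zero]
    exact lie_shiftX rfl fun η => by push_cast; ring
  have e2 : raise (shiftX lam) 2 (shiftOp (fun _ => t) 2) =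
      shiftOp (fun η => t * (3 * η ^ 2 - lam ^ 2 + 1)) 0 := by
    rw [raise_succ, e1]
    exact lie_shiftX rfl fun η => by push_cast; ring
  have e3 : raise (shiftX lam) 3 (shiftOp (fun _ => t) 2) =
      shiftOp (fun η => t * (3 * (η - 1) * ((η - 1) ^ 2 - lam ^ 2))) (-1) := by
    rw [raise_succ, e2]
    exact lie_shiftX rfl fun η => by push_cast; ring
  have e4 : raise (shiftX lam) 4 (shiftOp (fun _ => t) 2) =
      shiftOp (fun η => t * (3 / 2 * ((η - 1) ^ 2 - lam ^ 2) * ((η - 3) ^ 2 - lam ^ 2))) (-2) := by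
    rw [raise_succ, e3]
    exact lie_shiftX rfl fun η => by push_cast; ring
  have hlow : IsLowest (shiftX lam) shiftY (shiftOp (fun _ => t) 2) 4 := by
    constructor
    · rw [shiftY, shiftOp_lie, ← shiftOp_zero 3]
      exact congrArg (shiftOp · _) (funext fun η => by ring)
    · simp only [shiftX, shiftY, shiftOp_lie, Int.reduceAdd, Int.reduceNeg, shiftOp_smul,
        shiftOp_neg]
      refine congrArg (shiftOp · _) (funext fun η => ?_)
      push_cast
      ring
  refine ⟨⟨shift_isSl2Pair lam, hlow, ?_⟩, ?_, ?_, ?_⟩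
  · rw [raise_succ, e4, ← shiftOp_zero (-3)]
    exact lie_shiftX rfl fun η => by push_cast; ring
  · rw [e1, e2, e3, shiftY]
    simp only [shiftOp_lie, Int.reduceAdd, Int.reduceNeg, shiftOp_smul, shiftOp_sub]
    refine congrArg (shiftOp · _) (funext fun η => ?_)
    push_cast
    ring
  · rw [e1]
    simp only [shiftOp_lie, Int.reduceAdd]
    rw [← shiftOp_zero 5]
    refine congrArg (shiftOp · _) (funext fun η => ?_)
    push_cast
    ring
  · rw [e1, e2, e3]
    simp only [shiftOp_lie, Int.reduceAdd, Int.reduceNeg, shiftOp_smul, shiftOp_sub]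
    refine congrArg (shiftOp · _) (funext fun η => ?_)
    push_cast
    ring

theorem shift_isOspTriple (lam t : ℂ) :
    IsOspTriple (t * lam ^ 2) t (shiftX lam) shiftY (t • shiftY ^ 3) := by
  have e0 : t • shiftY ^ 3 = shiftOp (fun _ => t) 3 := by
    rw [shiftY_pow, shiftOp_smul]
    exact congrArg (shiftOp · _) (funext fun η => mul_one t)
  rw [e0]
  have e1 : raise (shiftX lam) 1 (shiftOp (fun _ => t) 3) = shiftOp (fun η => t * (3 * η + 6)) 2
    := by
    rw [raise_succ, raise_zero]
    exact lie_shiftX rfl fun η => by push_cast; ring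
  have e2 : raise (shiftX lam) 2 (shiftOp (fun _ => t) 3) =
      shiftOp (fun η => t * (3 / 2 * (5 * η ^ 2 + 10 * η - lam ^ 2 + 9))) 1 := by
    rw [raise_succ, e1]
    exact lie_shiftX rfl fun η => by push_cast; ring
  have e3 : raise (shiftX lam) 3 (shiftOp (fun _ => t) 3) =
      shiftOp (fun η => t * (3 * η * (5 * η ^ 2 - 3 * lam ^ 2 + 7))) 0 := by
    rw [raise_succ, e2]
    exact lie_shiftX rfl fun η => by push_cast; ring
  have e4 : raise (shiftX lam) 4 (shiftOp (fun _ => t) 3) =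
      shiftOp (fun η => t * (9 / 2 * ((η - 1) ^ 2 - lam ^ 2) *
        (5 * η ^ 2 - 10 * η - lam ^ 2 + 9))) (-1) := by
    rw [raise_succ, e3]
    exact lie_shiftX rfl fun η => by push_cast; ring
  have e5 : raise (shiftX lam) 5 (shiftOp (fun _ => t) 3) =
      shiftOp (fun η => t * (45 / 2 * (η - 2) * ((η - 1) ^ 2 - lam ^ 2) *
        ((η - 3) ^ 2 - lam ^ 2))) (-2) := by
    rw [raise_succ, e4]
    exact lie_shiftX rfl fun η => by push_cast; ring
  have e6 : raise (shiftX lam) 6 (shiftOp (fun _ => t) 3) =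
      shiftOp (fun η => t * (45 / 4 * ((η - 1) ^ 2 - lam ^ 2) *
        ((η - 3) ^ 2 - lam ^ 2) * ((η - 5) ^ 2 - lam ^ 2))) (-3) := by
    rw [raise_succ, e5]
    exact lie_shiftX rfl fun η => by push_cast; ring
  have hlow : IsLowest (shiftX lam) shiftY (shiftOp (fun _ => t) 3) 6 := by
    constructor
    · rw [shiftY, shiftOp_lie, ← shiftOp_zero 4]
      exact congrArg (shiftOp · _) (funext fun η => by ring)
    · simp only [shiftX, shiftY, shiftOp_lie, Int.reduceAdd, Int.reduceNeg, shiftOp_smul,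
        shiftOp_neg]
      refine congrArg (shiftOp · _) (funext fun η => ?_)
      push_cast
      ring
  refine ⟨⟨shift_isSl2Pair lam, hlow, ?_⟩, ?_, ?_, ?_, ?_⟩
  · rw [raise_succ, e6, ← shiftOp_zero (-4)]
    exact lie_shiftX rfl fun η => by push_cast; ring
  · rw [e1, e2, e3]
    simp only [shiftOp_lie, Int.reduceAdd, shiftOp_smul, shiftOp_sub]
    refine congrArg (shiftOp · _) (funext fun η => ?_)
    push_cast
    ring
  · rw [e1, e2, e3, e4, shiftY]
    simp only [shiftOp_lie, Int.reduceAdd, Int.reduceNeg, shiftOp_smul, shiftOp_sub, shiftOp_add]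
    refine congrArg (shiftOp · _) (funext fun η => ?_)
    push_cast
    ring
  · rw [e1]
    simp only [shiftOp_lie, Int.reduceAdd]
    rw [← shiftOp_zero 8]
    refine congrArg (shiftOp · _) (funext fun η => ?_)
    push_cast
    ring
  · rw [e1, e2, e3]
    simp only [shiftOp_lie, Int.reduceAdd, shiftOp_smul, shiftOp_sub]
    refine congrArg (shiftOp · _) (funext fun η => ?_)
    push_cast
    ring

end Shift

/-! ### Relations and lowest weight vectors in `U lam` -/

section

/-- The relations are inherited from the difference operators because `shiftRep` is faithful. -/
theorem U.isSlTriple (lam t : ℂ) :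
    IsSlTriple (t ^ 2 * lam ^ 2) (t ^ 2) (uX lam) (uY lam) (t • uY lam ^ 2) := by
  refine IsSlTriple.of_injective (shiftRep lam).toLieHom (shiftRep_injective lam) ?_
  change IsSlTriple _ _ (shiftRep lam (uX lam)) (shiftRep lam (uY lam))
    (shiftRep lam (t • uY lam ^ 2))
  rw [map_smul, map_pow, shiftRep_uX, shiftRep_uY]
  exact shift_isSlTriple lam t

theorem U.isOspTriple (lam t : ℂ) :
    IsOspTriple (t * lam ^ 2) t (uX lam) (uY lam) (t • uY lam ^ 3) := by
  refine IsOspTriple.of_injective (shiftRep lam).toLieHom (shiftRep_injective lam) ?_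
  change IsOspTriple _ _ (shiftRep lam (uX lam)) (shiftRep lam (uY lam))
    (shiftRep lam (t • uY lam ^ 3))
  rw [map_smul, map_pow, shiftRep_uX, shiftRep_uY]
  exact shift_isOspTriple lam t

/-- A criterion for the vectors `Y_m` to be nonzero multiples of given vectors. -/
theorem exists_lowVec_eq_smul {L : Type} [LieRing L] [LieAlgebra ℂ L] {N : ℕ} (hN : N ≠ 0)
    {x y z : L} (v : ℕ → L) (c : ℕ → ℂ) (hc : ∀ m, c m ≠ 0) (h0 : v 0 = y)
    (h : ∀ m, ⁅raise x 1 z, v m⁆ = c m • v (m + 1)) (m : ℕ) :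
    ∃ a : ℂ, a ≠ 0 ∧ lowVec N x y z m = a • v m := by
  induction m with
  | zero => exact ⟨-(N : ℂ)⁻¹, by simpa using hN, by rw [h0]; rfl⟩
  | succ m ih =>
    obtain ⟨a, ha, hm⟩ := ih
    exact ⟨a * c m, mul_ne_zero ha (hc m), by rw [← lie_lowVec, hm, lie_smul, h, smul_smul]⟩

variable {A : Type} [Ring A] [Algebra ℂ A] {x y : A}

theorem IsSl2Pair.commute_lie (hp : IsSl2Pair x y) (k : ℕ) :
    ⁅⁅x, y⁆, y ^ k⁆ = -((2 * k : ℂ) • y ^ k) := by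
  have h := (hp.isLowest_pow k).lie_h
  push_cast at h
  exact h

/-- Write h = [x, y]. Then z₁ = t(hy + yh) and [h, y^k] = -2k y^k, so ad z₁ sends y^k to -4kt
y^{k+1}; here k = m + 1. -/
theorem IsSl2Pair.exists_lowVec_sl (hp : IsSl2Pair x y) {t : ℂ} (ht : t ≠ 0) (m : ℕ) :
    ∃ a : ℂ, a ≠ 0 ∧ lowVec 4 x y (t • y ^ 2) m = a • y ^ (m + 1) := by
  refine exists_lowVec_eq_smul (by decide) (fun m => y ^ (m + 1)) (fun m => -(4 * t * (m + 1)))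
    (fun m => ?_) (pow_one y) (fun m => ?_) m
  · rw [neg_ne_zero]
    exact mul_ne_zero (mul_ne_zero (by norm_num) ht) (by exact_mod_cast Nat.succ_ne_zero m)
  · have h1 : raise x 1 (t • y ^ 2) = t • (⁅x, y⁆ * y + y * ⁅x, y⁆) := by
      rw [raise_succ, raise_zero, lie_smul, Ring.lie_def, Ring.lie_def]
      noncomm_ring
    have h2 (k : ℕ) : ⁅⁅x, y⁆ * y + y * ⁅x, y⁆, y ^ k⁆ = ⁅⁅x, y⁆, y ^ k⁆ * y + y * ⁅⁅x, y⁆,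
      y ^ k⁆ := by
      have h3 : y ^ k * y = y * y ^ k := by rw [← pow_succ, ← pow_succ']
      have h4 (a : A) : y ^ k * (y * a) = y * (y ^ k * a) := by rw [← mul_assoc, h3, mul_assoc]
      simp only [Ring.lie_def _ (y ^ k), sub_mul, mul_sub, add_mul, mul_add, mul_assoc, h3, h4]
      abel
    rw [h1, smul_lie, h2, hp.commute_lie, neg_mul, smul_mul_assoc, ← pow_succ, mul_neg,
      mul_smul_comm, ← pow_succ']
    push_cast
    module

/-- Now z₁ = t(hyy + yhy + yyh) with h = [x, y], so ad z₁ sends y^k to -6kt y^{k+2}; only the odd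
powers k = 2m + 1 are reached from y. -/
theorem IsSl2Pair.exists_lowVec_osp (hp : IsSl2Pair x y) {t : ℂ} (ht : t ≠ 0) (m : ℕ) :
    ∃ a : ℂ, a ≠ 0 ∧ lowVec 6 x y (t • y ^ 3) m = a • y ^ (2 * m + 1) := by
  refine exists_lowVec_eq_smul (by decide) (fun m => y ^ (2 * m + 1))
    (fun m => -(6 * t * (2 * m + 1))) (fun m => ?_) (pow_one y) (fun m => ?_) m
  · rw [neg_ne_zero]
    exact mul_ne_zero (mul_ne_zero (by norm_num) ht) (by exact_mod_cast Nat.succ_ne_zero (2 * m))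
  · have h1 : raise x 1 (t • y ^ 3) = t • (⁅x, y⁆ * y * y + y * ⁅x, y⁆ * y + y * y * ⁅x, y⁆) := by
      rw [raise_succ, raise_zero, lie_smul, Ring.lie_def, Ring.lie_def]
      noncomm_ring
    have h2 (k : ℕ) : ⁅⁅x, y⁆ * y * y + y * ⁅x, y⁆ * y + y * y * ⁅x, y⁆, y ^ k⁆ =
        ⁅⁅x, y⁆, y ^ k⁆ * y * y + y * ⁅⁅x, y⁆, y ^ k⁆ * y + y * y * ⁅⁅x, y⁆, y ^ k⁆ := by
      have h3 : y ^ k * y = y * y ^ k := by rw [← pow_succ, ← pow_succ']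
      have h4 (a : A) : y ^ k * (y * a) = y * (y ^ k * a) := by rw [← mul_assoc, h3, mul_assoc]
      simp only [Ring.lie_def _ (y ^ k), sub_mul, mul_sub, add_mul, mul_add, mul_assoc, h3, h4]
      abel
    rw [h1, smul_lie, h2, hp.commute_lie]
    simp only [neg_mul, mul_neg, smul_mul_assoc, mul_smul_comm, ← pow_succ, ← pow_succ',
      mul_assoc]
    simp only [mul_add_one]
    push_cast
    module

end


/-! ### The presentations of `sl(lam)` and `o/sp(lam)` -/

section

variable {L : Type} [LieRing L] [LieAlgebra ℂ L]

theorem lowVec_mem_range (N : ℕ) (a b c : L) (m : ℕ) : lowVec N a b c m ∈ (evalHom a b c).range :=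
  ⟨lowVec N fX fY genZ m, by
    change evalHom a b c _ = _
    rw [map_lowVec, evalHom_fX, evalHom_fY, evalHom_genZ]⟩

theorem raise_mem_range {a b c v : L} (hv : v ∈ (evalHom a b c).range) (i : ℕ) :
    raise a i v ∈ (evalHom a b c).range := by
  obtain ⟨r, rfl⟩ := hv
  refine ⟨raise fX i r, ?_⟩
  change evalHom a b c _ = raise a i (evalHom a b c r)
  rw [map_raise, evalHom_fX]

theorem evalHom_surjective_of_surjective {L' : Type} [LieRing L'] [LieAlgebra ℂ L'] {a b c : L}
    (h : Function.Surjective (evalHom a b c)) {f : L →ₗ⁅ℂ⁆ L'} (hf : Function.Surjective f) :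
    Function.Surjective (evalHom (f a) (f b) (f c)) := by
  intro u
  obtain ⟨v, rfl⟩ := hf u
  obtain ⟨r, rfl⟩ := h v
  exact ⟨r, (map_evalHom f a b c r).symm⟩

theorem mem_of_smul_mem {S : LieSubalgebra ℂ L} {c : ℂ} (hc : c ≠ 0) {v : L} (h : c • v ∈ S) :
    v ∈ S := by
  have h1 := S.smul_mem c⁻¹ h
  rwa [inv_smul_smul₀ hc] at h1

theorem U.induction {lam : ℂ} {p : U lam → Prop} (h0 : p 0)
    (hadd : ∀ a b, p a → p b → p (a + b)) (hsmul : ∀ (c : ℂ) a, p a → p (c • a))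
    (h : ∀ k i, p (raise (uX lam) i (uY lam ^ k))) (a : U lam) : p a := by
  have ha : a ∈ Submodule.span ℂ
      (Set.range fun v : ℕ × ℕ => raise (uX lam) v.2 (uY lam ^ v.1)) :=
    U.span_eq_top lam ▸ trivial
  induction ha using Submodule.span_induction with
  | mem a ha =>
    obtain ⟨v, rfl⟩ := ha
    exact h v.1 v.2
  | zero => exact h0
  | add a b _ _ ha hb => exact hadd a b ha hb
  | smul c a _ ha => exact hsmul c a ha

/-- The elements (ad x)^i y^k span U_λ. For k = 0 they go to zero or to multiples of f 1 = 0, and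
for k ≥ 1 they are multiples of (ad x)^i Y_{k-1}. -/
theorem U.evalHom_surjective {lam t : ℂ} (ht : t ≠ 0) {f : U lam →ₗ⁅ℂ⁆ L}
    (hf : Function.Surjective f) (h1 : f 1 = 0) :
    Function.Surjective (evalHom (f (uX lam)) (f (uY lam)) (f (t • uY lam ^ 2))) := by
  obtain ⟨z, hz⟩ : ∃ z, z = f (t • uY lam ^ 2) := ⟨_, rfl⟩
  rw [← hz, ← LieHom.range_eq_top, eq_top_iff]
  intro b _
  obtain ⟨b, rfl⟩ := hf b
  induction b using U.induction with
  | h0 => rw [map_zero]; exact zero_mem _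
  | hadd a b ha hb => rw [map_add]; exact add_mem (ha trivial) (hb trivial)
  | hsmul c a ha => rw [map_smul]; exact LieSubalgebra.smul_mem _ _ (ha trivial)
  | h k i =>
    rw [map_raise]
    refine raise_mem_range ?_ i
    cases k with
    | zero => rw [pow_zero, h1]; exact zero_mem _
    | succ k =>
      obtain ⟨a, ha, hk⟩ := (U.isSl2Pair lam).exists_lowVec_sl ht k
      have h2 := lowVec_mem_range 4 (f (uX lam)) (f (uY lam)) z k
      rw [hz, ← map_lowVec, ← hz, hk, map_smul] at h2
      exact mem_of_smul_mem ha h2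

variable {A : Type} [Ring A] [Algebra ℂ A]

theorem IsSl2Pair.map {B : Type} [Ring B] [Algebra ℂ B] {x y : A} (h : IsSl2Pair x y)
    (f : A →ₐ[ℂ] B) : IsSl2Pair (f x) (f y) := by
  have e (a b : A) : ⁅f a, f b⁆ = f ⁅a, b⁆ := (f.toLieHom.map_lie a b).symm
  exact ⟨by rw [e, e, h.lie_x, map_smul], by rw [e, e, h.lie_y, map_neg, map_smul]⟩

/-- Constants have weight 0, whereas y^{k+1} has weight -2(k + 1). This is what keeps the Y_m
nonzero modulo constants. -/
theorem IsSl2Pair.pow_eq_zero_of_eq_smul {x y : A} (h : IsSl2Pair x y) {k : ℕ} {c : ℂ}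
    (hc : y ^ (k + 1) = c • 1) : y ^ (k + 1) = 0 := by
  have h1 := h.commute_lie (k + 1)
  rw [hc, lie_smul, show ⁅⁅x, y⁆, (1 : A)⁆ = 0 by simp [Ring.lie_def ⁅x, y⁆], smul_zero, eq_comm,
    neg_eq_zero, smul_eq_zero] at h1
  rw [hc]
  refine h1.resolve_left (mul_ne_zero two_ne_zero ?_)
  exact Nat.cast_ne_zero.2 (Nat.succ_ne_zero k)

theorem sl_isSlTriple (lam t : ℂ) : IsSlTriple (t ^ 2 * lam ^ 2) (t ^ 2) (toSl lam (uX lam))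
    (toSl lam (uY lam)) (toSl lam (t • uY lam ^ 2)) :=
  (U.isSlTriple lam t).map (quotHom (constants (U lam)))

theorem sl_lowVec_ne_zero {t : ℂ} (ht : t ≠ 0) (lam : ℂ) (m : ℕ) :
    lowVec 4 (toSl lam (uX lam)) (toSl lam (uY lam)) (toSl lam (t • uY lam ^ 2)) m ≠ 0 := by
  intro h
  obtain ⟨a, ha, hm⟩ := (U.isSl2Pair lam).exists_lowVec_sl ht m
  change lowVec 4 (quotHom (constants (U lam)) (uX lam)) (quotHom (constants (U lam)) (uY lam))
    (quotHom (constants (U lam)) (t • uY lam ^ 2)) m = 0 at h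
  rw [← map_lowVec, hm, map_smul, smul_eq_zero_iff_right ha, quotHom_eq_zero] at h
  obtain ⟨c, hc⟩ := Submodule.mem_span_singleton.1 h
  exact uY_pow_ne_zero lam _ ((U.isSl2Pair lam).pow_eq_zero_of_eq_smul hc.symm)

theorem isPresentedBy_sl {t : ℂ} (ht : t ≠ 0) (lam : ℂ) :
    IsPresentedBy (toSl lam (uX lam)) (toSl lam (uY lam)) (toSl lam (t • uY lam ^ 2))
      (relSl lam t) := by
  rw [relSl_eq]
  refine isPresentedBy_slRel_univ (sl_isSlTriple lam t) (sl_lowVec_ne_zero ht lam) ?_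
  change Function.Surjective (evalHom (quotHom (constants (U lam)) (uX lam))
    (quotHom (constants (U lam)) (uY lam)) (quotHom (constants (U lam)) (t • uY lam ^ 2)))
  exact (U.evalHom_surjective ht (quotHom_surjective (constants (U lam)))
      (quotHom_eq_zero.2 (Submodule.mem_span_singleton_self _)))

theorem matY_pow (n k : ℕ) (i j : Fin n) :
    (matY n ^ k) i j = if (i : ℕ) = j + k then 1 else 0 := by
  induction k generalizing i with
  | zero => simp [Matrix.one_apply, Fin.ext_iff]
  | succ k ih =>
    rw [pow_succ', Matrix.mul_apply]
    simp only [ih]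
    rcases Nat.eq_zero_or_pos (i : ℕ) with hi | hi
    · rw [Finset.sum_eq_zero fun l _ => by simp [matY, hi], if_neg (by omega)]
    · have h1 : (i : ℕ) - 1 < n := by omega
      rw [Finset.sum_eq_single (⟨i - 1, h1⟩ : Fin n)]
      · have h2 : (i : ℕ) = i - 1 + 1 := by omega
        rw [matY, Matrix.of_apply, if_pos h2, one_mul]
        exact if_congr (by simp only; omega) rfl rfl
      · intro l _ hl
        have : (i : ℕ) ≠ l + 1 := fun h => hl (Fin.ext (by simp [h]))
        simp [matY, this]
      · simp

theorem matY_pow_eq_zero {n k : ℕ} (h : n ≤ k) : matY n ^ k = 0 := by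
  ext i j
  rw [matY_pow, if_neg (by omega), Matrix.zero_apply]

theorem matY_pow_ne_zero {n k : ℕ} (h : k < n) : matY n ^ k ≠ 0 := by
  intro h1
  have h2 := congrFun (congrFun h1 ⟨k, h⟩) ⟨0, by omega⟩
  rw [matY_pow, if_pos (by simp)] at h2
  exact one_ne_zero h2

/-- Y_m is a multiple of y^{m+1}, and the k-th power of a Jordan block of size n vanishes exactly
when k ≥ n. Thus Y_{n-1} is the first to vanish, which is shearing with exponent n - 2. -/
theorem isPresentedBy_slInt {t : ℂ} (ht : t ≠ 0) (lam : ℂ) (n : ℕ) (hn : lam ^ 2 = (n : ℂ) ^ 2)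
    (h2 : 2 ≤ n) :
    IsPresentedBy (toSlInt lam n hn (uX lam)) (toSlInt lam n hn (uY lam))
      (toSlInt lam n hn (t • uY lam ^ 2)) (relSl lam t ∪ {shear (n - 2)}) := by
  obtain ⟨n, rfl⟩ := Nat.exists_eq_add_of_le' h2
  rw [relSl_eq, Nat.add_sub_cancel]
  set I := idealJ lam (n + 2) hn ⊔ constants (U lam) with hI
  change IsPresentedBy (quotHom I (uX lam)) (quotHom I (uY lam)) (quotHom I (t • uY lam ^ 2)) _
  have hJ : idealJ lam (n + 2) hn ≤ I := le_sup_left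
  have hC : constants (U lam) ≤ I := le_sup_right
  refine isPresentedBy_slRel_shear ((U.isSlTriple lam t).map _) n ?_ (fun m hmn h => ?_)
    (U.evalHom_surjective ht (quotHom_surjective _)
      (quotHom_eq_zero.2 (hC (Submodule.mem_span_singleton_self _))))
  · obtain ⟨a, -, hm⟩ := (U.isSl2Pair lam).exists_lowVec_sl ht (n + 1)
    rw [← map_lowVec, hm, quotHom_eq_zero]
    refine hJ (LieHom.mem_ker.2 ?_)
    change matRep lam (n + 2) hn (a • uY lam ^ (n + 1 + 1)) = 0
    rw [map_smul, map_pow, matRep_uY, matY_pow_eq_zero le_rfl, smul_zero]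
  · obtain ⟨a, ha, hm⟩ := (U.isSl2Pair lam).exists_lowVec_sl ht m
    rw [← map_lowVec, hm, map_smul, smul_eq_zero_iff_right ha, quotHom_eq_zero, hI,
      LieSubmodule.mem_sup] at h
    -- If the power of y is in J plus constants, its matrix is scalar, hence zero by weights,
    -- although the exponent is below the size.
    obtain ⟨j, hj, u, hu, hju⟩ := h
    obtain ⟨c, rfl⟩ := Submodule.mem_span_singleton.1 hu
    have hj' : matRep lam (n + 2) hn j = 0 := LieHom.mem_ker.1 hj
    have h3 := congrArg (matRep lam (n + 2) hn) hju
    rw [map_add, hj', zero_add, map_smul, map_one, map_pow] at h3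
    have h4 := ((U.isSl2Pair lam).map (matRep lam (n + 2) hn)).pow_eq_zero_of_eq_smul h3.symm
    rw [matRep_uY] at h4
    exact matY_pow_ne_zero (by omega) h4

theorem anti_raise (lam : ℂ) (i k : ℕ) : anti lam (raise (uX lam) i (uY lam ^ k)) =
    (-1 : ℂ) ^ k • raise (uX lam) i (uY lam ^ k) := by
  induction i with
  | zero =>
    rw [raise_zero, anti_uY_pow, ← neg_one_smul ℂ (1 : U lam), _root_.smul_pow, one_pow,
      smul_mul_assoc, one_mul]
  | succ i ih => rw [raise_succ, anti_lie_uX, ih, lie_smul]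

theorem osp_isOspTriple (lam t : ℂ) :
    IsOspTriple (t * lam ^ 2) t (ospX lam) (ospY lam) (ospZ lam t) :=
  IsOspTriple.of_injective (oSp lam).incl Subtype.val_injective (U.isOspTriple lam t)

theorem osp_exists_lowVec {t : ℂ} (ht : t ≠ 0) (lam : ℂ) (m : ℕ) : ∃ a : ℂ, a ≠ 0 ∧
    (oSp lam).incl (lowVec 6 (ospX lam) (ospY lam) (ospZ lam t) m) = a • uY lam ^ (2 * m + 1) := by
  rw [map_lowVec]
  exact (U.isSl2Pair lam).exists_lowVec_osp ht m

theorem osp_lowVec_ne_zero {t : ℂ} (ht : t ≠ 0) (lam : ℂ) (m : ℕ) :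
    lowVec 6 (ospX lam) (ospY lam) (ospZ lam t) m ≠ 0 := by
  intro h
  obtain ⟨a, ha, hm⟩ := osp_exists_lowVec ht lam m
  rw [h, map_zero, eq_comm, smul_eq_zero_iff_right ha] at hm
  exact uY_pow_ne_zero lam _ hm

/-- The map b ↦ b - τ(b) is multiplication by 2 on o/sp, and it annihilates (ad x)^i y^k for even k.
For odd k these elements are multiples of (ad x)^i Y_m. -/
theorem osp_evalHom_surjective {t : ℂ} (ht : t ≠ 0) (lam : ℂ) :
    Function.Surjective (evalHom (ospX lam) (ospY lam) (ospZ lam t)) := by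
  have key (b : U lam) : ∃ r, (oSp lam).incl (evalHom (ospX lam) (ospY lam) (ospZ lam t) r) =
      b - anti lam b := by
    induction b using U.induction with
    | h0 => exact ⟨0, by simp [anti]⟩
    | hadd a b ha hb =>
      obtain ⟨r, hr⟩ := ha
      obtain ⟨r', hr'⟩ := hb
      refine ⟨r + r', ?_⟩
      have h : anti lam (a + b) = anti lam a + anti lam b := by simp [anti]
      rw [map_add, map_add, hr, hr', h]
      abel
    | hsmul c a ha =>
      obtain ⟨r, hr⟩ := ha
      refine ⟨c • r, ?_⟩
      have h : anti lam (c • a) = c • anti lam a := by simp [anti]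
      rw [map_smul, map_smul, hr, h, smul_sub]
    | h k i =>
      rw [anti_raise]
      rcases Nat.even_or_odd' k with ⟨m, rfl | rfl⟩
      · exact ⟨0, by simp⟩
      · obtain ⟨a, ha, hm⟩ := osp_exists_lowVec ht lam m
        refine ⟨(2 * a⁻¹) • raise fX i (lowVec 6 fX fY genZ m), ?_⟩
        rw [map_smul, map_raise, map_lowVec, evalHom_fX, evalHom_fY, evalHom_genZ,
          map_smul]
        have h := map_raise (oSp lam).incl (ospX lam)
          (lowVec 6 (ospX lam) (ospY lam) (ospZ lam t) m) i
        rw [hm, raise_smul] at h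
        change _ = a • raise (uX lam) i _ at h
        rw [h, smul_smul, mul_assoc, inv_mul_cancel₀ ha]
        simp [pow_succ]
        module
  intro b
  obtain ⟨r, hr⟩ := key b
  have hb : anti lam b = -b := b.property
  refine ⟨(2 : ℂ)⁻¹ • r, Subtype.val_injective (?_ : (oSp lam).incl _ = (b : U lam))⟩
  rw [map_smul, map_smul, hr, hb]
  module

theorem isPresentedBy_osp {t : ℂ} (ht : t ≠ 0) (lam : ℂ) :
    IsPresentedBy (ospX lam) (ospY lam) (ospZ lam t) (relOsp lam t) := by
  rw [relOsp_eq]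
  exact isPresentedBy_ospRel_univ (osp_isOspTriple lam t) (osp_lowVec_ne_zero ht lam)
    (osp_evalHom_surjective ht lam)

/-- Only odd powers y^{2m+1} occur, and for N = 2n as well as for N = 2n + 1 the inequality 2m + 1 ≥
N means m ≥ n. Hence Y_n is the first to vanish and the exponent is n - 1 for both parities. -/
theorem isPresentedBy_ospInt {t : ℂ} (ht : t ≠ 0) (lam : ℂ) (n N : ℕ)
    (hN : lam ^ 2 = (N : ℂ) ^ 2) (h1 : 1 ≤ n) (hnN : N = 2 * n ∨ N = 2 * n + 1) :
    IsPresentedBy (toOspInt lam N hN (ospX lam)) (toOspInt lam N hN (ospY lam))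
      (toOspInt lam N hN (ospZ lam t)) (relOsp lam t ∪ {shear (n - 1)}) := by
  obtain ⟨n, rfl⟩ := Nat.exists_eq_add_of_le' h1
  rw [relOsp_eq, Nat.add_sub_cancel]
  change IsPresentedBy (quotHom (idealI lam N hN) (ospX lam)) (quotHom (idealI lam N hN) (ospY lam))
    (quotHom (idealI lam N hN) (ospZ lam t)) _
  have hz (m : ℕ) : quotHom (idealI lam N hN) (lowVec 6 (ospX lam) (ospY lam) (ospZ lam t) m) = 0 ↔
      matY N ^ (2 * m + 1) = 0 := by
    obtain ⟨a, ha, hm⟩ := osp_exists_lowVec ht lam m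
    rw [quotHom_eq_zero, idealI, LieHom.mem_ker, LieHom.comp_apply, hm]
    change matRep lam N hN (a • uY lam ^ (2 * m + 1)) = 0 ↔ _
    rw [map_smul, map_pow, matRep_uY, smul_eq_zero_iff_right ha]
  refine isPresentedBy_ospRel_shear ((osp_isOspTriple lam t).map _) n ?_ (fun m hmn h => ?_)
    (evalHom_surjective_of_surjective (osp_evalHom_surjective ht lam) (quotHom_surjective _))
  · rw [← map_lowVec, hz]
    exact matY_pow_eq_zero (by omega)
  · rw [← map_lowVec, hz] at h
    exact matY_pow_ne_zero (by omega) h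

end


/-! ### Polynomial functions on the hyperboloid -/

section

theorem toHyp_eq_zero {f : MvPolynomial (Fin 3) ℂ} : toHyp f = 0 ↔ ∃ g, f = hyperboloid * g :=
  quotHom_eq_zero (I := hyperboloidIdeal) (a := f)

theorem toHyp_add (f g : MvPolynomial (Fin 3) ℂ) : toHyp (f + g) = toHyp f + toHyp g := rfl

theorem toHyp_sub (f g : MvPolynomial (Fin 3) ℂ) : toHyp (f - g) = toHyp f - toHyp g := rfl

theorem toHyp_smul (c : ℂ) (f : MvPolynomial (Fin 3) ℂ) : toHyp (c • f) = c • toHyp f := rfl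

theorem toHyp_neg (f : MvPolynomial (Fin 3) ℂ) : toHyp (-f) = -toHyp f := rfl

theorem toHyp_eq {f f' : MvPolynomial (Fin 3) ℂ} (g : MvPolynomial (Fin 3) ℂ)
    (h : f - f' = hyperboloid * g) : toHyp f = toHyp f' := by
  rw [← sub_eq_zero, ← toHyp_sub]
  exact toHyp_eq_zero.2 ⟨g, h⟩

theorem toHyp_surjective : Function.Surjective toHyp :=
  quotHom_surjective hyperboloidIdeal

/-- The derivation `{x, -}` of polynomials. -/
noncomputable def poissonX : Module.End ℂ (MvPolynomial (Fin 3) ℂ) where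
  toFun := poisson (.X 0)
  map_add' := poisson_add_right _
  map_smul' c f := poisson_smul_right c _ f

theorem poissonX_apply (f : MvPolynomial (Fin 3) ℂ) : poissonX f = poisson (.X 0) f := rfl

theorem raise_toHyp (f : MvPolynomial (Fin 3) ℂ) (i : ℕ) :
    raise (toHyp (.X 0)) i (toHyp f) = toHyp ((poissonX ^ i) f) := by
  induction i with
  | zero => rfl
  | succ i ih => rw [raise_succ, ih, toHyp_lie, pow_succ']; rfl

theorem pderiv_ofNat (i : Fin 3) (n : ℕ) [n.AtLeastTwo] :
    MvPolynomial.pderiv i (ofNat(n) : MvPolynomial (Fin 3) ℂ) = 0 :=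
  (MvPolynomial.pderiv i).map_natCast n

theorem C_ofNat (n : ℕ) [n.AtLeastTwo] :
    (MvPolynomial.C (ofNat(n) : ℂ) : MvPolynomial (Fin 3) ℂ) = ofNat(n) :=
  map_ofNat _ n

/-- The commutative case ε = 0, with δ = {x, -}: the equation of the hyperboloid, h² + 4xy = 1,
plays the role of the Casimir relation. -/
theorem span_poissonX_pow_sup_eq_top :
    Submodule.span ℂ (Set.range fun v : ℕ × ℕ => (poissonX ^ v.2) (.X 1 ^ v.1)) ⊔
      LinearMap.range (LinearMap.mulLeft ℂ hyperboloid) = ⊤ := by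
  refine span_derivation_pow_eq_top (δ := poissonX) (x := .X 0) (y := .X 1) (h := .X 2) (ε := 0)
    (c := 1) (fun a b => ?_) ?_ ?_ ?_ ?_ ?_ ?_ (fun a => ?_) ?_
  · simp only [poissonX_apply, poisson, MvPolynomial.pderiv_mul]
    ring
  · simp [poissonX_apply, poisson]
  · simp [poissonX_apply, poisson]
  · simp [poissonX_apply, poisson, MvPolynomial.smul_eq_C_mul, C_ofNat]
  · simp [mul_comm]
  · rintro a _ ⟨g, rfl⟩
    exact ⟨a * g, mul_left_comm _ _ _⟩
  · rintro _ ⟨g, rfl⟩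
    exact ⟨poissonX g, (poisson_hyperboloid _ _).symm⟩
  · refine ⟨a, ?_⟩
    rw [LinearMap.mulLeft_apply, hyperboloid]
    simp [MvPolynomial.smul_eq_C_mul, C_ofNat]
    ring
  · rw [← MvPolynomial.adjoin_range_X]
    congr 1
    ext f
    simp [Fin.exists_fin_succ, eq_comm]

theorem toHyp_induction {p : HypFun → Prop} (h0 : p 0)
    (hadd : ∀ a b, p a → p b → p (a + b)) (hsmul : ∀ (c : ℂ) a, p a → p (c • a))
    (h : ∀ k i, p (raise (toHyp (.X 0)) i (toHyp (.X 1 ^ k)))) (a : HypFun) : p a := by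
  obtain ⟨f, rfl⟩ := toHyp_surjective a
  have hf : f ∈ Submodule.span ℂ (Set.range fun v : ℕ × ℕ => (poissonX ^ v.2) (.X 1 ^ v.1)) ⊔
      LinearMap.range (LinearMap.mulLeft ℂ hyperboloid) := span_poissonX_pow_sup_eq_top ▸ trivial
  obtain ⟨f, hf', _, ⟨g, rfl⟩, rfl⟩ := Submodule.mem_sup.1 hf
  rw [toHyp_add, LinearMap.mulLeft_apply, toHyp_eq_zero.2 ⟨g, rfl⟩, add_zero]
  clear hf
  induction hf' using Submodule.span_induction with
  | mem a ha =>
    obtain ⟨v, rfl⟩ := ha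
    have h1 := h v.1 v.2
    rwa [raise_toHyp] at h1
  | zero => exact h0
  | add a b _ _ ha hb => exact hadd _ _ ha hb
  | smul c a _ ha => exact hsmul c _ ha

theorem toHyp_X_one_pow_ne (k : ℕ) (c : ℂ) : toHyp (.X 1 ^ (k + 1)) ≠ c • toHyp 1 := by
  intro h
  rw [← toHyp_smul, ← sub_eq_zero, ← toHyp_sub, toHyp_eq_zero] at h
  obtain ⟨g, hg⟩ := h
  have h1 (s : ℂ) : s ^ (k + 1) - c = 0 := by
    -- The line x = 0, h = 1 lies on the hyperboloid, and the coordinate y takes all values s on it.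
    have h2 := congrArg (MvPolynomial.eval ![0, s, 1]) hg
    simpa [hyperboloid, MvPolynomial.smul_eval] using h2
  have h2 := h1 0
  have h3 := h1 1
  rw [zero_pow (Nat.succ_ne_zero k), zero_sub, neg_eq_zero] at h2
  rw [h2] at h3
  simp at h3

theorem toHyp_isSl2Pair : IsSl2Pair (toHyp (.X 0)) (toHyp (.X 1)) := by
  constructor
  · simp only [toHyp_lie, ← toHyp_smul]
    congr 1
    simp [poisson, MvPolynomial.smul_eq_C_mul, C_ofNat]
  · simp only [toHyp_lie, ← toHyp_smul, ← toHyp_neg]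
    congr 1
    simp [poisson, MvPolynomial.smul_eq_C_mul, C_ofNat]

theorem hyp_isSlTriple (t : ℂ) :
    IsSlTriple (t ^ 2) 0 (toHyp (.X 0)) (toHyp (.X 1)) (t • toHyp (.X 1 ^ 2)) := by
  have e0 : t • toHyp (.X 1 ^ 2) = toHyp (.C t * .X 1 ^ 2) := by
    rw [← toHyp_smul, MvPolynomial.smul_eq_C_mul]
  rw [e0]
  set z : MvPolynomial (Fin 3) ℂ := .C t * .X 1 ^ 2 with hz
  have e1 : raise (toHyp (.X 0)) 1 (toHyp z) =
      toHyp (.C t * (2 * .X 1 * .X 2)) := by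
    rw [raise_succ, raise_zero, toHyp_lie]
    congr 1
    simp [hz, poisson]
    ring
  have e2 : raise (toHyp (.X 0)) 2 (toHyp z) =
      toHyp (.C t * (2 * .X 2 ^ 2 - 4 * .X 0 * .X 1)) := by
    rw [raise_succ, e1, toHyp_lie]
    congr 1
    simp [poisson, pderiv_ofNat]
    ring
  have e3 : raise (toHyp (.X 0)) 3 (toHyp z) =
      toHyp (.C t * (-(12 * .X 0 * .X 2))) := by
    rw [raise_succ, e2, toHyp_lie]
    congr 1
    simp [poisson, pderiv_ofNat]
    ring
  have e4 : raise (toHyp (.X 0)) 4 (toHyp z) =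
      toHyp (.C t * (24 * .X 0 ^ 2)) := by
    rw [raise_succ, e3, toHyp_lie]
    congr 1
    simp [poisson, pderiv_ofNat]
    ring
  have hlow : IsLowest (toHyp (.X 0)) (toHyp (.X 1)) (toHyp z) 4 := by
    constructor
    · rw [toHyp_lie]
      refine toHyp_eq_zero.2 ⟨0, ?_⟩
      simp [hz, poisson]
    · simp only [toHyp_lie, ← toHyp_smul, ← toHyp_neg]
      congr 1
      simp [hz, poisson, MvPolynomial.smul_eq_C_mul, C_ofNat]
      ring
  refine ⟨⟨toHyp_isSl2Pair, hlow, ?_⟩, ?_, ?_, ?_⟩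
  · rw [raise_succ, e4, toHyp_lie]
    refine toHyp_eq_zero.2 ⟨0, ?_⟩
    simp [poisson, pderiv_ofNat]
  · rw [e1, e2, e3]
    simp only [toHyp_lie, ← toHyp_smul, ← toHyp_sub]
    -- The left-hand side of the relation is 24t²y(4xy + h²) as a polynomial; the cofactor of 4xy +
    -- h² - 1 is read off from this.
    refine toHyp_eq (24 * .C t ^ 2 * .X 1) ?_
    simp [hz, hyperboloid, poisson, pderiv_ofNat, MvPolynomial.smul_eq_C_mul, C_ofNat]
    ring
  · rw [e1]
    simp only [toHyp_lie]
    refine toHyp_eq_zero.2 ⟨0, ?_⟩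
    simp [hz, poisson, pderiv_ofNat]
  · rw [e1, e2, e3]
    simp only [toHyp_lie, ← toHyp_smul, ← toHyp_sub]
    refine toHyp_eq (576 * .C t ^ 3 * .X 1 ^ 2) ?_
    simp [hz, hyperboloid, poisson, pderiv_ofNat, MvPolynomial.smul_eq_C_mul, C_ofNat]
    ring

theorem hyp_isOspTriple (t : ℂ) :
    IsOspTriple (t) 0 (toHyp (.X 0)) (toHyp (.X 1)) (t • toHyp (.X 1 ^ 3)) := by
  have e0 : t • toHyp (.X 1 ^ 3) = toHyp (.C t * .X 1 ^ 3) := by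
    rw [← toHyp_smul, MvPolynomial.smul_eq_C_mul]
  rw [e0]
  set z : MvPolynomial (Fin 3) ℂ := .C t * .X 1 ^ 3 with hz
  have e1 : raise (toHyp (.X 0)) 1 (toHyp z) =
      toHyp (.C t * (3 * .X 1 ^ 2 * .X 2)) := by
    rw [raise_succ, raise_zero, toHyp_lie]
    congr 1
    simp [hz, poisson]
    ring
  have e2 : raise (toHyp (.X 0)) 2 (toHyp z) =
      toHyp (.C t * (6 * .X 1 * .X 2 ^ 2 - 6 * .X 0 * .X 1 ^ 2)) := by
    rw [raise_succ, e1, toHyp_lie]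
    congr 1
    simp [poisson, pderiv_ofNat]
    ring
  have e3 : raise (toHyp (.X 0)) 3 (toHyp z) =
      toHyp (.C t * (6 * .X 2 ^ 3 - 36 * .X 0 * .X 1 * .X 2)) := by
    rw [raise_succ, e2, toHyp_lie]
    congr 1
    simp [poisson, pderiv_ofNat]
    ring
  have e4 : raise (toHyp (.X 0)) 4 (toHyp z) =
      toHyp (.C t * (72 * .X 0 ^ 2 * .X 1 - 72 * .X 0 * .X 2 ^ 2)) := by
    rw [raise_succ, e3, toHyp_lie]
    congr 1
    simp [poisson, pderiv_ofNat]
    ring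
  have e5 : raise (toHyp (.X 0)) 5 (toHyp z) =
      toHyp (.C t * (360 * .X 0 ^ 2 * .X 2)) := by
    rw [raise_succ, e4, toHyp_lie]
    congr 1
    simp [poisson, pderiv_ofNat]
    ring
  have e6 : raise (toHyp (.X 0)) 6 (toHyp z) =
      toHyp (.C t * (-(720 * .X 0 ^ 3))) := by
    rw [raise_succ, e5, toHyp_lie]
    congr 1
    simp [poisson, pderiv_ofNat]
    ring
  have hlow : IsLowest (toHyp (.X 0)) (toHyp (.X 1)) (toHyp z) 6 := by
    constructor
    · rw [toHyp_lie]
      refine toHyp_eq_zero.2 ⟨0, ?_⟩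
      simp [hz, poisson]
    · simp only [toHyp_lie, ← toHyp_smul, ← toHyp_neg]
      congr 1
      simp [hz, poisson, MvPolynomial.smul_eq_C_mul, C_ofNat]
      ring
  refine ⟨⟨toHyp_isSl2Pair, hlow, ?_⟩, ?_, ?_, ?_, ?_⟩
  · rw [raise_succ, e6, toHyp_lie]
    refine toHyp_eq_zero.2 ⟨0, ?_⟩
    simp [poisson, pderiv_ofNat]
  · rw [e1, e2, e3]
    simp only [toHyp_lie, ← toHyp_smul, ← toHyp_sub]
    refine toHyp_eq (72 * .C t ^ 2 * .X 1 ^ 3) ?_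
    simp [hz, hyperboloid, poisson, pderiv_ofNat, MvPolynomial.smul_eq_C_mul, C_ofNat]
    ring
  · rw [e1, e2, e3, e4]
    simp only [toHyp_lie, ← toHyp_smul, ← toHyp_sub, ← toHyp_add]
    -- With S = 4xy + h², the left-hand side is 216tS z₂ + 432t²S²y. The last factor of the cofactor
    -- comes from S² - 1 = (S - 1)(S + 1).
    refine toHyp_eq (216 * .C t ^ 2 * (6 * .X 1 * .X 2 ^ 2 - 6 * .X 0 * .X 1 ^ 2) +
      432 * .C t ^ 2 * .X 1 * (4 * .X 0 * .X 1 + .X 2 ^ 2 + 1)) ?_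
    simp [hyperboloid, poisson, pderiv_ofNat, MvPolynomial.smul_eq_C_mul, C_ofNat]
    ring
  · rw [e1]
    simp only [toHyp_lie]
    refine toHyp_eq_zero.2 ⟨0, ?_⟩
    simp [hz, poisson, pderiv_ofNat]
  · rw [e1, e2, e3]
    simp only [toHyp_lie, ← toHyp_smul, ← toHyp_sub]
    refine toHyp_eq (720 * .C t * poisson z (.C t * (3 * .X 1 ^ 2 * .X 2))) ?_
    simp [hz, hyperboloid, poisson, pderiv_ofNat, MvPolynomial.smul_eq_C_mul, C_ofNat]
    ring

end

/-! ### The presentations of `sl(*)` and `o/sp(*)` -/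

section

theorem hyp_exists_lowVec_sl {t : ℂ} (ht : t ≠ 0) (m : ℕ) : ∃ a : ℂ, a ≠ 0 ∧
    lowVec 4 (toHyp (.X 0)) (toHyp (.X 1)) (t • toHyp (.X 1 ^ 2)) m =
      a • toHyp (.X 1 ^ (m + 1)) := by
  refine exists_lowVec_eq_smul (by decide) (fun m => toHyp (.X 1 ^ (m + 1)))
    (fun m => -(4 * t * (m + 1))) (fun m => ?_) (by rw [zero_add, pow_one]) (fun m => ?_) m
  · rw [neg_ne_zero]
    exact mul_ne_zero (mul_ne_zero (by norm_num) ht) (Nat.cast_add_one_ne_zero m)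
  · rw [raise_succ, raise_zero, lie_smul, toHyp_lie, smul_lie, toHyp_lie, ← toHyp_smul,
      ← toHyp_smul]
    congr 1
    simp [poisson, MvPolynomial.smul_eq_C_mul, C_ofNat, pderiv_ofNat]
    ring

theorem hyp_exists_lowVec_osp {t : ℂ} (ht : t ≠ 0) (m : ℕ) : ∃ a : ℂ, a ≠ 0 ∧
    lowVec 6 (toHyp (.X 0)) (toHyp (.X 1)) (t • toHyp (.X 1 ^ 3)) m =
      a • toHyp (.X 1 ^ (2 * m + 1)) := by
  refine exists_lowVec_eq_smul (by decide) (fun m => toHyp (.X 1 ^ (2 * m + 1)))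
    (fun m => -(6 * t * (2 * m + 1))) (fun m => ?_) (by rw [mul_zero, zero_add, pow_one])
    (fun m => ?_) m
  · rw [neg_ne_zero]
    exact mul_ne_zero (mul_ne_zero (by norm_num) ht)
      (by exact_mod_cast Nat.succ_ne_zero (2 * m))
  · rw [raise_succ, raise_zero, lie_smul, toHyp_lie, smul_lie, toHyp_lie, ← toHyp_smul,
      ← toHyp_smul]
    congr 1
    simp [poisson, MvPolynomial.smul_eq_C_mul, C_ofNat, pderiv_ofNat]
    ring

/-- The homomorphism from the functions on the hyperboloid to `sl(*)`. -/
noncomputable abbrev slStarHom : HypFun →ₗ⁅ℂ⁆ SlStar := quotHom constFun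

theorem slStar_isSlTriple (t : ℂ) :
    IsSlTriple (t ^ 2) 0 (toSlStar (.X 0)) (toSlStar (.X 1)) (t • toSlStar (.X 1 ^ 2)) :=
  (hyp_isSlTriple t).map slStarHom

theorem slStar_lowVec_ne_zero {t : ℂ} (ht : t ≠ 0) (m : ℕ) :
    lowVec 4 (toSlStar (.X 0)) (toSlStar (.X 1)) (t • toSlStar (.X 1 ^ 2)) m ≠ 0 := by
  intro h
  obtain ⟨a, ha, hm⟩ := hyp_exists_lowVec_sl ht m
  have h1 := map_lowVec slStarHom 4 (toHyp (.X 0)) (toHyp (.X 1)) (t • toHyp (.X 1 ^ 2)) m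
  rw [hm, map_smul slStarHom] at h1
  have h2 := (smul_eq_zero_iff_right ha).1 (h1.trans h)
  obtain ⟨c, hc⟩ := Submodule.mem_span_singleton.1 (quotHom_eq_zero.1 h2)
  exact toHyp_X_one_pow_ne m c hc.symm

theorem isPresentedBy_slStar {t : ℂ} (ht : t ≠ 0) :
    IsPresentedBy (toSlStar (.X 0)) (toSlStar (.X 1)) (t • toSlStar (.X 1 ^ 2))
      (relSlStar t) := by
  rw [relSlStar_eq]
  refine isPresentedBy_slRel_univ (slStar_isSlTriple t) (slStar_lowVec_ne_zero ht) ?_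
  rw [← LieHom.range_eq_top, eq_top_iff]
  intro b _
  obtain ⟨b, rfl⟩ := quotHom_surjective constFun b
  induction b using toHyp_induction with
  | h0 => rw [map_zero]; exact zero_mem _
  | hadd a b ha hb => rw [map_add]; exact add_mem (ha trivial) (hb trivial)
  | hsmul c a ha => rw [map_smul]; exact LieSubalgebra.smul_mem _ _ (ha trivial)
  | h k i =>
    rw [map_raise]
    refine raise_mem_range (a := toSlStar (.X 0)) ?_ i
    cases k with
    | zero =>
      rw [pow_zero, quotHom_eq_zero.2 (Submodule.mem_span_singleton_self _)]
      exact zero_mem _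
    | succ k =>
      obtain ⟨a, ha, hk⟩ := hyp_exists_lowVec_sl ht k
      have h1 := lowVec_mem_range 4 (toSlStar (.X 0)) (toSlStar (.X 1))
        (t • toSlStar (.X 1 ^ 2)) k
      have h2 := map_lowVec slStarHom 4 (toHyp (.X 0)) (toHyp (.X 1)) (t • toHyp (.X 1 ^ 2)) k
      rw [hk, map_smul slStarHom] at h2
      exact mem_of_smul_mem ha (h2.symm ▸ h1)

theorem ospStar_isOspTriple (t : ℂ) : IsOspTriple t 0 ospStarX ospStarY (ospStarZ t) :=
  IsOspTriple.of_injective oSpStar.incl Subtype.val_injective (hyp_isOspTriple t)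

theorem ospStar_exists_lowVec {t : ℂ} (ht : t ≠ 0) (m : ℕ) : ∃ a : ℂ, a ≠ 0 ∧
    oSpStar.incl (lowVec 6 ospStarX ospStarY (ospStarZ t) m) =
      a • toHyp (.X 1 ^ (2 * m + 1)) := by
  rw [map_lowVec]
  exact hyp_exists_lowVec_osp ht m

theorem ospStar_lowVec_ne_zero {t : ℂ} (ht : t ≠ 0) (m : ℕ) :
    lowVec 6 ospStarX ospStarY (ospStarZ t) m ≠ 0 := by
  intro h
  obtain ⟨a, ha, hm⟩ := ospStar_exists_lowVec ht m
  rw [h, map_zero, eq_comm, smul_eq_zero_iff_right ha] at hm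
  exact toHyp_X_one_pow_ne (2 * m) 0 (by rw [hm, zero_smul])

/-- The change of sign of the coordinates as a linear map on functions on the hyperboloid. -/
noncomputable def hypSign : HypFun →ₗ[ℂ] HypFun :=
  Submodule.liftQ _ ((quotHom hyperboloidIdeal : Pol →ₗ[ℂ] HypFun) ∘ₗ signChange.toLinearMap) (by
    rintro _ ⟨g, rfl⟩
    refine LinearMap.mem_ker.2 (toHyp_eq_zero.2 ⟨signChange g, ?_⟩)
    change signChange (hyperboloid * g) = _
    rw [map_mul]
    congr 1
    rw [hyperboloid, map_sub, map_add, map_mul, map_ofNat]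
    simp [signChange])

theorem hypSign_toHyp (f : MvPolynomial (Fin 3) ℂ) : hypSign (toHyp f) = toHyp (signChange f) :=
  rfl

theorem signChange_X (i : Fin 3) : signChange (.X i) = -.X i := by simp [signChange]

theorem hypSign_raise (i k : ℕ) : hypSign (raise (toHyp (.X 0)) i (toHyp (.X 1 ^ k))) =
    (-1 : ℂ) ^ k • raise (toHyp (.X 0)) i (toHyp (.X 1 ^ k)) := by
  rw [raise_toHyp, hypSign_toHyp, ← toHyp_smul]
  congr 1
  induction i with
  | zero =>
    change signChange (.X 1 ^ k) = (-1 : ℂ) ^ k • .X 1 ^ k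
    rw [map_pow, signChange_X, neg_pow, MvPolynomial.smul_eq_C_mul]
    simp
  | succ i ih =>
    rw [pow_succ', Module.End.mul_apply, ← map_smul poissonX, ← ih, poissonX_apply, poissonX_apply,
      poisson, poisson]
    simp only [map_add, map_sub, map_mul, signChange_X, pderiv_signChange, map_ofNat,
      MvPolynomial.pderiv_X]
    simp [signChange]

/-- The sign change of the coordinates plays the role of τ: it is (-1)^k on (ad x)^i y^k, so the
difference of a function and its sign change retains the odd k only. -/
theorem ospStar_evalHom_surjective {t : ℂ} (ht : t ≠ 0) :
    Function.Surjective (evalHom ospStarX ospStarY (ospStarZ t)) := by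
  have key (b : HypFun) : ∃ r, oSpStar.incl (evalHom ospStarX ospStarY (ospStarZ t) r) =
      b - hypSign b := by
    induction b using toHyp_induction with
    | h0 => exact ⟨0, by rw [map_zero, map_zero, map_zero, sub_zero]⟩
    | hadd a b ha hb =>
      obtain ⟨r, hr⟩ := ha
      obtain ⟨r', hr'⟩ := hb
      exact ⟨r + r', by rw [map_add, map_add, hr, hr', map_add]; abel⟩
    | hsmul c a ha =>
      obtain ⟨r, hr⟩ := ha
      exact ⟨c • r, by rw [map_smul, map_smul, hr, map_smul, smul_sub]⟩
    | h k i =>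
      rw [hypSign_raise]
      rcases Nat.even_or_odd' k with ⟨m, rfl | rfl⟩
      · refine ⟨0, ?_⟩
        rw [map_zero, map_zero, (even_two_mul m).neg_one_pow, one_smul, sub_self]
      · obtain ⟨a, ha, hm⟩ := ospStar_exists_lowVec ht m
        refine ⟨(2 * a⁻¹) • raise fX i (lowVec 6 fX fY genZ m), ?_⟩
        rw [map_smul, map_raise, map_lowVec, evalHom_fX, evalHom_fY, evalHom_genZ, map_smul]
        have h := map_raise oSpStar.incl ospStarX (lowVec 6 ospStarX ospStarY (ospStarZ t) m) i
        rw [hm, raise_smul] at h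
        change _ = a • raise (toHyp (.X 0)) i _ at h
        rw [h, smul_smul, mul_assoc, inv_mul_cancel₀ ha, (odd_two_mul_add_one m).neg_one_pow]
        module
  intro b
  obtain ⟨r, hr⟩ := key b
  obtain ⟨f, hf, hb⟩ := b.property
  have hb' : hypSign (b : HypFun) = -(b : HypFun) := by
    rw [← hb, hypSign_toHyp, hf, toHyp_neg]
  refine ⟨(2 : ℂ)⁻¹ • r, Subtype.val_injective (?_ : oSpStar.incl _ = (b : HypFun))⟩
  rw [map_smul, map_smul, hr, hb']
  module

theorem isPresentedBy_ospStar {t : ℂ} (ht : t ≠ 0) :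
    IsPresentedBy ospStarX ospStarY (ospStarZ t) (relOspStar t) := by
  rw [relOspStar_eq]
  exact isPresentedBy_ospRel_univ (ospStar_isOspTriple t) (ospStar_lowVec_ne_zero ht)
    (ospStar_evalHom_surjective ht)

/-! ### The limits -/

/-- For a family of relations with a normal form that presents Lie algebras in which the lowest
weight vectors are nonzero, the relations of the Lie algebra at `s = 0` are the limit, as
`lam → ∞`, of those of the Lie algebras at `s = 1 / lam`. -/
theorem limit_eq_of_isPresentedBy {N : ℕ} (hN : 3 ≤ N) {R : ℂ → Set Free} {L₀ : Type} [LieRing L₀]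
    [LieAlgebra ℂ L₀] {L : ℂ → Type} [∀ lam, LieRing (L lam)] [∀ lam, LieAlgebra ℂ (L lam)]
    {x₀ y₀ z₀ : L₀} {x y z : ∀ lam, L lam}
    (hnf : ∀ r, HasNormalForm N Set.univ (fun s => LieSubmodule.lieSpan ℂ Free (R s)) (fun _ => r))
    (hp₀ : IsPresentedBy x₀ y₀ z₀ (R 0)) (hs₀ : IsSl2Pair x₀ y₀)
    (hl₀ : ∀ m, IsLowest x₀ y₀ (lowVec N x₀ y₀ z₀ m) (lowWt N m))
    (hne₀ : ∀ m, lowVec N x₀ y₀ z₀ m ≠ 0)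
    (hp : ∀ lam ≠ 0, IsPresentedBy (x lam) (y lam) (z lam) (R lam⁻¹))
    (hs : ∀ lam ≠ 0, IsSl2Pair (x lam) (y lam))
    (hl : ∀ lam ≠ 0, ∀ m, IsLowest (x lam) (y lam) (lowVec N (x lam) (y lam) (z lam) m) (lowWt N m))
    (hne : ∀ lam ≠ 0, ∀ m, lowVec N (x lam) (y lam) (z lam) m ≠ 0) :
    {r | evalHom x₀ y₀ z₀ r = 0} =
      limitAtInfinity fun lam => {r | evalHom (x lam) (y lam) (z lam) r = 0} := by
  have h := eq_limitAtInfinity hnf (S := fun lam => {r | evalHom (x lam) (y lam) (z lam) r = 0})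
    (fun s c hc => ?_) (fun lam hlam => ?_)
  · rw [← h]
    ext r
    rw [Set.mem_ofPred_eq, SetLike.mem_coe, ← hp₀.2, LieHom.mem_ker]
  · by_cases h0 : s = 0
    · subst h0
      exact hp₀.eq_zero_of_mem (linearIndependent_map_vec hN hs₀ hl₀ fun m _ => hne₀ m) c hc
    · have h1 := inv_ne_zero h0
      have h2 := hp s⁻¹ h1
      rw [inv_inv] at h2
      exact h2.eq_zero_of_mem
        (linearIndependent_map_vec hN (hs _ h1) (hl _ h1) fun m _ => hne _ h1 m) c hc
  · ext r
    rw [Set.mem_ofPred_eq, SetLike.mem_coe, ← (hp lam hlam).2, LieHom.mem_ker]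

end

/-- With t/λ in place of t, the parameters (t²λ², t²) become (t², t²s²) for s = 1/λ: polynomial in
s, and dequantized at s = 0. -/
theorem slStar_eq_limitAtInfinity {t : ℂ} (ht : t ≠ 0) :
    {r | evalHom (toSlStar (.X 0)) (toSlStar (.X 1)) (t • toSlStar (.X 1 ^ 2)) r = 0} =
      limitAtInfinity fun lam => {r | evalHom (toSl lam (uX lam)) (toSl lam (uY lam))
        (toSl lam ((t / lam) • uY lam ^ 2)) r = 0} := by
  have ht' {lam : ℂ} (h : lam ≠ 0) : t / lam ≠ 0 := div_ne_zero ht h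
  refine limit_eq_of_isPresentedBy (N := 4) (by decide) (L := Sl)
    (x := fun lam => toSl lam (uX lam)) (y := fun lam => toSl lam (uY lam))
    (z := fun lam => toSl lam ((t / lam) • uY lam ^ 2))
    (R := fun s => slRel (t ^ 2) (t ^ 2 * s ^ 2))
    (hasNormalForm_slRel (C (t ^ 2)) (C (t ^ 2) * X ^ 2) (fun s r hr => ?_) (by simp)) ?_
    (slStar_isSlTriple t).pair (fun m => ((slStar_isSlTriple t).action m).low)
    -- The commutation relations of x and y do not involve z, so the triple with parameter 0
    -- provides them.
    (slStar_lowVec_ne_zero ht) (fun lam hlam => ?_) (fun lam _ => (sl_isSlTriple lam 0).pair)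
    (fun lam _ m => ((sl_isSlTriple lam _).action m).low)
    (fun lam hlam => sl_lowVec_ne_zero (ht' hlam) lam)
  · rw [eval_mul, eval_C, eval_pow, eval_X] at hr
    exact LieSubmodule.subset_lieSpan hr
  · have h := isPresentedBy_slStar ht
    rw [relSlStar_eq] at h
    simpa using h
  · have h := isPresentedBy_sl (ht' hlam) lam
    rw [relSl_eq, div_pow, div_mul_cancel₀ _ (pow_ne_zero 2 hlam), div_eq_mul_inv (t ^ 2),
      ← inv_pow] at h
    exact h

/-- With t/λ² in place of t, the parameters (tλ², t) become (t, ts²). The scaling differs from that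
of sl because here p is linear in t. -/
theorem ospStar_eq_limitAtInfinity {t : ℂ} (ht : t ≠ 0) :
    {r | evalHom ospStarX ospStarY (ospStarZ t) r = 0} =
      limitAtInfinity fun lam =>
        {r | evalHom (ospX lam) (ospY lam) (ospZ lam (t / lam ^ 2)) r = 0} := by
  have ht' {lam : ℂ} (h : lam ≠ 0) : t / lam ^ 2 ≠ 0 := div_ne_zero ht (pow_ne_zero 2 h)
  refine limit_eq_of_isPresentedBy (N := 6) (by decide) (L := fun lam => oSp lam)
    (x := ospX) (y := ospY) (z := fun lam => ospZ lam (t / lam ^ 2))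
    (R := fun s => ospRel t (t * s ^ 2))
    (hasNormalForm_ospRel (C t) (C t * X ^ 2) (fun s r hr => ?_) (by simp)) ?_
    (ospStar_isOspTriple t).pair (fun m => ((ospStar_isOspTriple t).action m).low)
    (ospStar_lowVec_ne_zero ht) (fun lam hlam => ?_) (fun lam _ => (osp_isOspTriple lam 0).pair)
    (fun lam _ m => ((osp_isOspTriple lam _).action m).low)
    (fun lam hlam => osp_lowVec_ne_zero (ht' hlam) lam)
  · rw [eval_mul, eval_C, eval_pow, eval_X] at hr
    exact LieSubmodule.subset_lieSpan hr
  · have h := isPresentedBy_ospStar ht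
    rw [relOspStar_eq] at h
    simpa using h
  · have h := isPresentedBy_osp (ht' hlam) lam
    rw [relOsp_eq, div_mul_cancel₀ _ (pow_ne_zero 2 hlam)] at h
    rwa [inv_pow, ← div_eq_mul_inv]

end ComplexSize

theorem theorem2p6 (t : ℂ) (ht : t ≠ 0) :
    -- The realization by differential operators is faithful.
    (∀ lam : ℂ, Function.Injective (ComplexSize.realization lam)) ∧
    -- `U lam` modulo constants, `lam ∈ ℂ`; this is `sl(lam)` unless `lam` is a nonzero integer.
    (∀ lam : ℂ,
      ComplexSize.IsPresentedBy
        (ComplexSize.toSl lam (ComplexSize.uX lam))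
        (ComplexSize.toSl lam (ComplexSize.uY lam))
        (ComplexSize.toSl lam (t • ComplexSize.uY lam ^ 2))
        (ComplexSize.relSl lam t)) ∧
    -- `sl(lam)` for an integer `lam = ± n`, with the dimension-shearing relation.
    (∀ (lam : ℂ) (n : ℕ) (hn : lam ^ 2 = (n : ℂ) ^ 2), 2 ≤ n →
      ComplexSize.IsPresentedBy
        (ComplexSize.toSlInt lam n hn (ComplexSize.uX lam))
        (ComplexSize.toSlInt lam n hn (ComplexSize.uY lam))
        (ComplexSize.toSlInt lam n hn (t • ComplexSize.uY lam ^ 2))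
        (ComplexSize.relSl lam t ∪ {ComplexSize.shear (n - 2)})) ∧
    -- `o/sp(lam)`, `lam ∈ ℂ`.
    (∀ lam : ℂ,
      ComplexSize.IsPresentedBy
        (ComplexSize.ospX lam) (ComplexSize.ospY lam) (ComplexSize.ospZ lam t)
        (ComplexSize.relOsp lam t)) ∧
    -- The quotients `sp(2n)` and `o(2n+1)` of `o/sp(lam)` for an integer `lam = ± N`, with the
    -- dimension-shearing relation.
    (∀ (lam : ℂ) (n N : ℕ) (hN : lam ^ 2 = (N : ℂ) ^ 2), 1 ≤ n → (N = 2 * n ∨ N = 2 * n + 1) →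
      ComplexSize.IsPresentedBy
        (ComplexSize.toOspInt lam N hN (ComplexSize.ospX lam))
        (ComplexSize.toOspInt lam N hN (ComplexSize.ospY lam))
        (ComplexSize.toOspInt lam N hN (ComplexSize.ospZ lam t))
        (ComplexSize.relOsp lam t ∪ {ComplexSize.shear (n - 1)})) ∧
    -- `sl(*)`.
    ComplexSize.IsPresentedBy
      (ComplexSize.toSlStar (.X 0)) (ComplexSize.toSlStar (.X 1))
      (t • ComplexSize.toSlStar (.X 1 ^ 2)) (ComplexSize.relSlStar t) ∧
    -- `o/sp(*)`.
    ComplexSize.IsPresentedBy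
      ComplexSize.ospStarX ComplexSize.ospStarY (ComplexSize.ospStarZ t)
      (ComplexSize.relOspStar t) ∧
    -- `sl(*)` and `o/sp(*)` are the limits as `lam → ∞`: their relations are the limits of the
    -- relations in `sl(lam)` and `o/sp(lam)` under `t ↦ t / lam` and `t ↦ t / lam ^ 2`.
    {r | ComplexSize.evalHom (ComplexSize.toSlStar (.X 0)) (ComplexSize.toSlStar (.X 1))
        (t • ComplexSize.toSlStar (.X 1 ^ 2)) r = 0} =
      ComplexSize.limitAtInfinity (fun lam =>
        {r | ComplexSize.evalHom (ComplexSize.toSl lam (ComplexSize.uX lam))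
          (ComplexSize.toSl lam (ComplexSize.uY lam))
          (ComplexSize.toSl lam ((t / lam) • ComplexSize.uY lam ^ 2)) r = 0}) ∧
    {r | ComplexSize.evalHom ComplexSize.ospStarX ComplexSize.ospStarY
        (ComplexSize.ospStarZ t) r = 0} =
      ComplexSize.limitAtInfinity (fun lam =>
        {r | ComplexSize.evalHom (ComplexSize.ospX lam) (ComplexSize.ospY lam)
          (ComplexSize.ospZ lam (t / lam ^ 2)) r = 0}) := by
  exact ⟨ComplexSize.realization_injective, ComplexSize.isPresentedBy_sl ht,
    ComplexSize.isPresentedBy_slInt ht, ComplexSize.isPresentedBy_osp ht,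
    ComplexSize.isPresentedBy_ospInt ht, ComplexSize.isPresentedBy_slStar ht,
    ComplexSize.isPresentedBy_ospStar ht, ComplexSize.slStar_eq_limitAtInfinity ht,
    ComplexSize.ospStar_eq_limitAtInfinity ht⟩
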